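/- **Setting.** Let $(M,d)$ be a locally compact separable metric space with a Borel measure $\mu$ that is finite on compact sets and strictly positive on non-empty open sets, and let $V(x,r)=\mu(B(x,r))$. Assume that $\mu$ is doubling, $V(x,2r)\lesssim V(x,r)$ for all $x\in M$, $r>0$, and let $\nu>0$ be such that $V(x,r)\lesssim (r/s)^{\nu}V(x,s)$ for all $x\in M$ and $r\ge s>0$. Function spaces are over $\mathbb R$ or over $\mathbb C$ (over $\mathbb R$, $\omega$-accretivity refers to the complexification of the operator). Let $L$ be an injective (maximal) $\omega$-accretive operator, $0\le\omega<\pi/2$, with dense domain $\mathcal D\subset L^2(M,\mu)$, and let $\Gamma$ be a bilinear operator with domain $\mathcal F\times\mathcal F$, where $\mathcal F\supset\mathcal D$ is a subspace of $L^2(M,\mu)$, with values in the measurable functions. Put $\Gamma(f):=|\Gamma(f,f)|^{1/2}$. Assume: * $|\Gamma(f,g)|\le\Gamma(f)\Gamma(g)$ a.e. for $f,g\in\mathcal F$, and $\|\Gamma(f)\|_2\lesssim\|L^{1/2}f\|_2$ for $f\in\mathcal D$; * $e^{-tL}$ has, for every $t>0$, a measurable kernel $p_t$ with $|p_t(x,y)|\lesssim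 V(x,\sqrt t)^{-1}\exp(-d(x,y)^2/(Ct))$ for a.e. $x,y$, with constants that do not depend on $t$; * $\|e^{-r^2L}\|_{L^2(B_1)\to L^2(B_2)}+\|r\,\Gamma e^{-r^2L}\|_{L^2(B_1)\to L^2(B_2)}\lesssim e^{-c\,d(B_1,B_2)^2/r^2}$ for all $r>0$ and all balls $B_1,B_2$ of radius $r$; * for every $t>0$ and all $f,g\in L^\infty(M,\mu)\cap\mathcal D$, almost everywhere, $$e^{-tL}L(fg)=e^{-tL}[Lf\cdot g]+e^{-tL}[f\cdot Lg]-2e^{-tL}\Gamma(f,g),$$ where $e^{-tL}L(fg)$ stands for $Le^{-tL}$ applied to $fg\in L^2$ and $e^{-tL}$ acts through its kernel on the right-hand side. **Notation.** For an integer $N\ge1$ let $c_N=\int_0^\infty s^Ne^{-s}\frac{ds}{s}$ and $\phi_N(x)=c_N^{-1}\int_x^\infty s^Ne^{-s}\frac{ds}{s}$ for $x\ge0$. Fix an integer $D>4\nu$ and, for $t>0$, put $Q_t=c_D^{-1}(tL)^De^{-tL}$ and $P_t=\phi_D(tL)$. For $p\in(1,\infty)$ let $\mathcal S^p$ be the set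 of all $f\in\mathcal C_0(M)\cap\mathcal F\cap L^p$, where $\mathcal C_0(M)$ is the space of continuous functions vanishing at infinity, such that $f=Lu$ and $h=Lf$ for some $u,h\in L^2\cap L^p$. **Lemma (Product decomposition).** Let $p\in(1,\infty)$ and $f,g\in\mathcal S^p$. For every $t>0$ the products $P_tf\cdot P_tg$, $Q_tf\cdot P_tg$ and $P_tf\cdot Q_tg$ lie in $L^2$, the functions $Q_t(P_tf\cdot P_tg)$, $P_t(Q_tf\cdot P_tg)$ and $P_t(Q_tg\cdot P_tf)$ lie in $L^p$, and the integrals $$\Pi(f,g)=\int_0^\infty Q_t(P_tf\cdot P_tg)\,\frac{dt}{t},\qquad \Pi_g(f)=\int_0^\infty P_t(Q_tf\cdot P_tg)\,\frac{dt}{t},\qquad \Pi_f(g)=\int_0^\infty P_t(Q_tg\cdot P_tf)\,\frac{dt}{t}$$ converge absolutely in $L^p(M,\mu)$. Moreover $fg\in L^p(M,\mu)$ and $$fg=\Pi(f,g)+\Pi_g(f)+\Pi_f(g)\qquad\text{in } L^p(M,\mu).$$ -/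

import Mathlib

open MeasureTheory Set Filter Topology TopologicalSpace
open scoped ENNReal NNReal ZeroAtInfty

noncomputable section

/-! ### Accretive operators and the semigroups they generate -/

section Operators

variable {𝕜 H : Type*} [RCLike 𝕜] [NormedAddCommGroup H] [InnerProductSpace 𝕜 H]

/-- `L` is a (maximal) `ω`-accretive operator: it is closed, its numerical range lies in the closed
sector of half-angle `ω` around the positive half-line, and so does its spectrum; given the
condition on the numerical range, the latter says that `s + L` is onto for all `s > 0`.

The field `sector` is the condition for the complexification `u + i v ↦ L u + i L v`, whose
numerical range consists of the numbers
`re ⟪u, L u⟫ + re ⟪v, L v⟫ + i (re ⟪u, L v⟫ - re ⟪v, L u⟫)`. In this form it makes sense for real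
scalars; for complex scalars it amounts to the usual condition on `⟪u, L u⟫`, as is shown in
`sector_iff_complex`. -/
structure IsOmegaAccretive (ω : ℝ) (L : H →ₗ.[𝕜] H) : Prop where
  closed : L.IsClosed
  re_nonneg : ∀ u : L.domain, 0 ≤ RCLike.re (inner 𝕜 (u : H) (L u))
  sector : ∀ u v : L.domain,
    |RCLike.re (inner 𝕜 (u : H) (L v)) - RCLike.re (inner 𝕜 (v : H) (L u))| ≤
      Real.tan ω * (RCLike.re (inner 𝕜 (u : H) (L u)) + RCLike.re (inner 𝕜 (v : H) (L v)))
  surjective : ∀ s : ℝ, 0 < s → ∀ y : H, ∃ u : L.domain, (s : 𝕜) • (u : H) + L u = y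

/-- Over `ℂ`, the field `sector` is the usual condition on the numerical range. -/
theorem sector_iff_complex {E : Type*} [NormedAddCommGroup E] [InnerProductSpace ℂ E]
    (ω : ℝ) (L : E →ₗ.[ℂ] E) :
    (∀ u v : L.domain,
      |RCLike.re (inner ℂ (u : E) (L v)) - RCLike.re (inner ℂ (v : E) (L u))| ≤
        Real.tan ω * (RCLike.re (inner ℂ (u : E) (L u)) + RCLike.re (inner ℂ (v : E) (L v)))) ↔
    ∀ u : L.domain,
      |(inner ℂ (u : E) (L u)).im| ≤ Real.tan ω * (inner ℂ (u : E) (L u)).re := by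
  constructor
  · intro h u
    have := h u (Complex.I • u)
    simp only [LinearPMap.map_smul, Submodule.coe_smul, inner_smul_left, inner_smul_right] at this
    simp only [RCLike.re_to_complex, Complex.mul_re, Complex.mul_im, Complex.I_re, Complex.I_im,
      Complex.conj_I, Complex.neg_re, Complex.neg_im] at this
    rw [abs_le] at this ⊢
    constructor <;> nlinarith [this.1, this.2]
  · intro h u v
    have h1 := h (u + Complex.I • v)
    have h2 := h (u - Complex.I • v)
    simp only [LinearPMap.map_smul, LinearPMap.map_add, LinearPMap.map_sub, Submodule.coe_add,
      Submodule.coe_sub, Submodule.coe_smul, inner_smul_left, inner_smul_right, inner_add_left,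
      inner_add_right, inner_sub_left, inner_sub_right] at h1 h2
    simp only [Complex.add_re, Complex.sub_re, Complex.add_im, Complex.sub_im,
      Complex.mul_re, Complex.mul_im, Complex.I_re, Complex.I_im,
      Complex.conj_I, Complex.neg_re, Complex.neg_im] at h1 h2
    simp only [RCLike.re_to_complex]
    rw [abs_le] at h1 h2 ⊢
    constructor <;> nlinarith [h1.1, h1.2, h2.1, h2.2]

/-- `S` (restricted to `[0, ∞)`) is a strongly continuous semigroup of bounded operators whose
infinitesimal generator is exactly `-L`, domain included. -/
structure IsSemigroupGeneratedByNeg (L : H →ₗ.[𝕜] H) (S : ℝ → H →L[𝕜] H) : Prop where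
  zero : S 0 = ContinuousLinearMap.id 𝕜 H
  add : ∀ s t : ℝ, 0 ≤ s → 0 ≤ t → S (s + t) = (S s).comp (S t)
  continuousOn : ∀ x : H, ContinuousOn (fun t => S t x) (Ici 0)
  generator : ∀ x y : H,
    Tendsto (fun t : ℝ => ((t⁻¹ : ℝ) : 𝕜) • (S t x - x)) (𝓝[>] 0) (𝓝 y) ↔
      ∃ hx : x ∈ L.domain, y = -L ⟨x, hx⟩

open Classical in
/-- The semigroup `e^{-tL}`, `t ≥ 0`: the strongly continuous semigroup generated by `-L`, which is
unique on `[0, ∞)` when it exists (and it exists for `ω`-accretive `L` with dense domain). -/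
def heatSemigroup (L : H →ₗ.[𝕜] H) : ℝ → H →L[𝕜] H :=
  if h : ∃ S, IsSemigroupGeneratedByNeg L S then h.choose else 0

open Classical in
/-- `L x` for `x` in the domain of `L`. -/
def opApply (L : H →ₗ.[𝕜] H) (x : H) : H :=
  if h : x ∈ L.domain then L ⟨x, h⟩ else 0

/-- `(tL)^k e^{-tL} x`. -/
def heatPow (L : H →ₗ.[𝕜] H) (k : ℕ) (t : ℝ) (x : H) : H :=
  ((t ^ k : ℝ) : 𝕜) • (opApply L)^[k] (heatSemigroup L t x)

/-- `c_N = ∫_0^∞ s^N e^{-s} ds/s`. -/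
def cN (N : ℕ) : ℝ := ∫ s in Ioi (0 : ℝ), s ^ N * Real.exp (-s) / s

/-- `φ_N(x) = c_N⁻¹ ∫_x^∞ s^N e^{-s} ds/s`. -/
def phiN (N : ℕ) (x : ℝ) : ℝ := (cN N)⁻¹ * ∫ s in Ioi x, s ^ N * Real.exp (-s) / s

/-- `Q_t^{(N)} = c_N⁻¹ (tL)^N e^{-tL}`. -/
def opQ (L : H →ₗ.[𝕜] H) (N : ℕ) (t : ℝ) (x : H) : H :=
  (((cN N)⁻¹ : ℝ) : 𝕜) • heatPow L N t x

/-- `P_t^{(N)} = φ_N(tL)`, for `N ≥ 1`. Since `φ_N(x) = ∑_{k < N} x^k e^{-x} / k!` (see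
`phiN_eq`), this is the operator `∑_{k < N} (tL)^k e^{-tL} / k!`. -/
def opP (L : H →ₗ.[𝕜] H) (N : ℕ) (t : ℝ) (x : H) : H :=
  ∑ k ∈ Finset.range N, (((k.factorial : ℝ)⁻¹ : ℝ) : 𝕜) • heatPow L k t x

/-- `L^{1/2} x = π^{-1/2} ∫_0^∞ t^{-1/2} L e^{-tL} x dt` for `x` in the domain of `L`. -/
def sqrtApply [NormedSpace ℝ H] (L : H →ₗ.[𝕜] H) (x : H) : H :=
  (Real.sqrt Real.pi)⁻¹ • ∫ t in Ioi (0 : ℝ), (t ^ (-(1 / 2) : ℝ)) • opApply L (heatSemigroup L t x)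

end Operators

theorem hasDerivAt_sum_pow_mul_exp_neg (n : ℕ) (x : ℝ) :
    HasDerivAt (fun x : ℝ => ∑ k ∈ Finset.range (n + 1),
      x ^ k * Real.exp (-x) / (k.factorial : ℝ)) (-(x ^ n * Real.exp (-x) / (n.factorial : ℝ))) x := by
  have he : HasDerivAt (fun x : ℝ => Real.exp (-x)) (-Real.exp (-x)) x := by
    simpa using (hasDerivAt_neg x).exp
  induction n with
  | zero => simpa using he
  | succ n ih =>
    have h1 := ((hasDerivAt_pow (n + 1) x).mul he).div_const ((n + 1).factorial : ℝ)
    have h2 := ih.add h1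
    refine (h2.congr_deriv ?_).congr_of_eventuallyEq (Eventually.of_forall fun y => ?_)
    · have hn : (n.factorial : ℝ) ≠ 0 := by exact_mod_cast n.factorial_ne_zero
      have hn1 : ((n : ℝ) + 1) ≠ 0 := by positivity
      rw [Nat.factorial_succ]
      push_cast
      field_simp
      ring
    · exact Finset.sum_range_succ _ _

theorem integral_Ioi_pow_mul_exp_neg (n : ℕ) (x : ℝ) (hx : 0 ≤ x) :
    ∫ s in Ioi x, s ^ (n + 1) * Real.exp (-s) / s =
      (n.factorial : ℝ) *
        ∑ k ∈ Finset.range (n + 1), x ^ k * Real.exp (-x) / (k.factorial : ℝ) := by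
  have hn : (n.factorial : ℝ) ≠ 0 := by exact_mod_cast n.factorial_ne_zero
  have h1 : ∫ s in Ioi x, s ^ (n + 1) * Real.exp (-s) / s = ∫ s in Ioi x, s ^ n * Real.exp (-s) := by
    refine setIntegral_congr_fun measurableSet_Ioi fun s hs => ?_
    have hs0 : s ≠ 0 := (hx.trans_lt hs).ne'
    field_simp
    ring
  have h2 : Tendsto (fun x : ℝ => -((n.factorial : ℝ) * ∑ k ∈ Finset.range (n + 1),
      x ^ k * Real.exp (-x) / (k.factorial : ℝ))) atTop (𝓝 0) := by
    have := (tendsto_finsetSum (Finset.range (n + 1)) fun k _ =>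
      (Real.tendsto_pow_mul_exp_neg_atTop_nhds_zero k).div_const (k.factorial : ℝ)).const_mul
        (n.factorial : ℝ) |>.neg
    simpa using this
  rw [h1, integral_Ioi_of_hasDerivAt_of_nonneg' (l := 0)
    (g := fun x : ℝ => -((n.factorial : ℝ) * ∑ k ∈ Finset.range (n + 1),
      x ^ k * Real.exp (-x) / (k.factorial : ℝ))) (fun y _ => ?_) (fun y hy => ?_) h2]
  · simp
  · refine ((hasDerivAt_sum_pow_mul_exp_neg n y).const_mul (n.factorial : ℝ)).neg.congr_deriv ?_
    field_simp
  · have : 0 ≤ y := hx.trans (le_of_lt hy)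
    positivity

theorem cN_eq (n : ℕ) : cN (n + 1) = n.factorial := by
  rw [cN, integral_Ioi_pow_mul_exp_neg n 0 le_rfl, Finset.sum_range_succ']
  simp

/-- The closed form of `φ_N` behind the definition of `P_t^{(N)}`. -/
theorem phiN_eq (N : ℕ) (hN : 0 < N) (x : ℝ) (hx : 0 ≤ x) :
    phiN N x = ∑ k ∈ Finset.range N, x ^ k * Real.exp (-x) / (k.factorial : ℝ) := by
  obtain ⟨n, rfl⟩ := Nat.exists_eq_succ_of_ne_zero hN.ne'
  have hn : (n.factorial : ℝ) ≠ 0 := by exact_mod_cast n.factorial_ne_zero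
  rw [phiN, Nat.succ_eq_add_one, cN_eq, integral_Ioi_pow_mul_exp_neg n x hx,
    inv_mul_cancel_left₀ hn]

/-! ### Metric measure spaces -/

section Space

variable {M : Type*} [MetricSpace M] [MeasurableSpace M]

/-- The doubling property `V(x, 2r) ≲ V(x, r)`. -/
def VolumeDoubling (μ : Measure M) : Prop :=
  ∃ C : ℝ≥0, ∀ (x : M) (r : ℝ), 0 < r → μ (Metric.ball x (2 * r)) ≤ C * μ (Metric.ball x r)

/-- `V(x, r) ≲ (r/s)^ν V(x, s)` for `r ≥ s > 0`. -/
def VolumeDimension (μ : Measure M) (ν : ℝ) : Prop :=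
  ∃ C : ℝ≥0, ∀ (x : M) (r s : ℝ), 0 < s → s ≤ r →
    μ (Metric.ball x r) ≤ C * ENNReal.ofReal ((r / s) ^ ν) * μ (Metric.ball x s)

/-- The distance `d(A, B) = inf {d(a, b) : a ∈ A, b ∈ B}` of two non-empty sets. -/
def setDist (A B : Set M) : ℝ := sInf (image2 dist A B)

end Space

/-! ### The setting -/

section Setting

variable {𝕜 M : Type*} [RCLike 𝕜] [MetricSpace M] [MeasurableSpace M] {μ : Measure M}

open Classical in
/-- The class in `L^p` of a function which is in `L^p`. -/
def lpClass (μ : Measure M) (p : ℝ≥0∞) (F : M → 𝕜) : Lp 𝕜 p μ :=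
  if h : MemLp F p μ then h.toLp F else 0

/-- The integral operator with kernel `k`. -/
def kernelApply (μ : Measure M) (k : M → M → 𝕜) (h : M → 𝕜) (x : M) : 𝕜 :=
  ∫ y, k x y * h y ∂μ

/-- `Γ(f) = |Γ(f, f)|^{1/2}`. -/
def gammaLength {F : Submodule ℝ (Lp 𝕜 2 μ)} (Γ : F →ₗ[ℝ] F →ₗ[ℝ] (M →ₘ[μ] 𝕜)) (f : F) (x : M) :
    ℝ :=
  Real.sqrt ‖Γ f f x‖

/-- The standing assumptions on the operator `L`, on the bilinear operator `Γ` with domain `F × F`,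
and on the kernel `k t` of `e^{-tL}`. -/
structure SobolevSetting (L : Lp 𝕜 2 μ →ₗ.[𝕜] Lp 𝕜 2 μ) (F : Submodule ℝ (Lp 𝕜 2 μ))
    (Γ : F →ₗ[ℝ] F →ₗ[ℝ] (M →ₘ[μ] 𝕜)) (k : ℝ → M → M → 𝕜) : Prop where
  /-- `L` is densely defined -/
  dense : Dense (L.domain : Set (Lp 𝕜 2 μ))
  /-- `L` is injective -/
  injective : ∀ u : L.domain, L u = 0 → u = 0
  /-- `L` is `ω`-accretive for some angle `ω < π/2` -/
  accretive : ∃ ω : ℝ, 0 ≤ ω ∧ ω < Real.pi / 2 ∧ IsOmegaAccretive ω L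
  domain_subset : ∀ u ∈ L.domain, u ∈ F
  /-- the Cauchy-Schwarz inequality for `Γ` -/
  gamma_le : ∀ f g : F, ∀ᵐ x ∂μ, ‖Γ f g x‖ ≤ gammaLength Γ f x * gammaLength Γ g x
  /-- `‖Γ f‖₂ ≲ ‖L^{1/2} f‖₂` on the domain of `L` -/
  riesz_two : ∃ C : ℝ≥0, ∀ f : F, (f : Lp 𝕜 2 μ) ∈ L.domain →
    eLpNorm (gammaLength Γ f) 2 μ ≤ C * ‖sqrtApply L (f : Lp 𝕜 2 μ)‖ₑ
  kernel_measurable : ∀ t : ℝ, 0 < t → Measurable (Function.uncurry (k t))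
  /-- `k t` is the kernel of `e^{-tL}` -/
  kernel_repr : ∀ t : ℝ, 0 < t → ∀ f : Lp 𝕜 2 μ,
    (heatSemigroup L t f : M → 𝕜) =ᵐ[μ] kernelApply μ (k t) f
  /-- the Gaussian upper estimates of the kernel -/
  kernel_bound : ∃ C c : ℝ, 0 < C ∧ 0 < c ∧ ∀ t : ℝ, 0 < t → ∀ᵐ x ∂μ, ∀ᵐ y ∂μ,
    ‖k t x y‖ ≤
      C / (μ (Metric.ball x (Real.sqrt t))).toReal * Real.exp (-(dist x y ^ 2 / (c * t)))
  /-- the `L²` Davies-Gaffney estimates of the semigroup and of its gradient -/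
  davies_gaffney : ∃ C c : ℝ, 0 < C ∧ 0 < c ∧ ∀ r : ℝ, 0 < r → ∀ (x₁ x₂ : M) (f : Lp 𝕜 2 μ),
    (∀ᵐ x ∂μ, x ∉ Metric.ball x₁ r → f x = 0) →
    ∀ u : F, (u : Lp 𝕜 2 μ) = heatSemigroup L (r ^ 2) f →
      eLpNorm (u : Lp 𝕜 2 μ) 2 (μ.restrict (Metric.ball x₂ r)) +
          ENNReal.ofReal r * eLpNorm (gammaLength Γ u) 2 (μ.restrict (Metric.ball x₂ r)) ≤
        ENNReal.ofReal
            (C * Real.exp (-(c * setDist (Metric.ball x₁ r) (Metric.ball x₂ r) ^ 2 / r ^ 2))) *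
          ‖f‖ₑ
  /-- the weak carré du champ identity
  `e^{-tL} L (fg) = e^{-tL} [Lf · g] + e^{-tL} [f · Lg] - 2 e^{-tL} Γ(f, g)`; the left-hand side is
  `L e^{-tL}` applied to `fg ∈ L²`, and `e^{-tL}` acts through its kernel on the right-hand side,
  where `Γ(f, g)` is only in `L¹` -/
  carre_du_champ : ∀ t : ℝ, 0 < t → ∀ f g : F,
    (f : Lp 𝕜 2 μ) ∈ L.domain → (g : Lp 𝕜 2 μ) ∈ L.domain →
    MemLp (f : Lp 𝕜 2 μ) ∞ μ → MemLp (g : Lp 𝕜 2 μ) ∞ μ →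
    ∀ᵐ x ∂μ,
      opApply L (heatSemigroup L t
          (lpClass μ 2 fun y => (f : Lp 𝕜 2 μ) y * (g : Lp 𝕜 2 μ) y)) x =
        kernelApply μ (k t) (fun y => opApply L (f : Lp 𝕜 2 μ) y * (g : Lp 𝕜 2 μ) y) x +
        kernelApply μ (k t) (fun y => (f : Lp 𝕜 2 μ) y * opApply L (g : Lp 𝕜 2 μ) y) x -
        2 * kernelApply μ (k t) (Γ f g) x

/-- The set `𝒮^p` of test functions: `f ∈ C₀(M) ∩ F ∩ L^p` with `f = L u` and `L f = h` for some
`u, h ∈ L² ∩ L^p`. -/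
structure IsTestFunction (L : Lp 𝕜 2 μ →ₗ.[𝕜] Lp 𝕜 2 μ) (F : Submodule ℝ (Lp 𝕜 2 μ)) (p : ℝ≥0∞)
    (f : Lp 𝕜 2 μ) : Prop where
  mem_C₀ : ∃ φ : C₀(M, 𝕜), f =ᵐ[μ] φ
  mem_F : f ∈ F
  memLp : MemLp f p μ
  eq_image : ∃ u : L.domain, L u = f ∧ MemLp (u : Lp 𝕜 2 μ) p μ
  image_memLp : ∃ hf : f ∈ L.domain, MemLp (L ⟨f, hf⟩) p μ

/-! ### Paraproducts -/

/-- `P_t (Q_t f · P_t g)`. -/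
def paraproductTerm (L : Lp 𝕜 2 μ →ₗ.[𝕜] Lp 𝕜 2 μ) (D : ℕ) (g f : Lp 𝕜 2 μ) (t : ℝ) : Lp 𝕜 2 μ :=
  opP L D t (lpClass μ 2 fun x => opQ L D t f x * opP L D t g x)

/-- `Q_t (P_t f · P_t g)`. -/
def resonantTerm (L : Lp 𝕜 2 μ →ₗ.[𝕜] Lp 𝕜 2 μ) (D : ℕ) (f g : Lp 𝕜 2 μ) (t : ℝ) : Lp 𝕜 2 μ :=
  opQ L D t (lpClass μ 2 fun x => opP L D t f x * opP L D t g x)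

/-- The `L^p`-valued (Bochner) integral `∫_0^∞ Φ(t) dt/t` of a family in `L² ∩ L^p`. -/
def lpIntegral (p : ℝ≥0∞) [Fact (1 ≤ p)] (Φ : ℝ → Lp 𝕜 2 μ) : Lp 𝕜 p μ :=
  ∫ t in Ioi (0 : ℝ), t⁻¹ • lpClass μ p (Φ t)

/-- `Φ(t) ∈ L^p` for all `t > 0` and `∫_0^∞ Φ(t) dt/t` converges absolutely in `L^p`. -/
def ConvergesAbsolutely (p : ℝ≥0∞) [Fact (1 ≤ p)] (Φ : ℝ → Lp 𝕜 2 μ) : Prop :=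
  (∀ t : ℝ, 0 < t → MemLp (Φ t) p μ) ∧
    IntegrableOn (fun t : ℝ => t⁻¹ • lpClass μ p (Φ t)) (Ioi 0)

/-- The paraproduct `Π_g(f) = ∫_0^∞ P_t (Q_t f · P_t g) dt/t` in `L^p`. -/
def paraproduct (L : Lp 𝕜 2 μ →ₗ.[𝕜] Lp 𝕜 2 μ) (D : ℕ) (p : ℝ≥0∞) [Fact (1 ≤ p)]
    (g f : Lp 𝕜 2 μ) : Lp 𝕜 p μ :=
  lpIntegral p (paraproductTerm L D g f)

/-- The resonant term `Π(f, g) = ∫_0^∞ Q_t (P_t f · P_t g) dt/t` in `L^p`. -/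
def resonant (L : Lp 𝕜 2 μ →ₗ.[𝕜] Lp 𝕜 2 μ) (D : ℕ) (p : ℝ≥0∞) [Fact (1 ≤ p)]
    (f g : Lp 𝕜 2 μ) : Lp 𝕜 p μ :=
  lpIntegral p (resonantTerm L D f g)

end Setting

end

/-! ### The Hille-Yosida theorem for maximal accretive operators -/

section HilleYosida

variable {𝕜 H : Type*} [RCLike 𝕜] [NormedAddCommGroup H] [InnerProductSpace 𝕜 H]

/-! Let W(t) = P_t(P_t f · P_t g). The sum that defines P_t telescopes under differentiation, t
dP_t/dt = -Q_t, so by the product rule -t W'(t) is the sum of the integrands of Π(f,g), Π_g(f) and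
Π_f(g) (`hasDerivAt_opP_prodClass`). In L², W(t) tends to fg as t → 0, and to 0 as t → ∞ because g =
Lv makes P_t g = O(1/t). The decomposition is thus the fundamental theorem of calculus, once the
three integrals converge absolutely in L^p. As W is a curve in L² and the integrals live in L^p, the
two sides are compared through their integrals over sets of finite measure
(`AdmissibleFamily.lpIntegral_eq`).

Convergence is a matter of interpolation: each integrand is bounded in L^∞ and O(min(t, 1/t)) in L¹,
hence O(min(t, 1/t)^{1/p}) in L^p, which is integrable for dt/t
(`AdmissibleFamily.convergesAbsolutely`). The decay 1/t comes from f = Lu and g = Lv. In the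
paraproducts, the factor t comes from Q_t f = O(t) in L² for f in the domain of L. The resonant term
contains no such factor, and P_t f · P_t g need not be in the domain of L; there the carré du champ
identity writes Le^{-tL} of the product as e^{-tL} acting on three L¹ functions that are controlled
by graph norms, with Γ estimated through L^{1/2}
(`SobolevSetting.exists_eLpNorm_one_opApply_prodClass_le`).

All this needs P_t and Q_t to be bounded on L¹ and L^∞ uniformly in t, hence the same for (tL)^k
e^{-tL}. For k = 0 these are the Gaussian estimates. For k = 1, a difference quotient of the
semigroup in time inherits spatial decay and differs from the derivative by a small error in L²;
choosing the time step according to the distance gives any polynomial decay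
(`HasGaussianKernel.exists_norm_heatPow_one_le_of_ball`). Larger k follow by composition. The L²
bounds of tLe^{-tL} come from an energy functional on the real time axis, which serves real and
complex scalars alike (`IsSemigroupGeneratedByNeg.sq_norm_le_of_mem`); the semigroup itself is built
by Yosida approximation. -/

theorem norm_le_of_re_inner_le {u v : H} (h : ‖u‖ ^ 2 ≤ RCLike.re (inner 𝕜 u v)) : ‖u‖ ≤ ‖v‖ := by
  have h1 := (h.trans (RCLike.re_le_norm _)).trans (norm_inner_le_norm u v)
  rcases (norm_nonneg u).eq_or_lt with h0 | h0
  · rw [← h0]; exact norm_nonneg _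
  · nlinarith

/-- The norm of a curve `y` with `Re ⟪y, y'⟫ ≤ 0` is decreasing. -/
theorem antitoneOn_norm_of_re_inner_nonpos [NormedSpace ℝ H] {y y' : ℝ → H}
    (hc : ContinuousOn y (Ici 0)) (hd : ∀ t, 0 < t → HasDerivAt y (y' t) t)
    (hn : ∀ t, 0 < t → RCLike.re (inner 𝕜 (y t) (y' t)) ≤ 0) :
    AntitoneOn (fun t => ‖y t‖) (Ici 0) := by
  have hd2 : ∀ t, 0 < t →
      HasDerivAt (fun t => ‖y t‖ ^ 2) (2 * RCLike.re (inner 𝕜 (y t) (y' t))) t := by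
    intro t ht
    have h := RCLike.reCLM.hasFDerivAt.comp_hasDerivAt t ((hd t ht).inner 𝕜 (hd t ht))
    refine (h.congr_deriv ?_).congr_of_eventuallyEq (Eventually.of_forall fun s => ?_)
    · rw [RCLike.reCLM_apply, map_add, ← inner_re_symm (y t) (y' t)]; ring
    · simp
  have h := antitoneOn_of_deriv_nonpos (convex_Ici 0) (hc.norm.pow 2)
    (fun t ht => (hd2 t (by simpa using ht)).differentiableAt.differentiableWithinAt)
    (fun t ht => by
      have ht : 0 < t := by simpa using ht
      have h := (hd2 t ht).deriv
      exact h.le.trans (by linarith [hn t ht]))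
  intro s hs t ht hst
  exact le_of_sq_le_sq (h hs ht hst) (norm_nonneg _)
where
  le_of_sq_le_sq {a b : ℝ} (h : a ^ 2 ≤ b ^ 2) (hb : 0 ≤ b) : a ≤ b := by
    nlinarith [abs_le_of_sq_le_sq' h hb]

theorem hasDerivAt_exp_smul_apply [CompleteSpace H] [NormedSpace ℝ H] [IsScalarTower ℝ 𝕜 H]
    (A : H →L[𝕜] H) (x : H) (t : ℝ) :
    HasDerivAt (fun s : ℝ => NormedSpace.exp ((s : 𝕜) • A) x)
      (A (NormedSpace.exp ((t : 𝕜) • A) x)) t := by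
  have h := (hasDerivAt_exp_smul_const' A (t : 𝕜)).clm_apply (hasDerivAt_const (t : 𝕜) x)
  have h2 := h.scomp t (RCLike.ofRealCLM (K := 𝕜)).hasDerivAt
  simpa [Function.comp_def] using h2

/-- `A` is dissipative: `Re ⟪x, A x⟫ ≤ 0`. -/
def Dissipative (A : H →L[𝕜] H) : Prop := ∀ x, RCLike.re (inner 𝕜 x (A x)) ≤ 0

theorem Dissipative.norm_exp_apply_le [CompleteSpace H] [NormedSpace ℝ H] [IsScalarTower ℝ 𝕜 H]
    {A : H →L[𝕜] H} (hA : Dissipative A) (x : H) {t : ℝ} (ht : 0 ≤ t) :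
    ‖NormedSpace.exp ((t : 𝕜) • A) x‖ ≤ ‖x‖ := by
  have h := antitoneOn_norm_of_re_inner_nonpos (𝕜 := 𝕜)
    (y := fun s : ℝ => NormedSpace.exp ((s : 𝕜) • A) x)
    (fun s _ => (hasDerivAt_exp_smul_apply A x s).continuousAt.continuousWithinAt)
    (fun s _ => hasDerivAt_exp_smul_apply A x s) (fun s _ => hA _)
    (self_mem_Ici (a := (0 : ℝ))) ht ht
  simpa using h

theorem exp_smul_apply_comm [CompleteSpace H] (A : H →L[𝕜] H) (x : H) (t : 𝕜) :
    NormedSpace.exp (t • A) (A x) = A (NormedSpace.exp (t • A) x) := by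
  have h : Commute A (NormedSpace.exp (t • A)) := ((Commute.refl A).smul_right t).exp_right
  exact congrArg (fun T : H →L[𝕜] H => T x) h.symm.eq

/-- The curve s ↦ e^{sA} e^{(t-s)B} x joins e^{tB} x to e^{tA} x. Since A and B commute, its
velocity is e^{sA} e^{(t-s)B} (Ax - Bx), and both exponentials are contractions. -/
theorem Dissipative.norm_exp_sub_le [CompleteSpace H] [NormedSpace ℝ H] [IsScalarTower ℝ 𝕜 H]
    {A B : H →L[𝕜] H} (hA : Dissipative A) (hB : Dissipative B) (hAB : Commute A B)
    (x : H) {t : ℝ} (ht : 0 ≤ t) :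
    ‖NormedSpace.exp ((t : 𝕜) • A) x - NormedSpace.exp ((t : 𝕜) • B) x‖ ≤ ‖A x - B x‖ * t := by
  set φ : 𝕜 → H := fun s => NormedSpace.exp (s • A) (NormedSpace.exp (((t : 𝕜) - s) • B) x)
    with hφ
  have hd : ∀ s : 𝕜, HasDerivAt φ (NormedSpace.exp (s • A)
      (NormedSpace.exp (((t : 𝕜) - s) • B) (A x - B x))) s := by
    intro s
    have h1 := hasDerivAt_exp_smul_const A s
    have h2 := (hasDerivAt_exp_smul_const B ((t : 𝕜) - s)).scomp s
      ((hasDerivAt_const s (t : 𝕜)).sub (hasDerivAt_id s))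
    have h3 := h1.clm_apply (h2.clm_apply (hasDerivAt_const s x))
    refine h3.congr_deriv ?_
    have hc : Commute A (NormedSpace.exp (((t : 𝕜) - s) • B)) :=
      (hAB.smul_right _).exp_right
    have hc' : A (NormedSpace.exp (((t : 𝕜) - s) • B) x) =
        NormedSpace.exp (((t : 𝕜) - s) • B) (A x) :=
      congrArg (fun T : H →L[𝕜] H => T x) hc.eq
    rw [sub_eq_add_neg] at hc'
    simp [sub_eq_add_neg, hc']
  have hd' : ∀ s : ℝ, HasDerivAt (fun s : ℝ => φ (s : 𝕜)) (NormedSpace.exp ((s : 𝕜) • A)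
      (NormedSpace.exp (((t : 𝕜) - s) • B) (A x - B x))) s := by
    intro s
    have h2 := (hd (s : 𝕜)).scomp s (RCLike.ofRealCLM (K := 𝕜)).hasDerivAt
    simpa [Function.comp_def] using h2
  have h := norm_image_sub_le_of_norm_deriv_le_segment' (a := 0) (b := t) (C := ‖A x - B x‖)
    (fun s _ => (hd' s).hasDerivWithinAt) (fun s hs => ?_) t ⟨ht, le_rfl⟩
  · simpa [hφ] using h
  · refine (hA.norm_exp_apply_le _ hs.1).trans ?_
    have := hB.norm_exp_apply_le (A x - B x) (t := t - s) (by linarith [hs.2])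
    simpa using this

/-- The resolvent `(s + L)⁻¹` of a maximal accretive operator. -/
theorem IsOmegaAccretive.exists_resolvent {ω : ℝ} {L : H →ₗ.[𝕜] H} (hL : IsOmegaAccretive ω L)
    {s : ℝ} (hs : 0 < s) :
    ∃ J : H →L[𝕜] H, (∀ y, ∃ h : J y ∈ L.domain, (s : 𝕜) • J y + L ⟨J y, h⟩ = y) ∧
      (∀ y, ‖J y‖ ≤ s⁻¹ * ‖y‖) ∧ ∀ u : L.domain, J ((s : 𝕜) • (u : H) + L u) = u := by
  -- In re ⟪su, su + Lu⟫ the cross term is nonnegative by accretivity. The resulting lower bound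
  -- gives both injectivity of s + L and the norm of its inverse.
  have hb : ∀ u : L.domain, ‖(u : H)‖ ≤ s⁻¹ * ‖(s : 𝕜) • (u : H) + L u‖ := by
    intro u
    have h1 : ‖(s : 𝕜) • (u : H)‖ ≤ ‖(s : 𝕜) • (u : H) + L u‖ := by
      refine norm_le_of_re_inner_le (𝕜 := 𝕜) ?_
      rw [inner_add_right, map_add, inner_self_eq_norm_sq, inner_smul_left, RCLike.conj_ofReal,
        RCLike.re_ofReal_mul]
      nlinarith [hL.re_nonneg u]
    rw [norm_smul, RCLike.norm_ofReal, abs_of_pos hs] at h1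
    rw [inv_mul_eq_div, le_div_iff₀ hs]; linarith
  let T : L.domain →ₗ[𝕜] H := (s : 𝕜) • L.domain.subtype + L.toFun
  have hT : ∀ u, T u = (s : 𝕜) • (u : H) + L u := fun u => rfl
  have hinj : Function.Injective T := by
    rw [injective_iff_map_eq_zero]
    intro u hu
    have h := hb u
    rw [← hT, hu, norm_zero, mul_zero] at h
    exact Subtype.ext (by simpa using h)
  let e := LinearEquiv.ofBijective T ⟨hinj, hL.surjective s hs⟩
  have he : ∀ y, (s : 𝕜) • (e.symm y : H) + L (e.symm y) = y := fun y => e.apply_symm_apply y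
  refine ⟨LinearMap.mkContinuous (L.domain.subtype ∘ₗ e.symm.toLinearMap) s⁻¹ fun y => ?_,
    fun y => ⟨(e.symm y).2, he y⟩, fun y => ?_, fun u => ?_⟩
  · have h := hb (e.symm y)
    rwa [he y] at h
  · have h := hb (e.symm y)
    rwa [he y] at h
  · exact congrArg Subtype.val (e.symm_apply_apply u)

/-- The Yosida approximation of `-L` by dissipative, commuting, bounded operators. -/
theorem IsOmegaAccretive.exists_yosida {ω : ℝ} {L : H →ₗ.[𝕜] H} (hL : IsOmegaAccretive ω L)
    (hd : Dense (L.domain : Set H)) :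
    ∃ A : ℕ → H →L[𝕜] H, (∀ n, Dissipative (A n)) ∧ (∀ n m, Commute (A n) (A m)) ∧
      ∀ u : L.domain, Tendsto (fun n => A n u) atTop (𝓝 (-L u)) := by
  have hpos : ∀ n : ℕ, 0 < (n : ℝ) + 1 := fun n => by positivity
  choose J hJ hJn hJL using fun n : ℕ => hL.exists_resolvent (hpos n)
  have hJm : ∀ n y, J n y ∈ L.domain := fun n y => (hJ n y).1
  have hJe : ∀ n y, L ⟨J n y, hJm n y⟩ = y - (((n : ℝ) + 1 : ℝ) : 𝕜) • J n y := fun n y => by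
    obtain ⟨h, h'⟩ := hJ n y
    rw [eq_sub_iff_add_eq, add_comm]; exact h'
  -- Resolvent identity: with z = J_n y and w = J_m z, the vector v = (a - b) w + z satisfies (b +
  -- L) v = y and (a + L) w = v. Hence J_m y = v and J_n J_m y = w = J_m J_n y.
  have hcomm : ∀ n m y, J n (J m y) = J m (J n y) := by
    intro n m y
    set a : 𝕜 := (((n : ℝ) + 1 : ℝ) : 𝕜)
    set b : 𝕜 := (((m : ℝ) + 1 : ℝ) : 𝕜)
    let w : L.domain := ⟨J m (J n y), hJm _ _⟩
    let z : L.domain := ⟨J n y, hJm _ _⟩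
    let v : L.domain := (a - b) • w + z
    have hw : L w = (z : H) - b • (w : H) := hJe m _
    have hz : L z = y - a • (z : H) := hJe n _
    have h1 : b • (v : H) + L v = y := by
      simp only [v, LinearPMap.map_add, LinearPMap.map_smul, hw, hz, Submodule.coe_add,
        Submodule.coe_smul]
      module
    have h2 : a • (w : H) + L w = v := by
      simp only [v, hw, Submodule.coe_add, Submodule.coe_smul]
      module
    have h3 : J m y = v := by rw [← h1]; exact hJL m v
    rw [h3, ← h2]; exact hJL n w
  -- This is -(n+1) L J_n. The shift to n + 1 keeps the resolvent parameter positive at n = 0.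
  let A : ℕ → H →L[𝕜] H := fun n =>
    (((n : ℝ) + 1 : ℝ) : 𝕜) • ((((n : ℝ) + 1 : ℝ) : 𝕜) • J n - 1)
  have hA : ∀ n x, A n x = (((n : ℝ) + 1 : ℝ) : 𝕜) • ((((n : ℝ) + 1 : ℝ) : 𝕜) • J n x - x) :=
    fun n x => rfl
  refine ⟨A, fun n x => ?_, fun n m => ?_, fun u => ?_⟩
  · have h0 : A n x = -((((n : ℝ) + 1 : ℝ) : 𝕜) • L ⟨J n x, hJm n x⟩) := by
      rw [hA, hJe]; module
    have h1 : x = (((n : ℝ) + 1 : ℝ) : 𝕜) • J n x + L ⟨J n x, hJm n x⟩ := by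
      rw [hJe]; module
    rw [h0]
    nth_rewrite 1 [h1]
    rw [inner_neg_right, inner_smul_right, inner_add_left, inner_smul_left, RCLike.conj_ofReal,
      map_neg, RCLike.re_ofReal_mul, map_add, RCLike.re_ofReal_mul, inner_self_eq_norm_sq]
    have h2 := hL.re_nonneg ⟨J n x, hJm n x⟩
    have := hpos n
    have h3 : 0 ≤ ((n : ℝ) + 1) * RCLike.re (inner 𝕜 (J n x) (L ⟨J n x, hJm n x⟩)) :=
      mul_nonneg this.le h2
    rw [Left.neg_nonpos_iff]
    positivity
  · have hc : Commute (J n) (J m) := by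
      ext y; exact hcomm n m y
    refine Commute.smul_left (Commute.smul_right ?_ _) _
    refine Commute.sub_left (Commute.sub_right ?_ (Commute.one_right _)) (Commute.one_left _)
    exact Commute.smul_left (Commute.smul_right hc _) _
  -- (n+1) J_n tends strongly to the identity: on the domain the error is -J_n(Lz), of size O(1/n),
  -- and (n+1) J_n is a contraction, so density suffices. On the domain, A_n u = -(n+1) J_n(Lu).
  · have hstrong : ∀ y : H, Tendsto (fun n : ℕ => (((n : ℝ) + 1 : ℝ) : 𝕜) • J n y) atTop (𝓝 y) := by
      intro y
      rw [Metric.tendsto_atTop]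
      intro ε hε
      obtain ⟨z, hz, hyz⟩ := Metric.mem_closure_iff.1 (hd y) (ε / 3) (by positivity)
      rw [dist_eq_norm] at hyz
      obtain ⟨N, hN⟩ := exists_nat_gt (‖L ⟨z, hz⟩‖ / (ε / 3))
      refine ⟨N, fun n hn => ?_⟩
      have hn' : (N : ℝ) ≤ n := by exact_mod_cast hn
      have hp := hpos n
      have h1 : ‖(((n : ℝ) + 1 : ℝ) : 𝕜) • J n (y - z)‖ ≤ ‖y - z‖ := by
        rw [norm_smul, RCLike.norm_ofReal, abs_of_pos hp]
        calc ((n : ℝ) + 1) * ‖J n (y - z)‖ ≤ ((n : ℝ) + 1) * (((n : ℝ) + 1)⁻¹ * ‖y - z‖) := by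
              gcongr; exact hJn n _
          _ = ‖y - z‖ := by field_simp
      have h2 : (((n : ℝ) + 1 : ℝ) : 𝕜) • J n z - z = -J n (L ⟨z, hz⟩) := by
        have : (((n : ℝ) + 1 : ℝ) : 𝕜) • J n z + J n (L ⟨z, hz⟩) = z := by
          simpa only [map_add, map_smul] using hJL n ⟨z, hz⟩
        rw [sub_eq_iff_eq_add, neg_add_eq_sub]; exact eq_sub_of_add_eq this
      have h3 : ‖J n (L ⟨z, hz⟩)‖ < ε / 3 := by
        refine (hJn n _).trans_lt ?_
        rw [div_lt_iff₀ (by positivity)] at hN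
        rw [inv_mul_eq_div, div_lt_iff₀ hp]
        nlinarith
      rw [dist_eq_norm]
      have h4 : (((n : ℝ) + 1 : ℝ) : 𝕜) • J n y - y =
          (((n : ℝ) + 1 : ℝ) : 𝕜) • J n (y - z) + (-J n (L ⟨z, hz⟩)) - (y - z) := by
        rw [← h2, map_sub, smul_sub]; abel
      rw [h4]
      refine (norm_sub_le _ _).trans_lt ?_
      have := norm_add_le ((((n : ℝ) + 1 : ℝ) : 𝕜) • J n (y - z)) (-J n (L ⟨z, hz⟩))
      rw [norm_neg] at this
      linarith
    have h1 : ∀ n, A n u = -((((n : ℝ) + 1 : ℝ) : 𝕜) • J n (L u)) := by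
      intro n
      have := hJL n u
      rw [map_add, map_smul] at this
      rw [hA]
      nth_rewrite 2 [← this]
      module
    simp only [h1]
    exact (hstrong (L u)).neg

theorem continuousOn_apply_of_dense {S : ℝ → H →L[𝕜] H} {s : Set ℝ} {D : Set H} (hD : Dense D)
    (hS : ∀ t ∈ s, ∀ x, ‖S t x‖ ≤ ‖x‖) (hc : ∀ x ∈ D, ContinuousOn (fun t => S t x) s) (x : H) :
    ContinuousOn (fun t => S t x) s := by
  intro t ht
  rw [Metric.continuousWithinAt_iff']
  intro ε hε
  obtain ⟨z, hz, hxz⟩ := Metric.mem_closure_iff.1 (hD x) (ε / 3) (by positivity)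
  rw [dist_eq_norm] at hxz
  have h1 := Metric.continuousWithinAt_iff'.1 (hc z hz t ht) (ε / 3) (by positivity)
  filter_upwards [h1, self_mem_nhdsWithin] with r hr hrs
  rw [dist_eq_norm] at hr ⊢
  have h2 : S r x - S t x = S r (x - z) + (S r z - S t z) - S t (x - z) := by
    simp only [map_sub]; abel
  rw [h2]
  have h3 := norm_sub_le (S r (x - z) + (S r z - S t z)) (S t (x - z))
  have h4 := norm_add_le (S r (x - z)) (S r z - S t z)
  linarith [hS r hrs (x - z), hS t ht (x - z)]

/-- The Hille-Yosida theorem: `-L` generates a strongly continuous semigroup. -/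
theorem IsOmegaAccretive.exists_semigroup [CompleteSpace H] [NormedSpace ℝ H] [IsScalarTower ℝ 𝕜 H]
    {ω : ℝ} {L : H →ₗ.[𝕜] H} (hL : IsOmegaAccretive ω L) (hd : Dense (L.domain : Set H)) :
    ∃ S, IsSemigroupGeneratedByNeg L S := by
  obtain ⟨A, hA, hAc, hAL⟩ := hL.exists_yosida hd
  set E : ℕ → ℝ → H →L[𝕜] H := fun n t => NormedSpace.exp ((t : 𝕜) • A n) with hE
  have hE1 : ∀ n t x, 0 ≤ t → ‖E n t x‖ ≤ ‖x‖ := fun n t x ht => (hA n).norm_exp_apply_le x ht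
  have hEsub : ∀ n t s x, 0 ≤ s → s ≤ t → ‖E n t x - E n s x‖ ≤ ‖A n x‖ * (t - s) := by
    intro n t s x hs hst
    refine norm_image_sub_le_of_norm_deriv_le_segment' (a := s) (b := t)
      (fun r _ => (hasDerivAt_exp_smul_apply (A n) x r).hasDerivWithinAt) (fun r hr => ?_) t
      ⟨hst, le_rfl⟩
    rw [← exp_smul_apply_comm]
    exact hE1 n r _ (hs.trans hr.1)
  have hEadd : ∀ n s t x, E n (s + t) x = E n s (E n t x) := by
    intro n s t x
    simp only [hE, RCLike.ofReal_add, add_smul]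
    let : NormedAlgebra ℚ (H →L[𝕜] H) := NormedAlgebra.restrictScalars ℚ 𝕜 _
    rw [NormedSpace.exp_add_of_commute (((Commute.refl (A n)).smul_left _).smul_right _)]
    rfl
  -- On the domain, `Dissipative.norm_exp_sub_le` and the convergence of A_n z make the sequence
  -- Cauchy; contractivity extends this to the closure.
  have hlim : ∀ t : ℝ, 0 ≤ t → ∀ x, ∃ y, Tendsto (fun n => E n t x) atTop (𝓝 y) := by
    intro t ht x
    refine cauchySeq_tendsto_of_complete ?_
    rw [Metric.cauchySeq_iff]
    intro ε hε
    obtain ⟨z, hz, hxz⟩ := Metric.mem_closure_iff.1 (hd x) (ε / 3) (by positivity)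
    rw [dist_eq_norm] at hxz
    obtain ⟨N, hN⟩ := Metric.cauchySeq_iff.1 ((hAL ⟨z, hz⟩).cauchySeq) (ε / (3 * (t + 1)))
      (by positivity)
    refine ⟨N, fun m hm n hn => ?_⟩
    have h1 := hN m hm n hn
    rw [dist_eq_norm] at h1 ⊢
    have h2 := (hA m).norm_exp_sub_le (hA n) (hAc m n) z ht
    have h3 : ‖A m z - A n z‖ * t < ε / 3 := by
      rw [lt_div_iff₀ (by positivity)] at h1
      simp only at h1
      nlinarith [norm_nonneg (A m z - A n z)]
    have h4 : E m t x - E n t x = E m t (x - z) + (E m t z - E n t z) - E n t (x - z) := by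
      simp only [map_sub]; abel
    rw [h4]
    have h5 := norm_sub_le (E m t (x - z) + (E m t z - E n t z)) (E n t (x - z))
    have h6 := norm_add_le (E m t (x - z)) (E m t z - E n t z)
    have h7 : ‖E m t z - E n t z‖ ≤ ‖A m z - A n z‖ * t := h2
    linarith [hE1 m t (x - z) ht, hE1 n t (x - z) ht]
  have hlim' : ∀ t : ℝ, ∃ T : H →L[𝕜] H, 0 ≤ t → ∀ x, Tendsto (fun n => E n t x) atTop (𝓝 (T x)) := by
    intro t
    by_cases ht : 0 ≤ t
    · choose f hf using hlim t ht
      exact ⟨continuousLinearMapOfTendsto (fun n => E n t) (tendsto_pi_nhds.2 hf), fun _ x => hf x⟩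
    · exact ⟨0, fun h => absurd h ht⟩
  choose S hS using hlim'
  have hS1 : ∀ t, 0 ≤ t → ∀ x, ‖S t x‖ ≤ ‖x‖ := fun t ht x =>
    le_of_tendsto (hS t ht x).norm (Eventually.of_forall fun n => hE1 n t x ht)
  have hS0 : S 0 = ContinuousLinearMap.id 𝕜 H := by
    ext x
    refine tendsto_nhds_unique (hS 0 le_rfl x) ?_
    simp [hE]
  have hSadd : ∀ s t : ℝ, 0 ≤ s → 0 ≤ t → S (s + t) = (S s).comp (S t) := by
    intro s t hs ht
    ext x
    refine tendsto_nhds_unique (hS _ (add_nonneg hs ht) x) ?_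
    have h1 : Tendsto (fun n => E n s (E n t x - S t x) + E n s (S t x)) atTop
        (𝓝 (0 + S s (S t x))) := by
      refine Tendsto.add ?_ (hS s hs _)
      refine squeeze_zero_norm (fun n => hE1 n s _ hs) ?_
      have := ((hS t ht x).sub_const (S t x)).norm
      simpa using this
    simpa [hEadd] using h1
  have hSlip : ∀ u : L.domain, ∀ s t, 0 ≤ s → s ≤ t → ‖S t u - S s u‖ ≤ ‖L u‖ * (t - s) := by
    intro u s t hs hst
    have h1 := (((hS t (hs.trans hst) (u : H)).sub (hS s hs (u : H))).norm)
    have h2 := ((hAL u).norm.mul_const (t - s))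
    rw [norm_neg] at h2
    exact le_of_tendsto_of_tendsto h1 h2 (Eventually.of_forall fun n => hEsub n t s u hs hst)
  have hScont : ∀ x : H, ContinuousOn (fun t => S t x) (Ici 0) := by
    refine continuousOn_apply_of_dense hd (fun t ht x => hS1 t ht x) fun x hx => ?_
    have : LipschitzOnWith (‖L ⟨x, hx⟩‖₊) (fun t => S t x) (Ici 0) := by
      refine LipschitzOnWith.of_dist_le_mul fun s hs t ht => ?_
      rw [dist_eq_norm, Real.dist_eq]
      rcases le_total s t with h | h
      · rw [norm_sub_rev, abs_sub_comm, abs_of_nonneg (sub_nonneg.2 h)]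
        exact hSlip ⟨x, hx⟩ s t hs h
      · rw [abs_of_nonneg (sub_nonneg.2 h)]
        exact hSlip ⟨x, hx⟩ t s ht h
    exact this.continuousOn
  have hgen : ∀ u : L.domain, Tendsto (fun t : ℝ => ((t⁻¹ : ℝ) : 𝕜) • (S t u - u)) (𝓝[>] 0)
      (𝓝 (-L u)) := by
    intro u
    -- The derivative of E_n(r)u - u - r A_n u is E_n(r) A_n u - A_n u. The vector -Lu need not lie
    -- in the domain, so it is replaced by a nearby w in the domain, on which E_n moves at speed at
    -- most ‖A_n w‖.
    have key : ∀ (w : L.domain) (h : ℝ), 0 ≤ h →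
        ‖S h u - u - (h : 𝕜) • (-L u)‖ ≤ (2 * ‖-L u - w‖ + ‖L w‖ * h) * h := by
      intro w h hh
      have h1 : Tendsto (fun n => ‖E n h u - u - (h : 𝕜) • A n u‖) atTop
          (𝓝 ‖S h u - u - (h : 𝕜) • (-L u)‖) :=
        (((hS h hh u).sub_const (u : H)).sub ((hAL u).const_smul (h : 𝕜))).norm
      have h2 : Tendsto (fun n => (2 * ‖A n u - w‖ + ‖A n w‖ * h) * h) atTop
          (𝓝 ((2 * ‖-L u - w‖ + ‖-L w‖ * h) * h)) :=
        (((((hAL u).sub_const (w : H)).norm).const_mul 2).add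
          ((hAL w).norm.mul_const h)).mul_const h
      rw [norm_neg] at h2
      refine le_of_tendsto_of_tendsto h1 h2 (Eventually.of_forall fun n => ?_)
      have hder : ∀ r : ℝ, HasDerivAt (fun r : ℝ => E n r u - u - (r : 𝕜) • A n u)
          (A n (E n r u) - A n u) r := by
        intro r
        have h3 : HasDerivAt (fun r : ℝ => (r : 𝕜) • A n u) (A n u) r := by
          have := ((hasDerivAt_id (r : 𝕜)).smul_const (A n u)).scomp r
            (RCLike.ofRealCLM (K := 𝕜)).hasDerivAt
          simpa [Function.comp_def] using this
        exact ((hasDerivAt_exp_smul_apply (A n) (u : H) r).sub_const (u : H)).sub h3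
      have h4 := norm_image_sub_le_of_norm_deriv_le_segment' (a := 0) (b := h)
        (C := 2 * ‖A n u - w‖ + ‖A n w‖ * h)
        (fun r _ => (hder r).hasDerivWithinAt) (fun r hr => ?_) h ⟨hh, le_rfl⟩
      · simpa [hE] using h4
      · have h5 : A n (E n r u) = E n r (A n u) := (exp_smul_apply_comm _ _ _).symm
        have h6 : E n r (A n u) - A n u =
            E n r (A n u - w) + (E n r w - w) - (A n u - w) := by
          simp only [map_sub]; abel
        rw [h5, h6]
        have h7 := norm_sub_le (E n r (A n u - w) + (E n r w - w)) (A n u - w)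
        have h8 := norm_add_le (E n r (A n u - w)) (E n r w - w)
        have h9 := hEsub n r 0 w le_rfl hr.1
        have h10 : E n 0 (w : H) = w := by simp [hE]
        rw [h10] at h9
        have h11 := hE1 n r (A n u - w) hr.1
        have h12 : ‖A n w‖ * (r - 0) ≤ ‖A n w‖ * h := by
          have := hr.2.le
          gcongr
          linarith
        linarith
    rw [Metric.tendsto_nhds]
    intro ε hε
    obtain ⟨w, hw, hwd⟩ := Metric.mem_closure_iff.1 (hd (-L u)) (ε / 4) (by positivity)
    rw [dist_eq_norm] at hwd
    have hδ : 0 < ε / (4 * (‖L ⟨w, hw⟩‖ + 1)) := by positivity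
    filter_upwards [Ioo_mem_nhdsGT hδ] with h hh
    have h1 := key ⟨w, hw⟩ h hh.1.le
    have h2 : ((h⁻¹ : ℝ) : 𝕜) • (S h u - u) - -L u =
        ((h⁻¹ : ℝ) : 𝕜) • (S h u - u - (h : 𝕜) • (-L u)) := by
      rw [smul_sub _ _ ((h : 𝕜) • (-L u)), smul_smul, ← RCLike.ofReal_mul,
        inv_mul_cancel₀ hh.1.ne', RCLike.ofReal_one, one_smul]
    rw [dist_eq_norm, h2, norm_smul, RCLike.norm_ofReal, abs_of_pos (inv_pos.2 hh.1),
      inv_mul_eq_div, div_lt_iff₀ hh.1]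
    refine h1.trans_lt (mul_lt_mul_of_pos_right ?_ hh.1)
    have h3 := hh.2
    rw [lt_div_iff₀ (by positivity)] at h3
    have := norm_nonneg (L ⟨w, hw⟩)
    nlinarith [hh.1]
  refine ⟨S, hS0, hSadd, hScont, fun x y => ⟨fun hxy => ?_, ?_⟩⟩
  -- The generator is not larger than -L: if x has limit y, pick u in the domain with u + Lu = x -
  -- y. The difference quotients at x - u then tend to y + Lu = x - u, while contractivity makes
  -- their inner product with x - u nonpositive in the limit. So x = u.
  · obtain ⟨u, hu⟩ := hL.surjective 1 one_pos (x - y)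
    rw [RCLike.ofReal_one, one_smul] at hu
    have h1 := hxy.sub (hgen u)
    have h2 : RCLike.re (inner 𝕜 (x - u) (y - -L u)) ≤ 0 := by
      have h3 : Tendsto (fun t : ℝ => RCLike.re (inner 𝕜 (x - u)
          (((t⁻¹ : ℝ) : 𝕜) • (S t x - x) - ((t⁻¹ : ℝ) : 𝕜) • (S t u - u)))) (𝓝[>] 0)
          (𝓝 (RCLike.re (inner 𝕜 (x - u) (y - -L u)))) :=
        (RCLike.continuous_re.tendsto _).comp (tendsto_const_nhds.inner h1)
      refine le_of_tendsto h3 ?_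
      filter_upwards [self_mem_nhdsWithin] with t ht
      have ht : 0 < t := ht
      have h4 : ((t⁻¹ : ℝ) : 𝕜) • (S t x - x) - ((t⁻¹ : ℝ) : 𝕜) • (S t u - u) =
          ((t⁻¹ : ℝ) : 𝕜) • (S t (x - u) - (x - u)) := by
        rw [map_sub]; module
      rw [h4, inner_smul_right, RCLike.re_ofReal_mul, inner_sub_right, map_sub,
        inner_self_eq_norm_sq]
      have h5 := (RCLike.re_le_norm _).trans (norm_inner_le_norm (𝕜 := 𝕜) (x - u) (S t (x - u)))
      have h6 := hS1 t ht.le (x - u)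
      have h7 : ‖x - u‖ * ‖S t (x - u)‖ ≤ ‖x - u‖ ^ 2 := by
        rw [sq]; gcongr
      refine mul_nonpos_of_nonneg_of_nonpos (inv_pos.2 ht).le (by linarith)
    have h3 : y - -L u = x - u := by
      rw [sub_neg_eq_add, sub_eq_iff_eq_add.1 hu.symm]; abel
    rw [h3, inner_self_eq_norm_sq] at h2
    have h4 : x = u := by
      have : ‖x - u‖ = 0 := by nlinarith [norm_nonneg (x - u)]
      exact sub_eq_zero.1 (norm_eq_zero.1 this)
    subst h4
    exact ⟨u.2, by rw [sub_self] at h3; exact sub_eq_zero.1 h3⟩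
  · rintro ⟨hx, rfl⟩
    exact hgen ⟨x, hx⟩

end HilleYosida

/-! ### Analyticity of the semigroup of a sectorial operator -/

section Analytic

variable {𝕜 H : Type*} [RCLike 𝕜] [NormedAddCommGroup H] [InnerProductSpace 𝕜 H]

theorem opApply_of_mem {L : H →ₗ.[𝕜] H} {x : H} (hx : x ∈ L.domain) : opApply L x = L ⟨x, hx⟩ :=
  dif_pos hx

theorem opApply_add {L : H →ₗ.[𝕜] H} {x y : H} (hx : x ∈ L.domain) (hy : y ∈ L.domain) :
    opApply L (x + y) = opApply L x + opApply L y := by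
  rw [opApply_of_mem hx, opApply_of_mem hy, opApply_of_mem (add_mem hx hy), ← LinearPMap.map_add]
  rfl

theorem opApply_smul {L : H →ₗ.[𝕜] H} {x : H} (c : 𝕜) (hx : x ∈ L.domain) :
    opApply L (c • x) = c • opApply L x := by
  rw [opApply_of_mem hx, opApply_of_mem (L.domain.smul_mem c hx), ← LinearPMap.map_smul]
  rfl

theorem opApply_sub {L : H →ₗ.[𝕜] H} {x y : H} (hx : x ∈ L.domain) (hy : y ∈ L.domain) :
    opApply L (x - y) = opApply L x - opApply L y := by
  rw [opApply_of_mem hx, opApply_of_mem hy, opApply_of_mem (sub_mem hx hy), ← LinearPMap.map_sub]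
  rfl

theorem opApply_sum {L : H →ₗ.[𝕜] H} {ι : Type*} (s : Finset ι) {x : ι → H}
    (hx : ∀ i, x i ∈ L.domain) : opApply L (∑ i ∈ s, x i) = ∑ i ∈ s, opApply L (x i) := by
  classical
  induction s using Finset.induction_on with
  | empty => simpa using opApply_smul (L := L) (0 : 𝕜) (zero_mem _)
  | insert i s hi ih =>
    rw [Finset.sum_insert hi, Finset.sum_insert hi,
      opApply_add (hx i) (sum_mem fun j _ => hx j), ih]

/-- A weighted Cauchy-Schwarz inequality for a form that is not symmetric. Accretivity at su ± v
controls the symmetric part re ⟪u, Lv⟫ + re ⟪v, Lu⟫, and the sector condition controls the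
antisymmetric part. -/
theorem IsOmegaAccretive.abs_re_inner_le {ω : ℝ} {L : H →ₗ.[𝕜] H} (hL : IsOmegaAccretive ω L)
    (u v : L.domain) (s : ℝ) :
    2 * s * |RCLike.re (inner 𝕜 (u : H) (L v))| ≤ (1 + Real.tan ω) *
      (s ^ 2 * RCLike.re (inner 𝕜 (u : H) (L u)) + RCLike.re (inner 𝕜 (v : H) (L v))) := by
  have h1 := hL.sector ((s : 𝕜) • u) v
  have h2 := hL.re_nonneg ((s : 𝕜) • u + v)
  have h3 := hL.re_nonneg ((s : 𝕜) • u - v)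
  simp only [LinearPMap.map_smul, LinearPMap.map_add, LinearPMap.map_sub, Submodule.coe_add,
    Submodule.coe_sub, Submodule.coe_smul, inner_smul_left, inner_smul_right, inner_add_left,
    inner_add_right, inner_sub_left, inner_sub_right, RCLike.conj_ofReal, map_add, map_sub,
    RCLike.re_ofReal_mul] at h1 h2 h3
  rw [abs_le] at h1
  rcases abs_cases (RCLike.re (inner 𝕜 (u : H) (L v))) with ⟨h, -⟩ | ⟨h, -⟩ <;> rw [h] <;> nlinarith

variable {L : H →ₗ.[𝕜] H} {S : ℝ → H →L[𝕜] H}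

namespace IsSemigroupGeneratedByNeg

variable (hS : IsSemigroupGeneratedByNeg L S)
include hS

/-- `S t` maps the difference quotients at x to those at `S t x`, and convergence of the latter
characterises the domain. -/
theorem apply_mem {x : H} (hx : x ∈ L.domain) {t : ℝ} (ht : 0 ≤ t) :
    ∃ h : S t x ∈ L.domain, L ⟨S t x, h⟩ = S t (L ⟨x, hx⟩) := by
  have h1 := (hS.generator x (-L ⟨x, hx⟩)).2 ⟨hx, rfl⟩
  have h2 := ((S t).continuous.tendsto _).comp h1
  obtain ⟨h, h'⟩ := (hS.generator (S t x) (S t (-L ⟨x, hx⟩))).1 <| h2.congr' <| by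
    filter_upwards [self_mem_nhdsWithin] with r hr
    have h3 : S r (S t x) = S t (S r x) := by
      have e1 := congrArg (fun T : H →L[𝕜] H => T x) (hS.add r t (le_of_lt hr) ht)
      have e2 := congrArg (fun T : H →L[𝕜] H => T x) (hS.add t r ht (le_of_lt hr))
      simp only [ContinuousLinearMap.comp_apply] at e1 e2
      rw [← e1, ← e2, add_comm]
    simp [h3]
  refine ⟨h, ?_⟩
  rw [map_neg] at h'
  exact (neg_inj.1 h').symm

theorem opApply_apply {x : H} (hx : x ∈ L.domain) {t : ℝ} (ht : 0 ≤ t) :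
    opApply L (S t x) = S t (opApply L x) := by
  obtain ⟨h, h'⟩ := hS.apply_mem hx ht
  rw [opApply_of_mem h, opApply_of_mem hx, h']

variable [NormedSpace ℝ H] [IsScalarTower ℝ 𝕜 H]

theorem hasDerivWithinAt {x : H} (hx : x ∈ L.domain) {t : ℝ} (ht : 0 ≤ t) :
    HasDerivWithinAt (fun t => S t x) (-S t (opApply L x)) (Ioi t) t := by
  rw [hasDerivWithinAt_iff_tendsto_slope' (by simp)]
  obtain ⟨h, h'⟩ := hS.apply_mem hx ht
  have h1 := (hS.generator (S t x) _).2 ⟨h, rfl⟩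
  rw [h', ← opApply_of_mem hx] at h1
  have h2 : Tendsto (fun s : ℝ => s - t) (𝓝[>] t) (𝓝[>] 0) := by
    refine tendsto_nhdsWithin_of_tendsto_nhds_of_eventually_within _ ?_ ?_
    · have : Tendsto (fun s : ℝ => s - t) (𝓝 t) (𝓝 (t - t)) := tendsto_id.sub_const t
      rw [sub_self] at this
      exact this.mono_left nhdsWithin_le_nhds
    · filter_upwards [self_mem_nhdsWithin] with s hs
      exact sub_pos.2 (mem_Ioi.1 hs)
  refine (h1.comp h2).congr' ?_
  filter_upwards [self_mem_nhdsWithin] with s hs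
  have hs : t < s := hs
  have h3 := congrArg (fun T : H →L[𝕜] H => T x) (hS.add (s - t) t (sub_pos.2 hs).le ht)
  simp only [ContinuousLinearMap.comp_apply, sub_add_cancel] at h3
  simp only [Function.comp_apply, ← h3, slope_def_module]
  rw [RCLike.real_smul_eq_coe_smul (K := 𝕜)]

variable [CompleteSpace H]

/-- The generator only gives right derivatives. Since the right derivative is continuous, the orbit
is the integral of it, and this integral is differentiable from both sides. -/
theorem hasDerivAt {x : H} (hx : x ∈ L.domain) {t : ℝ} (ht : 0 < t) :
    HasDerivAt (fun t => S t x) (-S t (opApply L x)) t := by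
  have hc : ContinuousOn (fun t => -S t (opApply L x)) (Ici 0) := (hS.continuousOn _).neg
  have hint : ∀ b, 0 ≤ b → IntervalIntegrable (fun t => -S t (opApply L x)) volume 0 b :=
    fun b hb => (hc.mono (by rw [uIcc_of_le hb]; exact Icc_subset_Ici_self)).intervalIntegrable
  have h1 : ∀ b, 0 ≤ b → (∫ s in (0 : ℝ)..b, -S s (opApply L x)) = S b x - S 0 x := by
    intro b hb
    refine intervalIntegral.integral_eq_sub_of_hasDeriv_right
      ((hS.continuousOn x).mono (by rw [uIcc_of_le hb]; exact Icc_subset_Ici_self))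
      (fun s hs => hS.hasDerivWithinAt hx ?_) (hint b hb)
    rw [min_eq_left hb] at hs
    exact hs.1.le
  have hnhds : Ici (0 : ℝ) ∈ 𝓝 t := Ici_mem_nhds ht
  have h2 := intervalIntegral.integral_hasDerivAt_right (hint t ht.le)
    (hc.stronglyMeasurableAtFilter_nhdsWithin measurableSet_Ici t |>.filter_mono
      (le_of_eq (nhdsWithin_eq_nhds.2 hnhds).symm)) (hc.continuousAt hnhds)
  refine (h2.add_const (S 0 x)).congr_of_eventuallyEq ?_
  filter_upwards [hnhds] with s hs
  rw [h1 s hs, sub_add_cancel]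

theorem norm_apply_le {ω : ℝ} (hL : IsOmegaAccretive ω L) (hd : Dense (L.domain : Set H))
    (x : H) {t : ℝ} (ht : 0 ≤ t) : ‖S t x‖ ≤ ‖x‖ := by
  refine hd.induction (P := fun x => ‖S t x‖ ≤ ‖x‖) (fun x hx => ?_)
    (isClosed_le (S t).continuous.norm continuous_norm) x
  have h := antitoneOn_norm_of_re_inner_nonpos (𝕜 := 𝕜) (hS.continuousOn x)
    (fun s hs => hS.hasDerivAt hx hs) (fun s hs => ?_) (self_mem_Ici (a := (0 : ℝ))) ht ht
  · simpa [hS.zero] using h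
  · obtain ⟨h, h'⟩ := hS.apply_mem hx hs.le
    rw [opApply_of_mem hx, ← h', inner_neg_right, map_neg, Left.neg_nonpos_iff]
    exact hL.re_nonneg ⟨S s x, h⟩

/-- With z = Lx, the energy ‖S_t x‖² + a t re ⟪S_t x, S_t z⟫ + (a/2) t² ‖S_t z‖² is decreasing for a
suitable a > 0. It equals ‖x‖² at t = 0 and dominates its last term. No complex times are needed. -/
theorem sq_norm_le_of_mem {ω : ℝ} (hω : 0 ≤ ω) (hω' : ω < Real.pi / 2)
    (hL : IsOmegaAccretive ω L) {x : H}
    (hx : x ∈ L.domain) (hx2 : opApply L x ∈ L.domain) {t : ℝ} (ht : 0 < t) :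
    t ^ 2 * ‖S t (opApply L x)‖ ^ 2 ≤ (1 + (1 + Real.tan ω) ^ 2 / 4) * ‖x‖ ^ 2 := by
  set K := 1 + Real.tan ω with hK
  have hK1 : 1 ≤ K := by have := Real.tan_nonneg_of_nonneg_of_le_pi_div_two hω hω'.le; linarith
  -- In E' the two terms in ‖S_t z‖² cancel, and what remains is at most (a + aK²/4 - 2) re ⟪S_t x,
  -- S_t z⟫. This a is the value for which the bracket vanishes.
  set a := 2 / (1 + K ^ 2 / 4) with ha
  have ha0 : 0 < a := by positivity
  have haK : a * (1 + K ^ 2 / 4) = 2 := by rw [ha]; field_simp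
  set z := opApply L x with hz
  set w := opApply L z with hw
  set E : ℝ → ℝ := fun t => ‖S t x‖ ^ 2 + a * (t * RCLike.re (inner 𝕜 (S t x) (S t z))) +
    a / 2 * (t ^ 2 * ‖S t z‖ ^ 2) with hE
  have hsq : ∀ (y y' : H), y ∈ L.domain → y' = opApply L y → ∀ t, 0 < t →
      HasDerivAt (fun t => ‖S t y‖ ^ 2) (-2 * RCLike.re (inner 𝕜 (S t y) (S t y'))) t := by
    rintro y y' hy rfl t ht
    have h := RCLike.reCLM.hasFDerivAt.comp_hasDerivAt t
      ((hS.hasDerivAt hy ht).inner 𝕜 (hS.hasDerivAt hy ht))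
    refine (h.congr_deriv ?_).congr_of_eventuallyEq (Eventually.of_forall fun s => ?_)
    · rw [RCLike.reCLM_apply, map_add, inner_neg_right, inner_neg_left, map_neg, map_neg,
        ← inner_re_symm (S t y)]
      ring
    · simp
  have hq : ∀ t, 0 < t → HasDerivAt (fun t => RCLike.re (inner 𝕜 (S t x) (S t z)))
      (-RCLike.re (inner 𝕜 (S t x) (S t w)) - ‖S t z‖ ^ 2) t := by
    intro t ht
    have h := RCLike.reCLM.hasFDerivAt.comp_hasDerivAt t
      ((hS.hasDerivAt hx ht).inner 𝕜 (hS.hasDerivAt hx2 ht))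
    refine h.congr_deriv ?_
    rw [RCLike.reCLM_apply, map_add, inner_neg_right, inner_neg_left, map_neg, map_neg,
      inner_self_eq_norm_sq]
    ring
  have hEd : ∀ t, 0 < t → HasDerivAt E (-2 * RCLike.re (inner 𝕜 (S t x) (S t z)) +
      a * (RCLike.re (inner 𝕜 (S t x) (S t z)) +
        t * (-RCLike.re (inner 𝕜 (S t x) (S t w)) - ‖S t z‖ ^ 2)) +
      a / 2 * (2 * t * ‖S t z‖ ^ 2 + t ^ 2 * (-2 * RCLike.re (inner 𝕜 (S t z) (S t w))))) t := by
    intro t ht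
    have h1 := (hasDerivAt_id t).mul (hq t ht)
    have h2 := (hasDerivAt_pow 2 t).mul (hsq z w hx2 hw t ht)
    refine (((hsq x z hx hz t ht).add (h1.const_mul a)).add (h2.const_mul (a / 2))).congr_deriv ?_
    simp
  have hEc : ContinuousOn E (Ici 0) := by
    have h1 := hS.continuousOn x
    have h2 := hS.continuousOn z
    refine ((h1.norm.pow 2).add (ContinuousOn.mul continuousOn_const (continuousOn_id.mul ?_))).add
      (ContinuousOn.mul continuousOn_const ((continuousOn_id.pow 2).mul (h2.norm.pow 2)))
    exact RCLike.continuous_re.comp_continuousOn (h1.inner h2)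
  have hqx : ∀ t, 0 ≤ t → 0 ≤ RCLike.re (inner 𝕜 (S t x) (S t z)) := by
    intro t ht
    obtain ⟨h, h'⟩ := hS.apply_mem hx ht
    rw [hz, opApply_of_mem hx, ← h']
    exact hL.re_nonneg ⟨S t x, h⟩
  have hanti := antitoneOn_of_deriv_nonpos (convex_Ici 0) hEc
    (fun t ht => (hEd t (by simpa using ht)).differentiableAt.differentiableWithinAt)
    (fun t ht => by
      have ht : 0 < t := by simpa using ht
      rw [(hEd t ht).deriv]
      obtain ⟨h, h'⟩ := hS.apply_mem hx ht.le
      obtain ⟨h2, h2'⟩ := hS.apply_mem hx2 ht.le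
      -- The weight s = K/(2t) is the one for which the coefficient of q2 in the bound of t|R| is
      -- exactly t², to be absorbed by the term -a t² q2 of E'.
      have h3 := hL.abs_re_inner_le ⟨S t x, h⟩ ⟨S t z, h2⟩ (K / 2 / t)
      rw [h', h2', ← opApply_of_mem hx, ← opApply_of_mem hx2, ← hz, ← hw, ← hK] at h3
      set q1 := RCLike.re (inner 𝕜 (S t x) (S t z))
      set q2 := RCLike.re (inner 𝕜 (S t z) (S t w))
      set R := RCLike.re (inner 𝕜 (S t x) (S t w))
      have h4 : t * |R| ≤ K ^ 2 / 4 * q1 + t ^ 2 * q2 := by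
        have h5 := mul_le_mul_of_nonneg_left h3 (a := t ^ 2 / K) (by positivity)
        have e1 : t ^ 2 / K * (2 * (K / 2 / t) * |R|) = t * |R| := by field_simp
        have e2 : t ^ 2 / K * (K * ((K / 2 / t) ^ 2 * q1 + q2)) = K ^ 2 / 4 * q1 + t ^ 2 * q2 := by
          field_simp; ring
        rwa [e1, e2] at h5
      have h6 : -R ≤ |R| := neg_le_abs R
      have h7 : a * (t * -R) ≤ a * (K ^ 2 / 4 * q1 + t ^ 2 * q2) := by
        refine mul_le_mul_of_nonneg_left (le_trans ?_ h4) ha0.le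
        exact mul_le_mul_of_nonneg_left h6 ht.le
      have h8 : a * (1 + K ^ 2 / 4) * q1 = 2 * q1 := by rw [haK]
      nlinarith)
    (self_mem_Ici (a := (0 : ℝ))) (mem_Ici.2 ht.le) ht.le
  have hE0 : E 0 = ‖x‖ ^ 2 := by simp [hE, hS.zero]
  rw [hE0] at hanti
  have h9 : a / 2 * (t ^ 2 * ‖S t z‖ ^ 2) ≤ ‖x‖ ^ 2 := by
    refine le_trans ?_ hanti
    simp only [hE]
    have := mul_nonneg ha0.le (mul_nonneg ht.le (hqx t ht.le))
    nlinarith [sq_nonneg ‖S t x‖]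
  have h10 := mul_le_mul_of_nonneg_left h9 (a := 1 + K ^ 2 / 4) (by positivity)
  calc t ^ 2 * ‖S t z‖ ^ 2 = (1 + K ^ 2 / 4) * (a / 2 * (t ^ 2 * ‖S t z‖ ^ 2)) := by
        linear_combination (-(1 / 2) * (t ^ 2 * ‖S t z‖ ^ 2)) * haK
    _ ≤ _ := h10

/-- The bound of S_t L is known on the domain of L², which is dense because the resolvent has dense
range and maps the domain of L into it. Approximating x by such vectors makes S_t L y_n Cauchy, and
L is closed. -/
theorem apply_mem_domain {ω : ℝ} (hω : 0 ≤ ω) (hω' : ω < Real.pi / 2)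
    (hL : IsOmegaAccretive ω L) (hd : Dense (L.domain : Set H)) (x : H) {t : ℝ} (ht : 0 < t) :
    ∃ h : S t x ∈ L.domain, ‖L ⟨S t x, h⟩‖ ≤
      √(1 + (1 + Real.tan ω) ^ 2 / 4) / t * ‖x‖ := by
  set C := √(1 + (1 + Real.tan ω) ^ 2 / 4) with hC
  have hC0 : 0 ≤ C := Real.sqrt_nonneg _
  have hC2 : C ^ 2 = 1 + (1 + Real.tan ω) ^ 2 / 4 := Real.sq_sqrt (by positivity)
  obtain ⟨J, hJ, -, hJL⟩ := hL.exists_resolvent one_pos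
  set D2 : Set H := {x | x ∈ L.domain ∧ opApply L x ∈ L.domain} with hD2
  have hdense : Dense D2 := by
    have h1 : DenseRange J := hd.mono fun u hu => ⟨_, hJL ⟨u, hu⟩⟩
    refine (h1.dense_image J.continuous hd).mono ?_
    rintro _ ⟨y, hy, rfl⟩
    obtain ⟨h, h'⟩ := hJ y
    refine ⟨h, ?_⟩
    rw [RCLike.ofReal_one, one_smul, ← eq_sub_iff_add_eq'] at h'
    rw [opApply_of_mem h, h']
    exact sub_mem hy h
  have hb : ∀ y ∈ D2, ‖S t (opApply L y)‖ ≤ C / t * ‖y‖ := by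
    intro y hy
    have h := hS.sq_norm_le_of_mem hω hω' hL hy.1 hy.2 ht
    rw [← hC2, ← mul_pow, ← mul_pow] at h
    have h2 := (abs_le_of_sq_le_sq' h (by positivity)).2
    rw [div_mul_eq_mul_div, le_div_iff₀ ht]; linarith
  obtain ⟨y, hy, hyx⟩ := mem_closure_iff_seq_limit.1 (hdense x)
  have hsub : ∀ n m, y n - y m ∈ D2 := fun n m => by
    refine ⟨sub_mem (hy n).1 (hy m).1, ?_⟩
    rw [opApply_sub (hy n).1 (hy m).1]
    exact sub_mem (hy n).2 (hy m).2
  have hcau : CauchySeq fun n => S t (opApply L (y n)) := by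
    rw [Metric.cauchySeq_iff]
    intro ε hε
    obtain ⟨N, hN⟩ := Metric.cauchySeq_iff.1 hyx.cauchySeq (ε / (C / t + 1)) (by positivity)
    refine ⟨N, fun m hm n hn => ?_⟩
    have h1 := hN m hm n hn
    rw [dist_eq_norm, lt_div_iff₀ (by positivity)] at h1
    have h2 := hb _ (hsub m n)
    rw [opApply_sub (hy m).1 (hy n).1, map_sub] at h2
    rw [dist_eq_norm]
    nlinarith [norm_nonneg (y m - y n)]
  obtain ⟨v, hv⟩ := cauchySeq_tendsto_of_complete hcau
  have hg : (S t x, v) ∈ L.graph := by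
    refine hL.closed.mem_of_tendsto ((((S t).continuous.tendsto x).comp hyx).prodMk_nhds hv)
      (Eventually.of_forall fun n => ?_)
    obtain ⟨h, h'⟩ := hS.apply_mem (hy n).1 ht.le
    rw [SetLike.mem_coe, LinearPMap.mem_graph_iff]
    exact ⟨⟨_, h⟩, rfl, h'.trans (congrArg _ (opApply_of_mem (hy n).1).symm)⟩
  rw [LinearPMap.mem_graph_iff] at hg
  obtain ⟨⟨u, hu⟩, rfl, hLu⟩ := hg
  refine ⟨hu, ?_⟩
  rw [hLu]
  exact le_of_tendsto_of_tendsto hv.norm (hyx.norm.const_mul _)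
    (Eventually.of_forall fun n => hb _ (hy n))

end IsSemigroupGeneratedByNeg

/-- `e^{-tL}` is a bounded analytic contraction semigroup. -/
structure IsAnalyticContraction (L : H →ₗ.[𝕜] H) (C : ℝ) : Prop where
  semigroup : IsSemigroupGeneratedByNeg L (heatSemigroup L)
  norm_le : ∀ t x, 0 ≤ t → ‖heatSemigroup L t x‖ ≤ ‖x‖
  mem : ∀ t x, 0 < t → heatSemigroup L t x ∈ L.domain
  norm_opApply_le : ∀ t x, 0 < t → ‖opApply L (heatSemigroup L t x)‖ ≤ C / t * ‖x‖
  const_nonneg : 0 ≤ C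
  dense : Dense (L.domain : Set H)

theorem IsOmegaAccretive.exists_isAnalyticContraction [CompleteSpace H] [NormedSpace ℝ H]
    [IsScalarTower ℝ 𝕜 H] {ω : ℝ} (hω : 0 ≤ ω) (hω' : ω < Real.pi / 2)
    (hL : IsOmegaAccretive ω L) (hd : Dense (L.domain : Set H)) :
    ∃ C, IsAnalyticContraction L C := by
  have hS : IsSemigroupGeneratedByNeg L (heatSemigroup L) := by
    have h := hL.exists_semigroup hd
    rw [heatSemigroup, dif_pos h]
    exact h.choose_spec
  refine ⟨_, hS, fun t x ht => hS.norm_apply_le hL hd x ht,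
    fun t x ht => (hS.apply_mem_domain hω hω' hL hd x ht).1, fun t x ht => ?_,
    Real.sqrt_nonneg (1 + (1 + Real.tan ω) ^ 2 / 4), hd⟩
  obtain ⟨h, h'⟩ := hS.apply_mem_domain hω hω' hL hd x ht
  rwa [opApply_of_mem h]

end Analytic

/-! ### The calculus of `(tL)^k e^{-tL}`, `P_t` and `Q_t` -/

section Calculus

variable {𝕜 H : Type*} [RCLike 𝕜] [NormedAddCommGroup H] [InnerProductSpace 𝕜 H]
  {L : H →ₗ.[𝕜] H} {C : ℝ}

theorem heatPow_zero (t : ℝ) (x : H) : heatPow L 0 t x = heatSemigroup L t x := by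
  simp [heatPow]

namespace IsAnalyticContraction

variable (h : IsAnalyticContraction L C)
include h

theorem semigroup_add {s t : ℝ} (hs : 0 ≤ s) (ht : 0 ≤ t) (x : H) :
    heatSemigroup L (s + t) x = heatSemigroup L s (heatSemigroup L t x) :=
  congrArg (fun T : H →L[𝕜] H => T x) (h.semigroup.add s t hs ht)

/-- The two assertions are proved together: commutation at level k + 1 needs membership at level k,
and membership at level k + 1 follows from commutation by splitting t = t/2 + t/2. -/
theorem iterate_aux (k : ℕ) : ∀ (t : ℝ) (x : H), 0 < t →
    (opApply L)^[k] (heatSemigroup L t x) ∈ L.domain ∧ ∀ s, 0 ≤ s →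
      (opApply L)^[k] (heatSemigroup L (s + t) x) =
        heatSemigroup L s ((opApply L)^[k] (heatSemigroup L t x)) := by
  induction k with
  | zero => exact fun t x ht => ⟨h.mem t x ht, fun s hs => h.semigroup_add hs ht.le x⟩
  | succ k ih =>
    have h1 : ∀ (t : ℝ) (x : H), 0 < t → ∀ s, 0 ≤ s →
        (opApply L)^[k + 1] (heatSemigroup L (s + t) x) =
          heatSemigroup L s ((opApply L)^[k + 1] (heatSemigroup L t x)) := by
      intro t x ht s hs
      obtain ⟨hm, he⟩ := ih t x ht
      rw [Function.iterate_succ_apply', he s hs, h.semigroup.opApply_apply hm hs,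
        Function.iterate_succ_apply']
    refine fun t x ht => ⟨?_, h1 t x ht⟩
    rw [← add_halves t, h1 _ _ (half_pos ht) _ (half_pos ht).le]
    exact h.mem _ _ (half_pos ht)

theorem iterate_mem (k : ℕ) {t : ℝ} (ht : 0 < t) (x : H) :
    (opApply L)^[k] (heatSemigroup L t x) ∈ L.domain := (h.iterate_aux k t x ht).1

theorem iterate_semigroup_add (k : ℕ) {s t : ℝ} (hs : 0 ≤ s) (ht : 0 < t) (x : H) :
    (opApply L)^[k] (heatSemigroup L (s + t) x) =
      heatSemigroup L s ((opApply L)^[k] (heatSemigroup L t x)) :=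
  (h.iterate_aux k t x ht).2 s hs

theorem iterate_comm (k : ℕ) {t : ℝ} (ht : 0 < t) {x : H} (hx : x ∈ L.domain) :
    (opApply L)^[k + 1] (heatSemigroup L t x) =
      (opApply L)^[k] (heatSemigroup L t (opApply L x)) := by
  rw [Function.iterate_succ_apply, h.semigroup.opApply_apply hx ht.le]

theorem iterate_add (k : ℕ) {s t : ℝ} (hs : 0 < s) (ht : 0 < t) (x : H) :
    (opApply L)^[k + 1] (heatSemigroup L (s + t) x) =
      (opApply L)^[k] (heatSemigroup L s (opApply L (heatSemigroup L t x))) := by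
  rw [h.semigroup_add hs.le ht.le, h.iterate_comm k hs (h.mem t x ht)]

theorem iterate_linear (k : ℕ) {t : ℝ} (ht : 0 < t) :
    ∃ T : H →ₗ[𝕜] H, ∀ x, T x = (opApply L)^[k] (heatSemigroup L t x) := by
  induction k with
  | zero => exact ⟨(heatSemigroup L t).toLinearMap, fun x => rfl⟩
  | succ k ih =>
    obtain ⟨T, hT⟩ := ih
    have hm : ∀ x, T x ∈ L.domain := fun x => by rw [hT]; exact h.iterate_mem k ht _
    refine ⟨IsLinearMap.mk' (fun x => opApply L (T x)) ⟨fun x y => ?_, fun c x => ?_⟩, fun x => ?_⟩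
    · rw [map_add, opApply_add (hm x) (hm y)]
    · rw [map_smul, opApply_smul _ (hm x)]
    · rw [Function.iterate_succ_apply', ← hT]; rfl

/-- Half of the time is spent on one factor of L. This reduces every bound on (tL)^k e^{-tL}, in L²
as well as in L¹ and L^∞, to k = 0 and k = 1. -/
theorem heatPow_succ (k : ℕ) {t : ℝ} (ht : 0 < t) (x : H) :
    heatPow L (k + 1) t x =
      ((2 ^ (k + 1) : ℝ) : 𝕜) • heatPow L k (t / 2) (heatPow L 1 (t / 2) x) := by
  obtain ⟨T, hT⟩ := h.iterate_linear k (half_pos ht)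
  simp only [heatPow, Function.iterate_one]
  have h1 := h.iterate_add k (half_pos ht) (half_pos ht) x
  rw [add_halves] at h1
  rw [h1, ← hT, ← hT, map_smul, smul_smul, smul_smul,
    ← RCLike.ofReal_mul, ← RCLike.ofReal_mul]
  congr 2
  rw [div_pow, pow_succ, pow_succ]
  field_simp

theorem exists_norm_heatPow_le (k : ℕ) :
    ∃ K, 0 ≤ K ∧ ∀ t x, 0 < t → ‖heatPow L k t x‖ ≤ K * ‖x‖ := by
  have h1 : ∀ t x, 0 < t → ‖heatPow L 1 t x‖ ≤ C * ‖x‖ := by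
    intro t x ht
    have := h.norm_opApply_le t x ht
    rw [heatPow, Function.iterate_one, pow_one, norm_smul, RCLike.norm_ofReal, abs_of_pos ht]
    calc t * ‖opApply L (heatSemigroup L t x)‖ ≤ t * (C / t * ‖x‖) := by gcongr
      _ = C * ‖x‖ := by field_simp
  induction k with
  | zero => exact ⟨1, zero_le_one, fun t x ht => by
      rw [heatPow_zero, one_mul]; exact h.norm_le t x ht.le⟩
  | succ k ih =>
    obtain ⟨K, hK, hb⟩ := ih
    refine ⟨2 ^ (k + 1) * (K * C), mul_nonneg (by positivity) (mul_nonneg hK h.const_nonneg),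
      fun t x ht => ?_⟩
    rw [h.heatPow_succ k ht, norm_smul, RCLike.norm_ofReal, abs_of_pos (by positivity), mul_assoc,
      mul_assoc]
    have := (hb (t / 2) (heatPow L 1 (t / 2) x) (half_pos ht)).trans
      (mul_le_mul_of_nonneg_left (h1 _ x (half_pos ht)) hK)
    gcongr

/-- `(tL)^k e^{-tL}` as a bounded operator. -/
theorem exists_clm (k : ℕ) {t : ℝ} (ht : 0 < t) :
    ∃ T : H →L[𝕜] H, ∀ x, T x = heatPow L k t x := by
  obtain ⟨T, hT⟩ := h.iterate_linear k ht
  obtain ⟨K, -, hK⟩ := h.exists_norm_heatPow_le k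
  have h1 : ∀ x, (((t ^ k : ℝ) : 𝕜) • T) x = heatPow L k t x := fun x => by
    rw [LinearMap.smul_apply, hT]; rfl
  exact ⟨(((t ^ k : ℝ) : 𝕜) • T).mkContinuous K fun x => by rw [h1]; exact hK t x ht, h1⟩

theorem exists_clm_opP (N : ℕ) {t : ℝ} (ht : 0 < t) :
    ∃ T : H →L[𝕜] H, ∀ x, T x = opP L N t x := by
  choose T hT using fun k : ℕ => h.exists_clm k ht
  exact ⟨∑ k ∈ Finset.range N, (((k.factorial : ℝ)⁻¹ : ℝ) : 𝕜) • T k, fun x => by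
    simp [opP, hT]⟩

theorem heatPow_mem (k : ℕ) {t : ℝ} (ht : 0 < t) (x : H) : heatPow L k t x ∈ L.domain :=
  L.domain.smul_mem _ (h.iterate_mem k ht x)

theorem opP_mem (N : ℕ) {t : ℝ} (ht : 0 < t) (x : H) : opP L N t x ∈ L.domain :=
  sum_mem fun k _ => L.domain.smul_mem _ (h.heatPow_mem k ht x)

theorem opApply_heatPow (k : ℕ) {t : ℝ} (ht : 0 < t) {x : H} (hx : x ∈ L.domain) :
    opApply L (heatPow L k t x) = heatPow L k t (opApply L x) := by
  rw [heatPow, opApply_smul _ (h.iterate_mem k ht x), ← Function.iterate_succ_apply' (f := opApply L),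
    h.iterate_comm k ht hx, heatPow]

theorem opApply_opP (N : ℕ) {t : ℝ} (ht : 0 < t) {x : H} (hx : x ∈ L.domain) :
    opApply L (opP L N t x) = opP L N t (opApply L x) := by
  simp only [opP]
  rw [opApply_sum _ fun k => L.domain.smul_mem _ (h.heatPow_mem k ht x)]
  refine Finset.sum_congr rfl fun k _ => ?_
  rw [opApply_smul _ (h.heatPow_mem k ht x), h.opApply_heatPow k ht hx]

theorem heatPow_succ_of_mem (k : ℕ) {t : ℝ} (ht : 0 < t) {x : H} (hx : x ∈ L.domain) :
    heatPow L (k + 1) t x = (t : 𝕜) • heatPow L k t (opApply L x) := by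
  rw [heatPow, h.iterate_comm k ht hx, heatPow, smul_smul, pow_succ', RCLike.ofReal_mul]

theorem exists_norm_opP_le (N : ℕ) :
    ∃ K, 0 ≤ K ∧ ∀ t x, 0 < t → ‖opP L N t x‖ ≤ K * ‖x‖ := by
  choose K hK hb using h.exists_norm_heatPow_le
  refine ⟨∑ k ∈ Finset.range N, (k.factorial : ℝ)⁻¹ * K k,
    Finset.sum_nonneg fun k _ => mul_nonneg (by positivity) (hK k), fun t x ht => ?_⟩
  rw [Finset.sum_mul]
  refine norm_sum_le_of_le _ fun k _ => ?_
  rw [norm_smul, RCLike.norm_ofReal, abs_of_pos (by positivity), mul_assoc]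
  exact mul_le_mul_of_nonneg_left (hb k t x ht) (by positivity)

theorem exists_norm_opQ_le (N : ℕ) :
    ∃ K, 0 ≤ K ∧ ∀ t x, 0 < t → ‖opQ L N t x‖ ≤ K * ‖x‖ := by
  obtain ⟨K, hK, hb⟩ := h.exists_norm_heatPow_le N
  refine ⟨|(cN N)⁻¹| * K, by positivity, fun t x ht => ?_⟩
  rw [opQ, norm_smul, RCLike.norm_ofReal, mul_assoc]
  exact mul_le_mul_of_nonneg_left (hb t x ht) (abs_nonneg _)

/-- `Q_t` is `O(t)` on the domain of `L`. -/
theorem exists_norm_opQ_le_mul {N : ℕ} (hN : 0 < N) :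
    ∃ K, 0 ≤ K ∧ ∀ t x, 0 < t → x ∈ L.domain → ‖opQ L N t x‖ ≤ K * ‖opApply L x‖ * t := by
  obtain ⟨n, rfl⟩ := Nat.exists_eq_succ_of_ne_zero hN.ne'
  obtain ⟨K, hK, hb⟩ := h.exists_norm_heatPow_le n
  refine ⟨|(cN (n + 1))⁻¹| * K, by positivity, fun t x ht hx => ?_⟩
  rw [opQ, norm_smul, RCLike.norm_ofReal, Nat.succ_eq_add_one, h.heatPow_succ_of_mem n ht hx,
    norm_smul, RCLike.norm_ofReal, abs_of_pos ht]
  have := mul_le_mul_of_nonneg_left (hb t (opApply L x) ht)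
    (mul_nonneg (abs_nonneg (cN (n + 1))⁻¹) ht.le)
  linarith

/-- `P_t` is `O(1/t)` on the range of `L`. -/
theorem exists_norm_opP_le_div (N : ℕ) :
    ∃ K, 0 ≤ K ∧ ∀ t x, 0 < t → x ∈ L.domain → ‖opP L N t (opApply L x)‖ ≤ K * ‖x‖ / t := by
  choose K hK hb using h.exists_norm_heatPow_le
  refine ⟨∑ k ∈ Finset.range N, (k.factorial : ℝ)⁻¹ * K (k + 1),
    Finset.sum_nonneg fun k _ => mul_nonneg (by positivity) (hK _), fun t x ht hx => ?_⟩
  rw [Finset.sum_mul, Finset.sum_div]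
  refine norm_sum_le_of_le _ fun k _ => ?_
  have h1 := hb (k + 1) t x ht
  rw [h.heatPow_succ_of_mem k ht hx, norm_smul, RCLike.norm_ofReal, abs_of_pos ht] at h1
  rw [norm_smul, RCLike.norm_ofReal, abs_of_pos (by positivity), le_div_iff₀ ht]
  have := mul_le_mul_of_nonneg_left h1 (a := (k.factorial : ℝ)⁻¹) (by positivity)
  linarith

theorem exists_norm_opQ_le_div (N : ℕ) :
    ∃ K, 0 ≤ K ∧ ∀ t x, 0 < t → x ∈ L.domain → ‖opQ L N t (opApply L x)‖ ≤ K * ‖x‖ / t := by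
  obtain ⟨K, hK, hb⟩ := h.exists_norm_heatPow_le (N + 1)
  refine ⟨|(cN N)⁻¹| * K, by positivity, fun t x ht hx => ?_⟩
  have h1 := hb t x ht
  rw [h.heatPow_succ_of_mem N ht hx, norm_smul, RCLike.norm_ofReal, abs_of_pos ht] at h1
  rw [opQ, norm_smul, RCLike.norm_ofReal, le_div_iff₀ ht]
  have := mul_le_mul_of_nonneg_left h1 (abs_nonneg (cN N)⁻¹)
  linarith

/-- On the domain of L a factor t can be gained by moving one L onto the vector; uniform boundedness
and density do the rest. In P_t only the term k = 0 survives as t → 0. -/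
theorem tendsto_heatPow_succ (k : ℕ) (x : H) :
    Tendsto (fun t => heatPow L (k + 1) t x) (𝓝[>] 0) (𝓝 0) := by
  obtain ⟨K, hK, hb⟩ := h.exists_norm_heatPow_le k
  obtain ⟨K', hK', hb'⟩ := h.exists_norm_heatPow_le (k + 1)
  rw [Metric.tendsto_nhds]
  intro ε hε
  obtain ⟨z, hz, hxz⟩ := Metric.mem_closure_iff.1 (h.dense x) (ε / (2 * (K' + 1))) (by positivity)
  rw [dist_eq_norm, lt_div_iff₀ (by positivity)] at hxz
  have hδ : 0 < ε / (2 * (K * ‖opApply L z‖ + 1)) := by positivity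
  filter_upwards [Ioo_mem_nhdsGT hδ] with t ht
  obtain ⟨T, hT⟩ := h.exists_clm (k + 1) ht.1
  rw [dist_zero_right]
  have h1 : heatPow L (k + 1) t x = heatPow L (k + 1) t (x - z) + heatPow L (k + 1) t z := by
    simp only [← hT, map_sub]; abel
  have h2 := hb' t (x - z) ht.1
  have h3 : ‖heatPow L (k + 1) t z‖ ≤ t * (K * ‖opApply L z‖) := by
    rw [h.heatPow_succ_of_mem k ht.1 hz, norm_smul, RCLike.norm_ofReal, abs_of_pos ht.1]
    exact mul_le_mul_of_nonneg_left (hb t _ ht.1) ht.1.le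
  have h4 := ht.2
  rw [lt_div_iff₀ (by positivity)] at h4
  rw [h1]
  refine (norm_add_le _ _).trans_lt ?_
  nlinarith [norm_nonneg (x - z), ht.1]

theorem tendsto_opP {N : ℕ} (hN : 0 < N) (x : H) :
    Tendsto (fun t => opP L N t x) (𝓝[>] 0) (𝓝 x) := by
  obtain ⟨n, rfl⟩ := Nat.exists_eq_succ_of_ne_zero hN.ne'
  have h0 : Tendsto (fun t => heatPow L 0 t x) (𝓝[>] 0) (𝓝 x) := by
    have h1 := (h.semigroup.continuousOn x 0 self_mem_Ici).mono_left
      (nhdsWithin_mono _ Ioi_subset_Ici_self)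
    simpa [heatPow_zero, h.semigroup.zero] using h1
  have h1 := (tendsto_finsetSum (Finset.range n) fun k _ =>
    (h.tendsto_heatPow_succ k x).const_smul ((((k + 1).factorial : ℝ)⁻¹ : ℝ) : 𝕜)).add h0
  simp only [smul_zero, Finset.sum_const_zero, zero_add] at h1
  refine h1.congr fun t => ?_
  rw [opP, Nat.succ_eq_add_one, Finset.sum_range_succ']
  simp

/-- `‖L^{1/2} x‖ ≲ ‖x‖ + ‖L x‖`. -/
theorem exists_norm_sqrtApply_le [NormedSpace ℝ H] :
    ∃ K, 0 ≤ K ∧ ∀ x ∈ L.domain, ‖sqrtApply L x‖ ≤ K * (‖x‖ + ‖opApply L x‖) := by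
  have i1 : IntegrableOn (fun t : ℝ => t ^ (-(1 / 2) : ℝ)) (Ioc 0 1) := by
    have := intervalIntegral.intervalIntegrable_rpow' (a := 0) (b := 1) (r := -(1 / 2))
      (by norm_num)
    rwa [intervalIntegrable_iff_integrableOn_Ioc_of_le zero_le_one] at this
  have i2 : IntegrableOn (fun t : ℝ => t ^ (-(3 / 2) : ℝ)) (Ioi 1) :=
    integrableOn_Ioi_rpow_of_lt (by norm_num) one_pos
  set a := ∫ t in Ioc (0 : ℝ) 1, t ^ (-(1 / 2) : ℝ) with ha
  set b := ∫ t in Ioi (1 : ℝ), t ^ (-(3 / 2) : ℝ) with hb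
  have ha0 : 0 ≤ a := setIntegral_nonneg measurableSet_Ioc fun t ht => by
    have := ht.1; positivity
  have hb0 : 0 ≤ b := setIntegral_nonneg measurableSet_Ioi fun t ht => by
    have : 0 < t := lt_trans one_pos ht
    positivity
  have hC := h.const_nonneg
  refine ⟨(√Real.pi)⁻¹ * (a + b * C), by positivity, fun x hx => ?_⟩
  rw [sqrtApply, norm_smul, Real.norm_of_nonneg (by positivity), mul_assoc]
  refine mul_le_mul_of_nonneg_left ?_ (by positivity)
  -- For t ≤ 1 the operator L falls on x and t^{-1/2} is integrable; for t > 1 analyticity gives an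
  -- extra C/t.
  set g : ℝ → ℝ := fun t => if t ≤ 1 then t ^ (-(1 / 2) : ℝ) * ‖opApply L x‖ else
    t ^ (-(3 / 2) : ℝ) * (C * ‖x‖) with hg
  have e1 : EqOn g (fun t => t ^ (-(1 / 2) : ℝ) * ‖opApply L x‖) (Ioc 0 1) := fun t ht => by
    simp [hg, ht.2]
  have e2 : EqOn g (fun t => t ^ (-(3 / 2) : ℝ) * (C * ‖x‖)) (Ioi 1) := fun t ht => by
    simp [hg, not_le.2 (mem_Ioi.1 ht)]
  have g1 : IntegrableOn g (Ioc 0 1) :=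
    (integrableOn_congr_fun e1 measurableSet_Ioc).2 (i1.mul_const _)
  have g2 : IntegrableOn g (Ioi 1) :=
    (integrableOn_congr_fun e2 measurableSet_Ioi).2 (i2.mul_const _)
  have hI : Ioc (0 : ℝ) 1 ∪ Ioi 1 = Ioi 0 := Ioc_union_Ioi_eq_Ioi zero_le_one
  have hint : IntegrableOn g (Ioi 0) := by rw [← hI]; exact g1.union g2
  have hval : ∫ t in Ioi 0, g t = a * ‖opApply L x‖ + b * (C * ‖x‖) := by
    rw [← hI, setIntegral_union Ioc_disjoint_Ioi_same measurableSet_Ioi g1 g2,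
      setIntegral_congr_fun measurableSet_Ioc e1, setIntegral_congr_fun measurableSet_Ioi e2,
      integral_mul_const, integral_mul_const]
  have hle : ‖∫ t in Ioi (0 : ℝ), (t ^ (-(1 / 2) : ℝ)) • opApply L (heatSemigroup L t x)‖ ≤
      ∫ t in Ioi 0, g t := by
    refine norm_integral_le_of_norm_le hint ?_
    filter_upwards [ae_restrict_mem measurableSet_Ioi] with t ht
    have ht : 0 < t := ht
    rw [norm_smul, Real.norm_of_nonneg (by positivity)]
    by_cases h1 : t ≤ 1
    · simp only [hg, h1, if_true]
      rw [h.semigroup.opApply_apply hx ht.le]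
      exact mul_le_mul_of_nonneg_left (h.norm_le _ _ ht.le) (by positivity)
    · simp only [hg, h1, if_false]
      have h2 := h.norm_opApply_le t x ht
      have h3 : t ^ (-(3 / 2) : ℝ) = t ^ (-(1 / 2) : ℝ) / t := by
        rw [← Real.rpow_sub_one ht.ne']; norm_num
      rw [h3, div_mul_eq_mul_div, mul_div_assoc]
      refine mul_le_mul_of_nonneg_left (h2.trans (le_of_eq ?_)) (by positivity)
      ring
  refine hle.trans ?_
  rw [hval]
  nlinarith [norm_nonneg x, norm_nonneg (opApply L x), mul_nonneg hb0 hC,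
    mul_nonneg (mul_nonneg hb0 hC) (norm_nonneg (opApply L x)), mul_nonneg ha0 (norm_nonneg x)]

variable [NormedSpace ℝ H] [IsScalarTower ℝ 𝕜 H] [CompleteSpace H]

/-- Near t, the curve is the orbit of the vector L^k e^{-(t/2)L} x, which lies in the domain, at the
shifted time s - t/2. -/
theorem hasDerivAt_iterate (k : ℕ) {t : ℝ} (ht : 0 < t) (x : H) :
    HasDerivAt (fun t => (opApply L)^[k] (heatSemigroup L t x))
      (-(opApply L)^[k + 1] (heatSemigroup L t x)) t := by
  have h2 := half_pos ht
  have h1 := (h.semigroup.hasDerivAt (h.iterate_mem k h2 x) (t := t - t / 2) (by linarith)).scomp t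
    ((hasDerivAt_id t).sub_const (t / 2))
  rw [one_smul, ← Function.iterate_succ_apply' (f := opApply L),
    ← h.iterate_semigroup_add (k + 1) (by linarith) h2, sub_add_cancel] at h1
  refine h1.congr_of_eventuallyEq ?_
  filter_upwards [Ioi_mem_nhds (half_lt_self ht)] with s hs
  have hs : t / 2 < s := hs
  simp only [Function.comp_apply, id]
  rw [← h.iterate_semigroup_add k (sub_pos.2 hs).le h2, sub_add_cancel]

theorem hasDerivAt_heatPow (k : ℕ) {t : ℝ} (ht : 0 < t) (x : H) :
    HasDerivAt (fun t => heatPow L k t x)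
      (t⁻¹ • ((k : 𝕜) • heatPow L k t x - heatPow L (k + 1) t x)) t := by
  have h1 := (hasDerivAt_pow k t).smul (h.hasDerivAt_iterate k ht x)
  refine (h1.congr_deriv ?_).congr_of_eventuallyEq (Eventually.of_forall fun s => ?_)
  · simp only [heatPow, ← RCLike.real_smul_eq_coe_smul (K := 𝕜)]
    rw [← RCLike.ofReal_natCast (K := 𝕜), ← RCLike.real_smul_eq_coe_smul (K := 𝕜), smul_sub,
      smul_smul, smul_smul, smul_smul, smul_neg]
    have e1 : t⁻¹ * t ^ (k + 1) = t ^ k := by rw [pow_succ]; field_simp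
    have e2 : t⁻¹ * k * t ^ k = k * t ^ (k - 1) := by
      rcases k with _ | k
      · simp
      · rw [Nat.add_sub_cancel, pow_succ]; field_simp
    rw [e1, e2]; abel
  · simp only [heatPow, ← RCLike.real_smul_eq_coe_smul (K := 𝕜)]
    rfl

/-- Telescoping: the k-th summand contributes (tL)^k e^{-tL}/(k-1)! - (tL)^{k+1} e^{-tL}/k! to t
dP_t/dt, so only the last negative term is left, and (N-1)! = c_N. -/
theorem hasDerivAt_opP {N : ℕ} (hN : 0 < N) {t : ℝ} (ht : 0 < t) (x : H) :
    HasDerivAt (fun t => opP L N t x) (-(t⁻¹ • opQ L N t x)) t := by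
  have key : ∀ n, HasDerivAt (fun t => opP L (n + 1) t x)
      (-(t⁻¹ • (((n.factorial : ℝ)⁻¹ : ℝ) : 𝕜) • heatPow L (n + 1) t x)) t := by
    intro n
    induction n with
    | zero =>
      have h1 := h.hasDerivAt_heatPow 0 ht x
      simpa [opP] using h1
    | succ n ih =>
      have h1 := (h.hasDerivAt_heatPow (n + 1) ht x).const_smul ((((n + 1).factorial : ℝ)⁻¹ : ℝ) : 𝕜)
      refine ((ih.add h1).congr_deriv ?_).congr_of_eventuallyEq
        (Eventually.of_forall fun s => ?_)
      · simp only [← RCLike.real_smul_eq_coe_smul (K := 𝕜)]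
        rw [← RCLike.ofReal_natCast (K := 𝕜), ← RCLike.real_smul_eq_coe_smul (K := 𝕜)]
        have e : ((n + 1).factorial : ℝ)⁻¹ * ((n + 1 : ℕ) : ℝ) = (n.factorial : ℝ)⁻¹ := by
          rw [Nat.factorial_succ]; push_cast; field_simp
        rw [← e]; module
      · exact Finset.sum_range_succ _ _
  obtain ⟨n, rfl⟩ := Nat.exists_eq_succ_of_ne_zero hN.ne'
  have h1 := key n
  rwa [← cN_eq] at h1

theorem continuousAt_opQ (N : ℕ) {t : ℝ} (ht : 0 < t) (x : H) :
    ContinuousAt (fun t => opQ L N t x) t :=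
  (h.hasDerivAt_heatPow N ht x).continuousAt.const_smul _

/-- The error of the difference quotients of the semigroup. -/
theorem exists_norm_smul_sub_le : ∃ K, 0 ≤ K ∧ ∀ (t δ : ℝ) (y : H), 0 < t → 0 ≤ δ →
    ‖(δ : 𝕜) • opApply L (heatSemigroup L t y) -
      (heatSemigroup L t y - heatSemigroup L (t + δ) y)‖ ≤ K * (δ / t) ^ 2 * ‖y‖ := by
  obtain ⟨K, hK, hb⟩ := h.exists_norm_heatPow_le 2
  refine ⟨K, hK, fun t δ y ht hδ => ?_⟩
  -- After time t the second derivative of the orbit is at most K ‖y‖/t². Two applications of the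
  -- mean value inequality on an interval of length δ give the factor (δ/t)².
  have hb2 : ∀ s, t ≤ s → ‖(opApply L)^[2] (heatSemigroup L s y)‖ ≤ K / t ^ 2 * ‖y‖ := by
    intro s hs
    have h1 := hb s y (ht.trans_le hs)
    rw [heatPow, norm_smul, RCLike.norm_ofReal, abs_of_nonneg (by positivity)] at h1
    rw [div_mul_eq_mul_div, le_div_iff₀ (by positivity), mul_comm]
    exact (mul_le_mul_of_nonneg_right (by gcongr) (norm_nonneg _)).trans h1
  have h1 : ∀ s, t ≤ s → s ≤ t + δ →
      ‖opApply L (heatSemigroup L s y) - opApply L (heatSemigroup L t y)‖ ≤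
        K / t ^ 2 * ‖y‖ * δ := by
    intro s hs hs'
    refine (norm_image_sub_le_of_norm_deriv_le_segment' (a := t) (b := s)
      (C := K / t ^ 2 * ‖y‖) (fun r hr => (h.hasDerivAt_iterate 1 (ht.trans_le hr.1) y).hasDerivWithinAt)
      (fun r hr => ?_) s ⟨hs, le_rfl⟩).trans ?_
    · rw [norm_neg]; exact hb2 r hr.1
    · gcongr; linarith
  have h2 := norm_image_sub_le_of_norm_deriv_le_segment' (a := t) (b := t + δ)
    (f := fun s => heatSemigroup L s y + (s - t) • opApply L (heatSemigroup L t y))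
    (fun r hr => (((h.hasDerivAt_iterate 0 (ht.trans_le hr.1) y).add
      (((hasDerivAt_id r).sub_const t).smul_const _)).hasDerivWithinAt))
    (C := K / t ^ 2 * ‖y‖ * δ) (fun r hr => ?_) (t + δ) ⟨by linarith, le_rfl⟩
  · have e : (δ : 𝕜) • opApply L (heatSemigroup L t y) -
        (heatSemigroup L t y - heatSemigroup L (t + δ) y) =
        heatSemigroup L (t + δ) y + (t + δ - t) • opApply L (heatSemigroup L t y) -
        (heatSemigroup L t y + (t - t) • opApply L (heatSemigroup L t y)) := by
      rw [RCLike.real_smul_eq_coe_smul (K := 𝕜), add_sub_cancel_left, sub_self, zero_smul]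
      abel
    rw [e]
    refine h2.trans (le_of_eq ?_)
    rw [div_pow]; ring
  · have h3 := h1 r hr.1 hr.2.le
    rw [norm_sub_rev] at h3
    rw [zero_add, Function.iterate_one, one_smul, neg_add_eq_sub]
    exact h3

end IsAnalyticContraction

end Calculus

/-! ### Volume growth and polynomially decaying kernels -/

section Volume

variable {M : Type*} [MetricSpace M] [MeasurableSpace M]

/-- Balls have positive finite measure, which grows at most polynomially with the radius. -/
structure PolynomialGrowth (μ : Measure M) (n : ℕ) (C : ℝ) : Prop where
  one_le : 1 ≤ C
  lt_top : ∀ x r, 0 < r → μ (Metric.ball x r) < ∞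
  pos : ∀ x r, 0 < r → 0 < μ.real (Metric.ball x r)
  growth : ∀ x r s, 0 < s → s ≤ r →
    μ.real (Metric.ball x r) ≤ C * (r / s) ^ n * μ.real (Metric.ball x s)

/-- A small ball is contained in a compact set and so has finite measure; the growth condition
carries finiteness to all radii. The real exponent is rounded up to a natural number, which is
harmless as r/s ≥ 1. -/
theorem VolumeDimension.exists_polynomialGrowth [LocallyCompactSpace M] {μ : Measure M}
    [IsFiniteMeasureOnCompacts μ] [μ.IsOpenPosMeasure] {ν : ℝ} (h : VolumeDimension μ ν) :
    ∃ n C, PolynomialGrowth μ n C := by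
  obtain ⟨C, hC⟩ := h
  obtain ⟨n, hn⟩ := exists_nat_ge ν
  have hfin : ∀ (x : M) (r : ℝ), 0 < r → μ (Metric.ball x r) < ∞ := by
    intro x r hr
    obtain ⟨K, hK, hKx⟩ := exists_compact_mem_nhds x
    obtain ⟨ε, hε, hεK⟩ := Metric.mem_nhds_iff.1 hKx
    have h1 := hC x r (min r ε) (lt_min hr hε) (min_le_left _ _)
    refine h1.trans_lt (ENNReal.mul_lt_top (ENNReal.mul_lt_top (by simp) (by simp)) ?_)
    refine (measure_mono ?_).trans_lt hK.measure_lt_top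
    exact (Metric.ball_subset_ball (min_le_right _ _)).trans hεK
  refine ⟨n, max C 1, le_max_right _ _, hfin, fun x r hr => ?_, fun x r s hs hsr => ?_⟩
  · exact ENNReal.toReal_pos (Metric.measure_ball_pos μ x hr).ne' (hfin x r hr).ne
  · have h1 := hC x r s hs hsr
    have h2 := ENNReal.toReal_mono (ENNReal.mul_lt_top (ENNReal.mul_lt_top (by simp) (by simp))
      (hfin x s hs)).ne h1
    have hrs : 1 ≤ r / s := (one_le_div hs).2 hsr
    rw [ENNReal.toReal_mul, ENNReal.toReal_mul, ENNReal.toReal_ofReal (by positivity)] at h2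
    refine h2.trans ?_
    have h3 : (r / s) ^ ν ≤ (r / s) ^ n := by
      rw [← Real.rpow_natCast]; exact Real.rpow_le_rpow_of_exponent_le hrs hn
    change (C : ℝ) * _ * μ.real (Metric.ball x s) ≤ _
    gcongr
    exact le_max_left _ _

/-- The kernel `V(x, r)⁻¹ (1 + d(x, y) / r)^{-m}`. -/
noncomputable def decayKernel (μ : Measure M) (r : ℝ) (m : ℕ) (x y : M) : ℝ :=
  (μ.real (Metric.ball x r))⁻¹ * ((1 + dist x y / r) ^ m)⁻¹

theorem decayKernel_nonneg (μ : Measure M) {r : ℝ} (hr : 0 < r) (m : ℕ) (x y : M) :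
    0 ≤ decayKernel μ r m x y := by
  unfold decayKernel; positivity

omit [MeasurableSpace M] in
theorem one_le_one_add_dist_div {r : ℝ} (hr : 0 < r) (x y : M) : 1 ≤ 1 + dist x y / r := by
  have : 0 ≤ dist x y / r := by positivity
  linarith

theorem decayKernel_anti (μ : Measure M) {r : ℝ} (hr : 0 < r) {m m' : ℕ} (h : m ≤ m') (x y : M) :
    decayKernel μ r m' x y ≤ decayKernel μ r m x y := by
  have h1 := one_le_one_add_dist_div hr x y
  unfold decayKernel
  gcongr

/-- The kernel does not change much when its second argument moves by `r`. -/
theorem decayKernel_le_of_dist_lt (μ : Measure M) {r : ℝ} (hr : 0 < r) (m : ℕ) (x : M) {y z : M}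
    (h : dist y z < r) : decayKernel μ r m x y ≤ 2 ^ m * decayKernel μ r m x z := by
  have h1 := one_le_one_add_dist_div hr x y
  have h2 := one_le_one_add_dist_div hr x z
  have h3 : 1 + dist x z / r ≤ 2 * (1 + dist x y / r) := by
    have h4 : dist x z / r ≤ dist x y / r + 1 := by
      rw [div_add_one hr.ne']
      have := dist_triangle x y z
      gcongr; linarith
    linarith
  have h5 : (1 + dist x z / r) ^ m ≤ 2 ^ m * (1 + dist x y / r) ^ m := by
    rw [← mul_pow]; gcongr
  unfold decayKernel
  rw [mul_left_comm]
  gcongr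
  rw [inv_le_iff_one_le_mul₀ (by positivity), ← div_eq_mul_inv, mul_comm, ← mul_div_assoc,
    one_le_div (by positivity), mul_comm]
  exact h5

namespace PolynomialGrowth

variable {μ : Measure M} {n : ℕ} {C : ℝ} (h : PolynomialGrowth μ n C)
include h

theorem real_ball_le (x y : M) {r : ℝ} (hr : 0 < r) :
    μ.real (Metric.ball y r) ≤ C * (1 + dist x y / r) ^ n * μ.real (Metric.ball x r) := by
  have h1 : μ.real (Metric.ball y r) ≤ μ.real (Metric.ball x (r + dist x y)) := by
    refine measureReal_mono (Metric.ball_subset_ball' ?_) (h.lt_top _ _ (by positivity)).ne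
    rw [dist_comm]
  refine h1.trans ((h.growth x _ r hr (by linarith [dist_nonneg (x := x) (y := y)])).trans
    (le_of_eq ?_))
  rw [add_div, div_self hr.ne']

theorem inv_real_ball_le (x y : M) {r : ℝ} (hr : 0 < r) :
    (μ.real (Metric.ball x r))⁻¹ ≤
      C * (1 + dist x y / r) ^ n * (μ.real (Metric.ball y r))⁻¹ := by
  have h1 := h.real_ball_le x y hr
  have hx := h.pos x r hr
  have hy := h.pos y r hr
  rw [inv_le_iff_one_le_mul₀ hx, ← div_eq_mul_inv, div_mul_eq_mul_div, one_le_div hy]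
  exact h1

variable [OpensMeasurableSpace M]

theorem exists_lintegral_le : ∃ K, 0 ≤ K ∧ ∀ (x : M) (r : ℝ), 0 < r →
    ∫⁻ y, ENNReal.ofReal (((1 + dist x y / r) ^ (n + 2))⁻¹) ∂μ ≤
      ENNReal.ofReal (K * μ.real (Metric.ball x r)) := by
  have hsum : Summable fun k : ℕ => (((k : ℝ) + 1) ^ 2)⁻¹ := by
    have := (summable_nat_add_iff 1).2 (Real.summable_nat_pow_inv.2 one_lt_two)
    simpa using this
  have hC := zero_le_one.trans h.one_le
  refine ⟨C * ∑' k : ℕ, (((k : ℝ) + 1) ^ 2)⁻¹, mul_nonneg hC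
    (tsum_nonneg fun k => by positivity), fun x r hr => ?_⟩
  -- The function is at most its bound on the annulus containing y, indexed by the integer part of
  -- d(x,y)/r. The ball of radius (k+1)r costs (k+1)^n, and the two extra powers make the series
  -- converge.
  have hpt : ∀ y, ENNReal.ofReal (((1 + dist x y / r) ^ (n + 2))⁻¹) ≤
      ∑' k : ℕ, (Metric.ball x ((k + 1) * r)).indicator
        (fun _ => ENNReal.ofReal ((((k : ℝ) + 1) ^ (n + 2))⁻¹)) y := by
    intro y
    have h0 : 0 ≤ dist x y / r := by positivity
    refine le_trans ?_ (ENNReal.le_tsum ⌊dist x y / r⌋₊)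
    rw [indicator_of_mem]
    · refine ENNReal.ofReal_le_ofReal ?_
      have : (⌊dist x y / r⌋₊ : ℝ) + 1 ≤ 1 + dist x y / r := by linarith [Nat.floor_le h0]
      gcongr
    · rw [Metric.mem_ball, dist_comm, ← div_lt_iff₀ hr]
      exact Nat.lt_floor_add_one _
  refine (lintegral_mono hpt).trans ?_
  rw [lintegral_tsum fun k => (measurable_const.indicator Metric.isOpen_ball.measurableSet).aemeasurable]
  have hterm : ∀ k : ℕ, ∫⁻ y, (Metric.ball x ((k + 1) * r)).indicator
        (fun _ => ENNReal.ofReal ((((k : ℝ) + 1) ^ (n + 2))⁻¹)) y ∂μ ≤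
      ENNReal.ofReal (C * μ.real (Metric.ball x r) * (((k : ℝ) + 1) ^ 2)⁻¹) := by
    intro k
    rw [lintegral_indicator_const Metric.isOpen_ball.measurableSet,
      ← ENNReal.ofReal_toReal (h.lt_top x ((k + 1) * r) (by positivity)).ne,
      ← ENNReal.ofReal_mul (by positivity)]
    refine ENNReal.ofReal_le_ofReal ?_
    have h1 := h.growth x ((k + 1) * r) r hr (by nlinarith [(k.cast_nonneg : (0 : ℝ) ≤ k)])
    rw [mul_div_cancel_right₀ _ hr.ne'] at h1
    calc (((k : ℝ) + 1) ^ (n + 2))⁻¹ * (μ (Metric.ball x ((k + 1) * r))).toReal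
        ≤ (((k : ℝ) + 1) ^ (n + 2))⁻¹ * (C * ((k : ℝ) + 1) ^ n * μ.real (Metric.ball x r)) :=
          mul_le_mul_of_nonneg_left h1 (by positivity)
      _ = _ := by rw [pow_add]; field_simp
  refine (ENNReal.tsum_le_tsum hterm).trans ?_
  rw [← ENNReal.ofReal_tsum_of_nonneg (fun k => by positivity) (hsum.mul_left _), tsum_mul_left]
  exact ENNReal.ofReal_le_ofReal (le_of_eq (by ring))

theorem exists_lintegral_decayKernel_right_le : ∃ K, 0 ≤ K ∧ ∀ (x : M) (r : ℝ), 0 < r →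
    ∫⁻ y, ENNReal.ofReal (decayKernel μ r (n + 2) x y) ∂μ ≤ ENNReal.ofReal K := by
  obtain ⟨K, hK, hb⟩ := h.exists_lintegral_le
  refine ⟨K, hK, fun x r hr => ?_⟩
  have hx := h.pos x r hr
  simp only [decayKernel]
  simp_rw [ENNReal.ofReal_mul (inv_nonneg.2 hx.le)]
  rw [lintegral_const_mul' _ _ (by simp)]
  refine (mul_le_mul_right (hb x r hr) _).trans ?_
  rw [← ENNReal.ofReal_mul (inv_nonneg.2 hx.le)]
  exact ENNReal.ofReal_le_ofReal (le_of_eq (by field_simp))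

/-- The kernel is normalised by the volume at its first variable. Passing to the volume at the
second one costs n powers of 1 + d/r, whence the exponent 2n + 2. -/
theorem exists_lintegral_decayKernel_left_le : ∃ K, 0 ≤ K ∧ ∀ (y : M) (r : ℝ), 0 < r →
    ∫⁻ x, ENNReal.ofReal (decayKernel μ r (2 * n + 2) x y) ∂μ ≤ ENNReal.ofReal K := by
  obtain ⟨K, hK, hb⟩ := h.exists_lintegral_decayKernel_right_le
  have hC := zero_le_one.trans h.one_le
  refine ⟨C * K, by positivity, fun y r hr => ?_⟩
  rw [ENNReal.ofReal_mul hC]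
  refine le_trans ?_ (mul_le_mul_right (hb y r hr) _)
  rw [← lintegral_const_mul' _ _ (by simp)]
  refine lintegral_mono fun x => ?_
  rw [← ENNReal.ofReal_mul hC]
  refine ENNReal.ofReal_le_ofReal ?_
  have h1 := one_le_one_add_dist_div hr x y
  have h2 := h.inv_real_ball_le x y hr
  unfold decayKernel
  calc _ ≤ C * (1 + dist x y / r) ^ n * (μ.real (Metric.ball y r))⁻¹ *
        ((1 + dist x y / r) ^ (2 * n + 2))⁻¹ := by gcongr
    _ = _ := by
      rw [dist_comm y x, show 2 * n + 2 = n + (n + 2) by ring, pow_add _ n (n + 2)]; field_simp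

/-- The `L²` norm of the kernel in its second variable. -/
theorem exists_lintegral_sq_right_le : ∃ K, 0 ≤ K ∧ ∀ (x : M) (r : ℝ), 0 < r →
    ∫⁻ y, ENNReal.ofReal (decayKernel μ r (n + 2) x y) ^ 2 ∂μ ≤
      ENNReal.ofReal (K * (μ.real (Metric.ball x r))⁻¹) := by
  obtain ⟨K, hK, hb⟩ := h.exists_lintegral_decayKernel_right_le
  refine ⟨K, hK, fun x r hr => ?_⟩
  rw [mul_comm, ENNReal.ofReal_mul (by positivity)]
  refine le_trans ?_ (mul_le_mul_right (hb x r hr) _)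
  rw [← lintegral_const_mul' _ _ (by simp)]
  refine lintegral_mono fun y => ?_
  rw [sq]
  refine mul_le_mul_left (ENNReal.ofReal_le_ofReal ?_) _
  unfold decayKernel
  have h1 := one_le_pow₀ (one_le_one_add_dist_div hr x y) (n := n + 2)
  exact mul_le_of_le_one_right (by positivity) (inv_le_one_of_one_le₀ h1)

/-- The `L²` norm of the kernel in its first variable. -/
theorem exists_lintegral_sq_left_le : ∃ K, 0 ≤ K ∧ ∀ (y : M) (r : ℝ), 0 < r →
    ∫⁻ x, ENNReal.ofReal (decayKernel μ r (2 * n + 2) x y) ^ 2 ∂μ ≤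
      ENNReal.ofReal (K * (μ.real (Metric.ball y r))⁻¹) := by
  obtain ⟨K, hK, hb⟩ := h.exists_lintegral_decayKernel_left_le
  have hC := zero_le_one.trans h.one_le
  refine ⟨C * K, by positivity, fun y r hr => ?_⟩
  have e : C * K * (μ.real (Metric.ball y r))⁻¹ = C * (μ.real (Metric.ball y r))⁻¹ * K := by ring
  rw [e, ENNReal.ofReal_mul (by positivity)]
  refine le_trans ?_ (mul_le_mul_right (hb y r hr) _)
  rw [← lintegral_const_mul' _ _ (by simp)]
  refine lintegral_mono fun x => ?_
  rw [sq]
  refine mul_le_mul_left (ENNReal.ofReal_le_ofReal ?_) _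
  unfold decayKernel
  have h1 := one_le_one_add_dist_div hr x y
  have h2 := h.inv_real_ball_le x y hr
  calc _ ≤ C * (1 + dist x y / r) ^ n * (μ.real (Metric.ball y r))⁻¹ *
        ((1 + dist x y / r) ^ n)⁻¹ := by
        gcongr
        omega
    _ = _ := by field_simp

end PolynomialGrowth

/-- The volume x ↦ μ(B(x,r)) is measurable as the measure of the sections of the set {dist < r} in M
× M. -/
theorem measurable_decayKernel [OpensMeasurableSpace M] [SecondCountableTopology M]
    (μ : Measure M) [SFinite μ] (r : ℝ) (m : ℕ) :
    Measurable (Function.uncurry (decayKernel μ r m)) := by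
  have h1 : Measurable fun x : M => μ (Metric.ball x r) := by
    have h2 : MeasurableSet {p : M × M | dist p.1 p.2 < r} :=
      measurableSet_lt measurable_dist measurable_const
    have h3 := measurable_measure_prodMk_left (ν := μ) h2
    have e : ∀ x : M, Metric.ball x r = Prod.mk x ⁻¹' {p : M × M | dist p.1 p.2 < r} := fun x => by
      ext y; simp [dist_comm]
    simpa only [e] using h3
  have h2 : Measurable fun p : M × M => μ.real (Metric.ball p.1 r) :=
    (h1.ennreal_toReal).comp measurable_fst
  have h3 : Measurable fun p : M × M => dist p.1 p.2 := measurable_dist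
  exact h2.inv.mul (((h3.div_const r).const_add 1).pow_const m).inv

end Volume

/-! ### Operators bounded on `L¹` and `L^∞` -/

section Endpoint

variable {𝕜 M : Type*} [RCLike 𝕜] [MeasurableSpace M] {μ : Measure M}

/-- `T` is bounded by `C` in the norms of `L¹` and of `L^∞`. -/
structure EndpointBound (T : Lp 𝕜 2 μ → Lp 𝕜 2 μ) (C : ℝ≥0) : Prop where
  one : ∀ f, eLpNorm (T f) 1 μ ≤ C * eLpNorm f 1 μ
  top : ∀ f, eLpNorm (T f) ∞ μ ≤ C * eLpNorm f ∞ μ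

theorem EndpointBound.comp {T T' : Lp 𝕜 2 μ → Lp 𝕜 2 μ} {C C' : ℝ≥0} (h : EndpointBound T C)
    (h' : EndpointBound T' C') : EndpointBound (fun f => T (T' f)) (C * C') where
  one f := (h.one _).trans (by
    rw [ENNReal.coe_mul, mul_assoc]; exact mul_le_mul_right (h'.one f) _)
  top f := (h.top _).trans (by
    rw [ENNReal.coe_mul, mul_assoc]; exact mul_le_mul_right (h'.top f) _)

theorem EndpointBound.const_smul {T : Lp 𝕜 2 μ → Lp 𝕜 2 μ} {C : ℝ≥0} (h : EndpointBound T C)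
    (c : 𝕜) : EndpointBound (fun f => c • T f) (‖c‖₊ * C) where
  one f := by
    rw [eLpNorm_congr_ae (Lp.coeFn_smul c (T f)), eLpNorm_const_smul, ENNReal.coe_mul, mul_assoc]
    exact mul_le_mul_right (h.one f) _
  top f := by
    rw [eLpNorm_congr_ae (Lp.coeFn_smul c (T f)), eLpNorm_const_smul, ENNReal.coe_mul, mul_assoc]
    exact mul_le_mul_right (h.top f) _

theorem EndpointBound.add {T T' : Lp 𝕜 2 μ → Lp 𝕜 2 μ} {C C' : ℝ≥0} (h : EndpointBound T C)
    (h' : EndpointBound T' C') : EndpointBound (fun f => T f + T' f) (C + C') where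
  one f := by
    rw [eLpNorm_congr_ae (Lp.coeFn_add _ _), ENNReal.coe_add, add_mul]
    exact (eLpNorm_add_le (Lp.aestronglyMeasurable _) (Lp.aestronglyMeasurable _) le_rfl).trans
      (add_le_add (h.one f) (h'.one f))
  top f := by
    rw [eLpNorm_congr_ae (Lp.coeFn_add _ _), ENNReal.coe_add, add_mul]
    exact (eLpNorm_add_le (Lp.aestronglyMeasurable _) (Lp.aestronglyMeasurable _) le_top).trans
      (add_le_add (h.top f) (h'.top f))

theorem EndpointBound.sum {ι : Type*} (s : Finset ι) {T : ι → Lp 𝕜 2 μ → Lp 𝕜 2 μ} {C : ι → ℝ≥0}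
    (h : ∀ i, EndpointBound (T i) (C i)) :
    EndpointBound (fun f => ∑ i ∈ s, T i f) (∑ i ∈ s, C i) := by
  classical
  induction s using Finset.induction_on with
  | empty =>
    simp only [Finset.sum_empty]
    constructor <;> intro f <;> rw [eLpNorm_congr_ae (Lp.coeFn_zero 𝕜 2 μ)] <;> simp
  | insert i s hi ih =>
    simp only [Finset.sum_insert hi]
    exact (h i).add ih

/-- `L¹` bound for functions dominated by an integral operator. -/
theorem eLpNorm_one_le_of_kernel [SFinite μ] {K : M → M → ℝ≥0∞}
    (hK : Measurable (Function.uncurry K)) {C : ℝ≥0∞} (hC : ∀ y, ∫⁻ x, K x y ∂μ ≤ C)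
    {f g : M → 𝕜} (hf : AEStronglyMeasurable f μ)
    (hfg : ∀ᵐ x ∂μ, ‖g x‖ₑ ≤ ∫⁻ y, K x y * ‖f y‖ₑ ∂μ) :
    eLpNorm g 1 μ ≤ C * eLpNorm f 1 μ := by
  rw [eLpNorm_one_eq_lintegral_enorm, eLpNorm_one_eq_lintegral_enorm]
  refine (lintegral_mono_ae hfg).trans ?_
  rw [lintegral_lintegral_swap]
  · rw [← lintegral_const_mul'' _ hf.enorm]
    refine lintegral_mono fun y => ?_
    rw [lintegral_mul_const _ (hK.of_uncurry_right (y := y))]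
    exact mul_le_mul_left (hC y) _
  · exact hK.aemeasurable.mul hf.enorm.comp_snd

/-- `L^∞` bound for functions dominated by an integral operator. -/
theorem eLpNorm_top_le_of_kernel {K : M → M → ℝ≥0∞} (hK : Measurable (Function.uncurry K))
    {C : ℝ≥0∞} (hC : ∀ x, ∫⁻ y, K x y ∂μ ≤ C)
    {f g : M → 𝕜} (hfg : ∀ᵐ x ∂μ, ‖g x‖ₑ ≤ ∫⁻ y, K x y * ‖f y‖ₑ ∂μ) :
    eLpNorm g ∞ μ ≤ C * eLpNorm f ∞ μ := by
  rw [eLpNorm_exponent_top, eLpNormEssSup]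
  refine essSup_le_of_ae_le _ ?_
  filter_upwards [hfg] with x hx
  refine hx.trans ?_
  calc ∫⁻ y, K x y * ‖f y‖ₑ ∂μ ≤ ∫⁻ y, K x y * eLpNorm f ∞ μ ∂μ := by
        refine lintegral_mono_ae ?_
        filter_upwards [ae_le_eLpNormEssSup (f := f) (μ := μ)] with y hy
        rw [eLpNorm_exponent_top]
        exact mul_le_mul_right hy _
    _ = (∫⁻ y, K x y ∂μ) * eLpNorm f ∞ μ :=
        lintegral_mul_const _ hK.of_uncurry_left
    _ ≤ _ := mul_le_mul_left (hC x) _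

theorem enorm_kernelApply_le {K : M → M → ℝ≥0∞} {κ : M → M → 𝕜}
    (hκ : ∀ᵐ x ∂μ, ∀ᵐ y ∂μ, ‖κ x y‖ₑ ≤ K x y) (f : M → 𝕜) :
    ∀ᵐ x ∂μ, ‖kernelApply μ κ f x‖ₑ ≤ ∫⁻ y, K x y * ‖f y‖ₑ ∂μ := by
  filter_upwards [hκ] with x hx
  refine (enorm_integral_le_lintegral_enorm _).trans (lintegral_mono_ae ?_)
  filter_upwards [hx] with y hy
  rw [enorm_mul]
  exact mul_le_mul_left hy _

end Endpoint

/-! ### Endpoint bounds of the semigroup and of its time derivatives -/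

section SquareIntegrals

variable {𝕜 M : Type*} [RCLike 𝕜] [MeasurableSpace M] {μ : Measure M}

theorem enorm_sq_eq_lintegral (g : Lp 𝕜 2 μ) : ‖g‖ₑ ^ 2 = ∫⁻ x, ‖g x‖ₑ ^ 2 ∂μ := by
  rw [Lp.enorm_def, eLpNorm_eq_lintegral_rpow_enorm_toReal two_ne_zero ENNReal.ofNat_ne_top,
    ← ENNReal.rpow_natCast, ← ENNReal.rpow_mul]
  simp

theorem sq_lintegral_mul_le {f g : M → ℝ≥0∞} (hf : AEMeasurable f μ) (hg : AEMeasurable g μ) :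
    (∫⁻ x, f x * g x ∂μ) ^ 2 ≤ (∫⁻ x, f x ^ 2 ∂μ) * ∫⁻ x, g x ^ 2 ∂μ := by
  have h := ENNReal.lintegral_mul_le_Lp_mul_Lq μ Real.HolderConjugate.two_two hf hg
  have h2 := pow_le_pow_left' h 2
  rw [mul_pow, ← ENNReal.rpow_natCast (_ ^ (1 / 2 : ℝ)), ← ENNReal.rpow_natCast (_ ^ (1 / 2 : ℝ)),
    ← ENNReal.rpow_mul, ← ENNReal.rpow_mul] at h2
  simpa using h2

theorem enorm_sq_eq_ofReal {E : Type*} [NormedAddCommGroup E] (z : E) :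
    ‖z‖ₑ ^ 2 = ENNReal.ofReal (‖z‖ ^ 2) := by
  rw [← ofReal_norm, ENNReal.ofReal_pow (norm_nonneg z)]

theorem tendsto_Lp_two_of_dominated {F : ℕ → Lp 𝕜 2 μ} {f : Lp 𝕜 2 μ}
    (hb : ∀ n, ∀ᵐ x ∂μ, ‖F n x - f x‖ ≤ ‖f x‖)
    (hl : ∀ᵐ x ∂μ, Tendsto (fun n => F n x) atTop (𝓝 (f x))) : Tendsto F atTop (𝓝 f) := by
  have h1 : Tendsto (fun n => ∫⁻ x, ‖F n x - f x‖ₑ ^ 2 ∂μ) atTop (𝓝 (∫⁻ _, 0 ∂μ)) := by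
    refine tendsto_lintegral_of_dominated_convergence' (fun x => ‖f x‖ₑ ^ 2) (fun n => ?_)
      (fun n => ?_) ?_ ?_
    · exact (((Lp.aestronglyMeasurable (F n)).sub (Lp.aestronglyMeasurable f)).enorm).pow_const 2
    · filter_upwards [hb n] with x hx
      exact pow_le_pow_left' (enorm_le_iff_norm_le.2 hx) 2
    · rw [← enorm_sq_eq_lintegral]; finiteness
    · filter_upwards [hl] with x hx
      have h2 := (hx.sub_const (f x)).enorm
      rw [sub_self, enorm_zero] at h2
      simpa using ENNReal.Tendsto.pow (n := 2) h2
  rw [lintegral_zero] at h1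
  have h2 : Tendsto (fun n => ‖F n - f‖ₑ ^ 2) atTop (𝓝 0) := by
    refine h1.congr fun n => ?_
    rw [enorm_sq_eq_lintegral]
    refine lintegral_congr_ae ?_
    filter_upwards [Lp.coeFn_sub (F n) f] with x hx
    rw [hx, Pi.sub_apply]
  have h3 : Tendsto (fun n => ‖F n - f‖ ^ 2) atTop (𝓝 0) := by
    have h4 := (ENNReal.tendsto_toReal ENNReal.zero_ne_top).comp h2
    simpa [Function.comp_def] using h4
  rw [tendsto_iff_norm_sub_tendsto_zero]
  have h5 := h3.sqrt
  simpa using h5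

end SquareIntegrals

/-! ### From Gaussian kernels to polynomially decaying ones -/

section KernelBounds

variable {𝕜 M : Type*} [RCLike 𝕜] [MetricSpace M] [SeparableSpace M]
  [MeasurableSpace M] [BorelSpace M] {μ : Measure M} [SigmaFinite μ]
  {L : Lp 𝕜 2 μ →ₗ.[𝕜] Lp 𝕜 2 μ} {k : ℝ → M → M → 𝕜}

/-- `k t` is the kernel of `e^{-tL}` and satisfies Gaussian upper estimates. -/
structure HasGaussianKernel (L : Lp 𝕜 2 μ →ₗ.[𝕜] Lp 𝕜 2 μ) (k : ℝ → M → M → 𝕜) : Prop where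
  measurable : ∀ t : ℝ, 0 < t → Measurable (Function.uncurry (k t))
  repr : ∀ t : ℝ, 0 < t → ∀ f : Lp 𝕜 2 μ,
    (heatSemigroup L t f : M → 𝕜) =ᵐ[μ] kernelApply μ (k t) f
  bound : ∃ C c : ℝ, 0 < C ∧ 0 < c ∧ ∀ t : ℝ, 0 < t → ∀ᵐ x ∂μ, ∀ᵐ y ∂μ,
    ‖k t x y‖ ≤
      C / (μ (Metric.ball x (Real.sqrt t))).toReal * Real.exp (-(dist x y ^ 2 / (c * t)))

/-- A power is dominated by the exponential series, (1+s)^m ≤ m! e^{1+s}, and s ≤ s²/c + c/4 by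
completing the square. -/
theorem exp_neg_le_inv_pow {c : ℝ} (hc : 0 < c) (m : ℕ) :
    ∃ A, 0 ≤ A ∧ ∀ s, 0 ≤ s → Real.exp (-(s ^ 2 / c)) ≤ A * ((1 + s) ^ m)⁻¹ := by
  refine ⟨m.factorial * Real.exp (1 + c / 4), by positivity, fun s hs => ?_⟩
  rw [← div_eq_mul_inv, le_div_iff₀ (by positivity)]
  have h1 := Real.pow_div_factorial_le_exp (1 + s) (by positivity) m
  have hm : (0 : ℝ) < m.factorial := by exact_mod_cast m.factorial_pos
  rw [div_le_iff₀ hm] at h1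
  have h2 : s ≤ s ^ 2 / c + c / 4 := by
    have h3 : 0 ≤ (s - c / 2) ^ 2 / c := by positivity
    have h4 : (s - c / 2) ^ 2 / c = s ^ 2 / c - s + c / 4 := by field_simp; ring
    linarith
  calc Real.exp (-(s ^ 2 / c)) * (1 + s) ^ m
      ≤ Real.exp (-(s ^ 2 / c)) * (Real.exp (1 + s) * m.factorial) := by gcongr
    _ = m.factorial * (Real.exp (-(s ^ 2 / c)) * Real.exp (1 + s)) := by ring
    _ ≤ m.factorial * Real.exp (1 + c / 4) := by
        rw [← Real.exp_add]
        exact mul_le_mul_of_nonneg_left (Real.exp_le_exp.2 (by linarith)) hm.le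

namespace HasGaussianKernel

variable {n : ℕ} {C₀ : ℝ}

omit [SeparableSpace M] [BorelSpace M] [SigmaFinite μ] in
-- One kernel, at scale √t, dominates all times in a window. The window is what the bound of
-- tLe^{-tL} uses: the times t/3, t and (1+q)t with q ≤ 1.
theorem exists_kernel_le (hk : HasGaussianKernel L k) (hμ : PolynomialGrowth μ n C₀) (m : ℕ) :
    ∃ A, 0 ≤ A ∧ ∀ t s, 0 < t → t / 3 ≤ s → s ≤ 2 * t → ∀ᵐ x ∂μ, ∀ᵐ y ∂μ,
      ‖k s x y‖ ≤ A * decayKernel μ √t m x y := by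
  obtain ⟨C, c, hC, hc, hb⟩ := hk.bound
  obtain ⟨A, hA, hAb⟩ := exp_neg_le_inv_pow (c := 2 * c) (by positivity) m
  have hC₀ := zero_le_one.trans hμ.one_le
  refine ⟨C * (C₀ * √3 ^ n) * A, by positivity, fun t s ht hs hs' => ?_⟩
  have hs0 : 0 < s := by linarith
  have hst : 0 < √t := Real.sqrt_pos.2 ht
  have hss : 0 < √s := Real.sqrt_pos.2 hs0
  filter_upwards [hb s hs0] with x hx
  filter_upwards [hx] with y hy
  refine hy.trans ?_
  have hV : (μ.real (Metric.ball x √s))⁻¹ ≤ C₀ * √3 ^ n * (μ.real (Metric.ball x √t))⁻¹ := by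
    have h1 := hμ.pos x _ hst
    have h2 := hμ.pos x _ hss
    rw [inv_le_iff_one_le_mul₀ h2, ← div_eq_mul_inv, div_mul_eq_mul_div, one_le_div h1]
    rcases le_total s t with hle | hle
    · refine (hμ.growth x _ _ hss (Real.sqrt_le_sqrt hle)).trans ?_
      have h3 : √t / √s ≤ √3 := by
        rw [← Real.sqrt_div ht.le]
        exact Real.sqrt_le_sqrt (by rw [div_le_iff₀ hs0]; linarith)
      gcongr
    · have h3 : μ.real (Metric.ball x √t) ≤ μ.real (Metric.ball x √s) :=
        measureReal_mono (Metric.ball_subset_ball (Real.sqrt_le_sqrt hle)) (hμ.lt_top _ _ hss).ne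
      have h4 : 1 ≤ √3 := by rw [Real.one_le_sqrt]; norm_num
      have h5 : 1 ≤ C₀ * √3 ^ n := one_le_mul_of_one_le_of_one_le hμ.one_le (one_le_pow₀ h4)
      nlinarith
  have hE : Real.exp (-(dist x y ^ 2 / (c * s))) ≤ A * ((1 + dist x y / √t) ^ m)⁻¹ := by
    refine le_trans ?_ (hAb (dist x y / √t) (by positivity))
    rw [Real.exp_le_exp, neg_le_neg_iff, div_pow, Real.sq_sqrt ht.le, div_div]
    exact div_le_div_of_nonneg_left (sq_nonneg _) (by positivity) (by nlinarith)
  calc C / (μ (Metric.ball x √s)).toReal * Real.exp (-(dist x y ^ 2 / (c * s)))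
      = C * (μ.real (Metric.ball x √s))⁻¹ * Real.exp (-(dist x y ^ 2 / (c * s))) := by
        rw [div_eq_mul_inv]; rfl
    _ ≤ C * (C₀ * √3 ^ n * (μ.real (Metric.ball x √t))⁻¹) *
        (A * ((1 + dist x y / √t) ^ m)⁻¹) := by gcongr
    _ = _ := by rw [decayKernel]; ring

/-- Pointwise bound of the semigroup by the `L²` norm. -/
theorem exists_norm_apply_le_norm (hk : HasGaussianKernel L k) (hμ : PolynomialGrowth μ n C₀) :
    ∃ B, 0 ≤ B ∧ ∀ t s, 0 < t → t / 3 ≤ s → s ≤ 2 * t → ∀ g : Lp 𝕜 2 μ, ∀ᵐ x ∂μ,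
      ‖heatSemigroup L s g x‖ ≤ B * √((μ.real (Metric.ball x √t))⁻¹) * ‖g‖ := by
  obtain ⟨A, hA, hAb⟩ := hk.exists_kernel_le hμ (n + 2)
  obtain ⟨K, hK, hKb⟩ := hμ.exists_lintegral_sq_right_le
  refine ⟨A * √K, by positivity, fun t s ht hs hs' g => ?_⟩
  have hst : 0 < √t := Real.sqrt_pos.2 ht
  filter_upwards [hk.repr s (by linarith) g, hAb t s ht hs hs'] with x hx hxk
  rw [hx, kernelApply]
  have hm : Measurable fun y => ENNReal.ofReal (decayKernel μ √t (n + 2) x y) :=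
    ((measurable_decayKernel μ √t (n + 2)).of_uncurry_left).ennreal_ofReal
  have h1 : ‖∫ y, k s x y * g y ∂μ‖ₑ ≤
      ENNReal.ofReal A * ∫⁻ y, ENNReal.ofReal (decayKernel μ √t (n + 2) x y) * ‖g y‖ₑ ∂μ := by
    refine (enorm_integral_le_lintegral_enorm _).trans ?_
    rw [← lintegral_const_mul' _ _ (by simp)]
    refine lintegral_mono_ae ?_
    filter_upwards [hxk] with y hy
    rw [enorm_mul, ← mul_assoc, ← ENNReal.ofReal_mul hA, ← ofReal_norm]
    exact mul_le_mul_left (ENNReal.ofReal_le_ofReal hy) _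
  have h2 := pow_le_pow_left' h1 2
  -- Cauchy-Schwarz against the row of the kernel at x, whose L² norm is of order V(x,√t)^{-1/2}.
  have h3 := sq_lintegral_mul_le hm.aemeasurable (Lp.aestronglyMeasurable g).enorm
  rw [mul_pow] at h2
  have h4 := h2.trans (mul_le_mul_right (h3.trans (mul_le_mul_left (hKb x √t hst) _)) _)
  rw [← enorm_sq_eq_lintegral, enorm_sq_eq_ofReal, enorm_sq_eq_ofReal, ← ENNReal.ofReal_pow hA,
    ← ENNReal.ofReal_mul (by positivity), ← ENNReal.ofReal_mul (by positivity),
    ENNReal.ofReal_le_ofReal_iff (by positivity)] at h4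
  refine (abs_le_of_sq_le_sq' (h4.trans (le_of_eq ?_)) (by positivity)).2
  rw [mul_pow, mul_pow, mul_pow, Real.sq_sqrt hK, Real.sq_sqrt (by positivity)]
  ring

omit [SeparableSpace M] [BorelSpace M] [SigmaFinite μ] in
/-- Pointwise bound of the semigroup for functions supported in a ball. -/
theorem exists_norm_apply_le_of_ball (hk : HasGaussianKernel L k) (hμ : PolynomialGrowth μ n C₀)
    (m : ℕ) :
    ∃ B, 0 ≤ B ∧ ∀ t s, 0 < t → t / 3 ≤ s → s ≤ 2 * t → ∀ (g : Lp 𝕜 2 μ) (z : M),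
      Integrable g μ → (∀ᵐ y ∂μ, √t ≤ dist y z → g y = 0) → ∀ᵐ x ∂μ,
      ‖heatSemigroup L s g x‖ ≤ B * decayKernel μ √t m x z * ∫ y, ‖g y‖ ∂μ := by
  obtain ⟨A, hA, hAb⟩ := hk.exists_kernel_le hμ m
  refine ⟨A * 2 ^ m, by positivity, fun t s ht hs hs' g z hg hgz => ?_⟩
  have hst : 0 < √t := Real.sqrt_pos.2 ht
  filter_upwards [hk.repr s (by linarith) g, hAb t s ht hs hs'] with x hx hxk
  rw [hx, kernelApply, ← integral_const_mul]
  refine norm_integral_le_of_norm_le (hg.norm.const_mul _) ?_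
  filter_upwards [hxk, hgz] with y hy hyz
  by_cases hd : √t ≤ dist y z
  · simp [hyz hd]
  · rw [norm_mul, mul_assoc A]
    refine mul_le_mul_of_nonneg_right (hy.trans ?_) (norm_nonneg _)
    exact mul_le_mul_of_nonneg_left (decayKernel_le_of_dist_lt μ hst m x (not_le.1 hd)) hA

omit [SeparableSpace M] [SigmaFinite μ] in
/-- `L²` bound of the semigroup for functions supported in a ball. -/
theorem exists_norm_le_of_ball (hk : HasGaussianKernel L k) (hμ : PolynomialGrowth μ n C₀) :
    ∃ B, 0 ≤ B ∧ ∀ t s, 0 < t → t / 3 ≤ s → s ≤ 2 * t → ∀ (g : Lp 𝕜 2 μ) (z : M),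
      Integrable g μ → (∀ᵐ y ∂μ, √t ≤ dist y z → g y = 0) →
      ‖heatSemigroup L s g‖ ≤ B * √((μ.real (Metric.ball z √t))⁻¹) * ∫ y, ‖g y‖ ∂μ := by
  obtain ⟨B, hB, hb⟩ := hk.exists_norm_apply_le_of_ball hμ (2 * n + 2)
  obtain ⟨K, hK, hKb⟩ := hμ.exists_lintegral_sq_left_le
  refine ⟨B * √K, by positivity, fun t s ht hs hs' g z hg hgz => ?_⟩
  have hst : 0 < √t := Real.sqrt_pos.2 ht
  have hN : 0 ≤ ∫ y, ‖g y‖ ∂μ := integral_nonneg fun y => norm_nonneg _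
  set N := ∫ y, ‖g y‖ ∂μ
  have h1 : ‖heatSemigroup L s g‖ₑ ^ 2 ≤ ENNReal.ofReal ((B * N) ^ 2) *
      ∫⁻ x, ENNReal.ofReal (decayKernel μ √t (2 * n + 2) x z) ^ 2 ∂μ := by
    rw [enorm_sq_eq_lintegral, ← lintegral_const_mul' _ _ (by simp)]
    refine lintegral_mono_ae ?_
    filter_upwards [hb t s ht hs hs' g z hg hgz] with x hx
    have h0 := decayKernel_nonneg μ hst (2 * n + 2) x z
    rw [enorm_sq_eq_ofReal, ← ENNReal.ofReal_pow h0, ← ENNReal.ofReal_mul (by positivity)]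
    refine ENNReal.ofReal_le_ofReal ?_
    rw [← mul_pow]
    refine pow_le_pow_left₀ (norm_nonneg _) (hx.trans (le_of_eq ?_)) 2
    ring
  have h2 := h1.trans (mul_le_mul_right (hKb z √t hst) _)
  rw [enorm_sq_eq_ofReal, ← ENNReal.ofReal_mul (by positivity),
    ENNReal.ofReal_le_ofReal_iff (by positivity)] at h2
  refine (abs_le_of_sq_le_sq' (h2.trans (le_of_eq ?_)) (by positivity)).2
  rw [mul_pow, mul_pow, mul_pow, mul_pow, Real.sq_sqrt hK, Real.sq_sqrt (by positivity)]
  ring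

end HasGaussianKernel

end KernelBounds

/-! ### Kernel domination of tLe^{-tL} and uniform bounds on L¹ and L^∞ -/

section TimeDerivative

variable {𝕜 M : Type*} [RCLike 𝕜] [MetricSpace M] [SeparableSpace M]
  [MeasurableSpace M] [BorelSpace M] {μ : Measure M} [SigmaFinite μ]
  {L : Lp 𝕜 2 μ →ₗ.[𝕜] Lp 𝕜 2 μ} {k : ℝ → M → M → 𝕜}

namespace HasGaussianKernel

variable {n : ℕ} {C₀ : ℝ} {C : ℝ}

/-- Pointwise bound of `tLe^{-tL}` for functions supported in a ball, by interpolation between the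
decay of the difference quotients in time and the `L²` bound of the second derivative. -/
theorem exists_norm_heatPow_one_le_of_ball (hk : HasGaussianKernel L k)
    (hμ : PolynomialGrowth μ n C₀) (hL : IsAnalyticContraction L C) (m : ℕ) :
    ∃ B, 0 ≤ B ∧ ∀ t, 0 < t → ∀ (g : Lp 𝕜 2 μ) (z : M),
      Integrable g μ → (∀ᵐ y ∂μ, √t ≤ dist y z → g y = 0) → ∀ᵐ x ∂μ,
      ‖heatPow L 1 t g x‖ ≤ B * decayKernel μ √t m x z * ∫ y, ‖g y‖ ∂μ := by
  obtain ⟨B₁, hB₁, hb₁⟩ := hk.exists_norm_apply_le_of_ball hμ (2 * m + n)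
  obtain ⟨B₂, hB₂, hb₂⟩ := hk.exists_norm_apply_le_norm hμ
  obtain ⟨B₃, hB₃, hb₃⟩ := hk.exists_norm_le_of_ball hμ
  obtain ⟨K, hK, hKb⟩ := hL.exists_norm_smul_sub_le
  have hC₀ := zero_le_one.trans hμ.one_le
  refine ⟨2 * B₁ + B₂ * (K * 9) * B₃ * C₀ * 2 ^ (m + n), by positivity, fun t ht g z hg hgz => ?_⟩
  have hst : 0 < √t := Real.sqrt_pos.2 ht
  have ht3 : 0 < t / 3 := by positivity
  have hN : 0 ≤ ∫ y, ‖g y‖ ∂μ := integral_nonneg fun y => norm_nonneg _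
  set N := ∫ y, ‖g y‖ ∂μ
  -- q_j is the relative time step used at distance about j√t. Dividing by it costs (1+d)^{m+n},
  -- which the decay of order 2m + n of the semigroup can afford; multiplying by it gains
  -- (1+d)^{-(m+n)}, which pays for comparing volumes and leaves order m.
  set q : ℕ → ℝ := fun j => (((j : ℝ) + 1) ^ (m + n))⁻¹ with hq
  have hq0 : ∀ j, 0 < q j := fun j => by simp only [hq]; positivity
  have hq1 : ∀ j, q j ≤ 1 := fun j => inv_le_one_of_one_le₀ (one_le_pow₀ (by
    have : (0 : ℝ) ≤ j := j.cast_nonneg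
    linarith))
  set G := heatSemigroup L (t / 3) g with hG
  -- The error of the difference quotient with step q_j t, taken at time t/3. One third of the time
  -- was spent to bring g into L², in G; the last third turns the L² bound of w into a pointwise
  -- one.
  set w : ℕ → Lp 𝕜 2 μ := fun j => ((q j * t : ℝ) : 𝕜) • opApply L (heatSemigroup L (t / 3) G) -
      (heatSemigroup L (t / 3) G - heatSemigroup L (t / 3 + q j * t) G) with hw
  have hwn : ∀ j, ‖w j‖ ≤ K * 9 * q j ^ 2 * (B₃ * √((μ.real (Metric.ball z √t))⁻¹) * N) := by
    intro j
    refine (hKb (t / 3) (q j * t) G ht3 (mul_nonneg (hq0 j).le ht.le)).trans ?_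
    have e : q j * t / (t / 3) = 3 * q j := by field_simp
    have h1 := hb₃ t (t / 3) ht le_rfl (by linarith) g z hg hgz
    rw [e, mul_pow]
    calc K * (3 ^ 2 * q j ^ 2) * ‖G‖ = K * 9 * q j ^ 2 * ‖G‖ := by ring
      _ ≤ _ := by gcongr
  -- The first two terms decay in space, and the third does not but is O(q²). After division by q
  -- they are balanced against each other.
  have hdec : ∀ j, ((q j : ℝ) : 𝕜) • heatPow L 1 t g =
      heatSemigroup L t g - heatSemigroup L ((1 + q j) * t) g + heatSemigroup L (t / 3) (w j) := by
    intro j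
    have hm := hL.mem (t / 3) G ht3
    have e1 : heatSemigroup L (t / 3) (heatSemigroup L (t / 3) G) = heatSemigroup L t g := by
      rw [hG, ← hL.semigroup_add ht3.le ht3.le,
        ← hL.semigroup_add (s := t / 3 + t / 3) (by linarith) ht3.le]
      congr 2; ring
    have e2 : heatSemigroup L (t / 3) (heatSemigroup L (t / 3 + q j * t) G) =
        heatSemigroup L ((1 + q j) * t) g := by
      have h1 : 0 ≤ t / 3 + q j * t := add_nonneg ht3.le (mul_nonneg (hq0 j).le ht.le)
      rw [hG, ← hL.semigroup_add h1 ht3.le, ← hL.semigroup_add ht3.le (by linarith)]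
      congr 2; ring
    have e3 : heatSemigroup L (t / 3) (opApply L (heatSemigroup L (t / 3) G)) =
        opApply L (heatSemigroup L t g) := by
      rw [← hL.semigroup.opApply_apply hm ht3.le, e1]
    simp only [hw, map_sub, map_smul, e1, e2, e3, heatPow, Function.iterate_one, pow_one]
    rw [RCLike.ofReal_mul, smul_smul]
    abel
  -- The steps form a sequence, so that a single null set serves all of them and the step may
  -- afterwards depend on x.
  have hall : ∀ᵐ x ∂μ, ∀ j, q j * ‖heatPow L 1 t g x‖ ≤
      2 * (B₁ * decayKernel μ √t (2 * m + n) x z * N) +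
        B₂ * √((μ.real (Metric.ball x √t))⁻¹) *
          (K * 9 * q j ^ 2 * (B₃ * √((μ.real (Metric.ball z √t))⁻¹) * N)) := by
    rw [ae_all_iff]
    intro j
    have h0 := hq0 j
    have h1 := hq1 j
    filter_upwards [hb₁ t t ht (by linarith) (by linarith) g z hg hgz,
      hb₁ t ((1 + q j) * t) ht (by nlinarith) (by nlinarith) g z hg hgz,
      hb₂ t (t / 3) ht le_rfl (by linarith) (w j),
      Lp.coeFn_smul ((q j : ℝ) : 𝕜) (heatPow L 1 t g),
      Lp.coeFn_add (heatSemigroup L t g - heatSemigroup L ((1 + q j) * t) g)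
        (heatSemigroup L (t / 3) (w j)),
      Lp.coeFn_sub (heatSemigroup L t g) (heatSemigroup L ((1 + q j) * t) g)]
      with x hx1 hx2 hx3 hx4 hx5 hx6
    have e : q j * ‖heatPow L 1 t g x‖ = ‖(((q j : ℝ) : 𝕜) • heatPow L 1 t g) x‖ := by
      rw [hx4, Pi.smul_apply, norm_smul, RCLike.norm_ofReal, abs_of_pos h0]
    rw [e, hdec j, hx5, Pi.add_apply, hx6, Pi.sub_apply]
    have h2 := norm_add_le (heatSemigroup L t g x - heatSemigroup L ((1 + q j) * t) g x)
      (heatSemigroup L (t / 3) (w j) x)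
    have h3 := norm_sub_le (heatSemigroup L t g x) (heatSemigroup L ((1 + q j) * t) g x)
    have h4 := mul_le_mul_of_nonneg_left (hwn j)
      (a := B₂ * √((μ.real (Metric.ball x √t))⁻¹)) (by positivity)
    linarith
  filter_upwards [hall] with x hx
  have hd0 : 0 ≤ dist x z / √t := by positivity
  set d := dist x z / √t with hd
  set V := (μ.real (Metric.ball x √t))⁻¹ with hV
  have hV0 : 0 ≤ V := by positivity
  have hj := hx ⌊d⌋₊
  set j := ⌊d⌋₊
  have hj1 : (j : ℝ) ≤ d := Nat.floor_le hd0
  have hj2 : d < j + 1 := Nat.lt_floor_add_one d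
  -- The L² bounds produce the geometric mean of the volumes at x and at z; moving everything to x
  -- costs at most n powers of 1 + d.
  have hVz : √((μ.real (Metric.ball z √t))⁻¹) ≤ C₀ * (1 + d) ^ n * √V := by
    have h1 := hμ.inv_real_ball_le z x hst
    rw [dist_comm, ← hd, ← hV] at h1
    have h2 : 1 ≤ C₀ * (1 + d) ^ n :=
      one_le_mul_of_one_le_of_one_le hμ.one_le (one_le_pow₀ (by linarith))
    rw [Real.sqrt_le_left (by positivity), mul_pow, Real.sq_sqrt hV0]
    refine h1.trans (mul_le_mul_of_nonneg_right ?_ hV0)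
    nlinarith
  have hqinv : (q j)⁻¹ ≤ (1 + d) ^ (m + n) := by
    simp only [hq, inv_inv]
    gcongr ?_ ^ _
    linarith
  have hqle : q j ≤ 2 ^ (m + n) * ((1 + d) ^ (m + n))⁻¹ := by
    simp only [hq]
    rw [inv_le_iff_one_le_mul₀ (by positivity), mul_right_comm, ← div_eq_mul_inv,
      one_le_div (by positivity), ← mul_pow]
    gcongr
    linarith [(j.cast_nonneg : (0 : ℝ) ≤ j)]
  have hmain : ‖heatPow L 1 t g x‖ ≤ (q j)⁻¹ * (2 * (B₁ * decayKernel μ √t (2 * m + n) x z * N)) +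
      q j * (B₂ * √V * (K * 9 * (B₃ * √((μ.real (Metric.ball z √t))⁻¹) * N))) := by
    have h1 := mul_le_mul_of_nonneg_left hj (inv_nonneg.2 (hq0 j).le)
    rw [inv_mul_cancel_left₀ (hq0 j).ne'] at h1
    refine h1.trans (le_of_eq ?_)
    have := (hq0 j).ne'
    field_simp
  refine hmain.trans ?_
  have h1 : (q j)⁻¹ * (2 * (B₁ * decayKernel μ √t (2 * m + n) x z * N)) ≤
      2 * B₁ * decayKernel μ √t m x z * N := by
    have h0 := decayKernel_nonneg μ hst (2 * m + n) x z
    calc _ ≤ (1 + d) ^ (m + n) * (2 * (B₁ * decayKernel μ √t (2 * m + n) x z * N)) := by gcongr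
      _ = _ := by
        rw [decayKernel, decayKernel, ← hd, show 2 * m + n = m + (m + n) by ring,
          pow_add _ m (m + n)]
        field_simp
  have h2 : q j * (B₂ * √V * (K * 9 * (B₃ * √((μ.real (Metric.ball z √t))⁻¹) * N))) ≤
      B₂ * (K * 9) * B₃ * C₀ * 2 ^ (m + n) * decayKernel μ √t m x z * N := by
    calc _ ≤ 2 ^ (m + n) * ((1 + d) ^ (m + n))⁻¹ *
          (B₂ * √V * (K * 9 * (B₃ * (C₀ * (1 + d) ^ n * √V) * N))) := by gcongr
      _ = B₂ * (K * 9) * B₃ * C₀ * 2 ^ (m + n) * ((√V * √V) * ((1 + d) ^ m)⁻¹) * N := by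
        rw [pow_add (1 + d)]; field_simp
      _ = _ := by rw [Real.mul_self_sqrt hV0, decayKernel]
  linarith

/-- Pointwise domination of `tLe^{-tL}` by an integral operator. -/
theorem exists_enorm_heatPow_one_le (hk : HasGaussianKernel L k)
    (hμ : PolynomialGrowth μ n C₀) (hL : IsAnalyticContraction L C) (m : ℕ) :
    ∃ B, 0 ≤ B ∧ ∀ t, 0 < t → ∀ f : Lp 𝕜 2 μ, ∀ᵐ x ∂μ,
      ‖heatPow L 1 t f x‖ₑ ≤ ∫⁻ y, ENNReal.ofReal (B * decayKernel μ √t m x y) * ‖f y‖ₑ ∂μ := by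
  obtain ⟨B, hB, hb⟩ := hk.exists_norm_heatPow_one_le_of_ball hμ hL m
  refine ⟨B * 2 ^ m, by positivity, fun t ht f => ?_⟩
  rcases isEmpty_or_nonempty M with hM | hM
  · exact Eventually.of_forall fun x => hM.elim x
  have hst : 0 < √t := Real.sqrt_pos.2 ht
  set z := denseSeq M
  -- A countable measurable partition, each piece inside a ball of radius √t, so that the bound for
  -- data supported in a ball applies to every piece of f.
  set U : ℕ → Set M := disjointed fun j => Metric.ball (z j) √t with hU
  have hUm : ∀ j, MeasurableSet (U j) := fun j =>
    MeasurableSet.disjointed (fun i => Metric.isOpen_ball.measurableSet) j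
  have hUz : ∀ j, U j ⊆ Metric.ball (z j) √t := fun j => disjointed_subset _ j
  have hUd : Pairwise (Function.onFun Disjoint U) := disjoint_disjointed _
  have hUu : ⋃ j, U j = univ := by
    rw [hU, iUnion_disjointed]
    refine eq_univ_of_forall fun x => ?_
    obtain ⟨j, hj⟩ := (denseRange_denseSeq M).exists_dist_lt x hst
    exact mem_iUnion.2 ⟨j, hj⟩
  have hmem : ∀ j, MemLp ((U j).indicator f) 2 μ := fun j => (Lp.memLp f).indicator (hUm j)
  set fj : ℕ → Lp 𝕜 2 μ := fun j => (hmem j).toLp with hfj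
  have hfe : ∀ j, fj j =ᵐ[μ] (U j).indicator f := fun j => (hmem j).coeFn_toLp
  have hint : ∀ j, Integrable (fj j) μ := by
    intro j
    rw [integrable_congr (hfe j), integrable_indicator_iff (hUm j)]
    have : IsFiniteMeasure (μ.restrict (U j)) :=
      ⟨by rw [Measure.restrict_apply_univ]
          exact (measure_mono (hUz j)).trans_lt (hμ.lt_top _ _ hst)⟩
    exact ((Lp.memLp f).restrict (U j)).integrable one_le_two
  have hsupp : ∀ j, ∀ᵐ y ∂μ, √t ≤ dist y (z j) → fj j y = 0 := by
    intro j
    filter_upwards [hfe j] with y hy hd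
    rw [hy, indicator_of_notMem]
    exact fun hyU => (not_lt.2 hd) (Metric.mem_ball.1 (hUz j hyU))
  -- Replacing the centre z_j by a point y of the same piece changes the kernel by a factor of at
  -- most 2^m.
  have hterm : ∀ j, ∀ᵐ x ∂μ, ‖heatPow L 1 t (fj j) x‖ₑ ≤
      ∫⁻ y in U j, ENNReal.ofReal (B * 2 ^ m * decayKernel μ √t m x y) * ‖f y‖ₑ ∂μ := by
    intro j
    filter_upwards [hb t ht (fj j) (z j) (hint j) (hsupp j)] with x hx
    have h0 := decayKernel_nonneg μ hst m x (z j)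
    rw [← ofReal_norm]
    refine (ENNReal.ofReal_le_ofReal hx).trans ?_
    rw [ENNReal.ofReal_mul (by positivity), ofReal_integral_norm_eq_lintegral_enorm (hint j),
      lintegral_congr_ae (g := (U j).indicator fun y => ‖f y‖ₑ) ?_,
      lintegral_indicator (hUm j), ← lintegral_const_mul' _ _ (by simp)]
    · refine setLIntegral_mono' (hUm j) fun y hy => ?_
      refine mul_le_mul_left (ENNReal.ofReal_le_ofReal ?_) _
      rw [mul_assoc]
      refine mul_le_mul_of_nonneg_left ?_ hB
      refine decayKernel_le_of_dist_lt μ hst m x ?_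
      rw [dist_comm]; exact hUz j hy
    · filter_upwards [hfe j] with y hy
      rw [hy]; exact enorm_indicator_eq_indicator_enorm _ _
  set F : ℕ → Lp 𝕜 2 μ := fun N => ∑ j ∈ Finset.range N, fj j with hF
  have hFe : ∀ᵐ x ∂μ, ∀ N, F N x = ∑ j ∈ Finset.range N, (U j).indicator f x := by
    rw [ae_all_iff]
    intro N
    filter_upwards [ae_all_iff.2 hfe, Lp.coeFn_finsetSum (Finset.range N) fj] with x hx hx'
    rw [hx', Finset.sum_apply]
    exact Finset.sum_congr rfl fun j _ => hx j
  have hsum : ∀ x, ∃ i, ∀ N, ∑ j ∈ Finset.range N, (U j).indicator f x =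
      if i < N then f x else 0 := by
    intro x
    obtain ⟨i, hi⟩ := mem_iUnion.1 (hUu ▸ mem_univ x : x ∈ ⋃ j, U j)
    refine ⟨i, fun N => ?_⟩
    have h1 : ∀ j, j ≠ i → (U j).indicator f x = 0 := fun j hj =>
      indicator_of_notMem (fun hxj => (hUd hj).le_bot ⟨hxj, hi⟩) _
    split_ifs with hN
    · rw [Finset.sum_eq_single i (fun j _ hj => h1 j hj)
        (fun h => absurd (Finset.mem_range.2 hN) h), indicator_of_mem hi]
    · refine Finset.sum_eq_zero fun j hj => h1 j ?_
      rintro rfl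
      exact hN (Finset.mem_range.1 hj)
  have hFf : Tendsto F atTop (𝓝 f) := by
    refine tendsto_Lp_two_of_dominated (fun N => ?_) ?_
    · filter_upwards [hFe] with x hx
      obtain ⟨i, hi⟩ := hsum x
      rw [hx, hi]
      split_ifs <;> simp
    · filter_upwards [hFe] with x hx
      obtain ⟨i, hi⟩ := hsum x
      refine tendsto_const_nhds.congr' ?_
      filter_upwards [eventually_gt_atTop i] with N hN
      rw [hx, hi, if_pos hN]
  obtain ⟨T, hT⟩ := hL.exists_clm 1 ht
  have hTF : Tendsto (fun N => T (F N)) atTop (𝓝 (T f)) := (T.continuous.tendsto f).comp hFf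
  -- Convergence in L² is pointwise only along a subsequence. This suffices, as the bound holds for
  -- every partial sum.
  obtain ⟨ns, -, hns⟩ := (tendstoInMeasure_of_tendsto_Lp hTF).exists_seq_tendsto_ae
  have hbound : ∀ᵐ x ∂μ, ∀ N, ‖T (F N) x‖ₑ ≤
      ∫⁻ y, ENNReal.ofReal (B * 2 ^ m * decayKernel μ √t m x y) * ‖f y‖ₑ ∂μ := by
    rw [ae_all_iff]
    intro N
    filter_upwards [ae_all_iff.2 hterm,
      Lp.coeFn_finsetSum (Finset.range N) fun j => T (fj j)] with x hx hx'
    rw [hF, map_sum, hx', Finset.sum_apply]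
    refine (enorm_sum_le _ _).trans ?_
    rw [← setLIntegral_univ, ← hUu, lintegral_iUnion hUm hUd]
    refine (Finset.sum_le_sum fun j _ => ?_).trans (ENNReal.sum_le_tsum (Finset.range N))
    rw [hT]
    exact hx j
  filter_upwards [hns, hbound] with x hx hx'
  rw [← hT]
  exact le_of_tendsto hx.enorm (Eventually.of_forall fun i => hx' (ns i))

omit [SeparableSpace M] [BorelSpace M] [SigmaFinite μ] in
/-- Pointwise domination of `e^{-tL}` by an integral operator. -/
theorem exists_enorm_heatPow_zero_le (hk : HasGaussianKernel L k)
    (hμ : PolynomialGrowth μ n C₀) (m : ℕ) :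
    ∃ B, 0 ≤ B ∧ ∀ t, 0 < t → ∀ᵐ x ∂μ, ∀ᵐ y ∂μ,
      ‖k t x y‖ₑ ≤ ENNReal.ofReal (B * decayKernel μ √t m x y) := by
  obtain ⟨A, hA, hAb⟩ := hk.exists_kernel_le hμ m
  refine ⟨A, hA, fun t ht => ?_⟩
  filter_upwards [hAb t t ht (by linarith) (by linarith)] with x hx
  filter_upwards [hx] with y hy
  rw [← ofReal_norm]
  exact ENNReal.ofReal_le_ofReal hy

/-- A dominating kernel which is uniformly integrable in each variable. -/
theorem exists_dominating (hμ : PolynomialGrowth μ n C₀) {B : ℝ} (hB : 0 ≤ B) :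
    ∃ K : ℝ≥0, ∀ t : ℝ, 0 < t →
      Measurable (Function.uncurry fun x y : M =>
        ENNReal.ofReal (B * decayKernel μ √t (2 * n + 2) x y)) ∧
      (∀ x, ∫⁻ y, ENNReal.ofReal (B * decayKernel μ √t (2 * n + 2) x y) ∂μ ≤ K) ∧
      ∀ y, ∫⁻ x, ENNReal.ofReal (B * decayKernel μ √t (2 * n + 2) x y) ∂μ ≤ K := by
  obtain ⟨K₁, hK₁, hb₁⟩ := hμ.exists_lintegral_decayKernel_right_le
  obtain ⟨K₂, hK₂, hb₂⟩ := hμ.exists_lintegral_decayKernel_left_le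
  refine ⟨Real.toNNReal (B * max K₁ K₂), fun t ht => ⟨?_, fun x => ?_, fun y => ?_⟩⟩
  · exact ((measurable_decayKernel μ √t (2 * n + 2)).const_mul B).ennreal_ofReal
  all_goals
    have hst : 0 < √t := Real.sqrt_pos.2 ht
    simp_rw [ENNReal.ofReal_mul hB]
    rw [lintegral_const_mul' _ _ (by simp)]
    change _ ≤ ENNReal.ofReal (B * max K₁ K₂)
    rw [ENNReal.ofReal_mul hB]
    refine mul_le_mul_right ?_ _
  · refine (lintegral_mono fun y => ENNReal.ofReal_le_ofReal
      (decayKernel_anti μ hst (by omega) x y)).trans ((hb₁ x √t hst).trans ?_)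
    exact ENNReal.ofReal_le_ofReal (le_max_left _ _)
  · exact (hb₂ y √t hst).trans (ENNReal.ofReal_le_ofReal (le_max_right _ _))

/-- The kernel operators `k t` are uniformly bounded on `L¹`. -/
theorem exists_eLpNorm_kernelApply_le (hk : HasGaussianKernel L k)
    (hμ : PolynomialGrowth μ n C₀) :
    ∃ K : ℝ≥0, ∀ t, 0 < t → ∀ f : M → 𝕜, AEStronglyMeasurable f μ →
      eLpNorm (kernelApply μ (k t) f) 1 μ ≤ K * eLpNorm f 1 μ := by
  obtain ⟨B, hB, hb⟩ := hk.exists_enorm_heatPow_zero_le hμ (2 * n + 2)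
  obtain ⟨K, hK⟩ := exists_dominating hμ hB
  refine ⟨K, fun t ht f hf => ?_⟩
  exact eLpNorm_one_le_of_kernel (hK t ht).1 (hK t ht).2.2 hf (enorm_kernelApply_le (hb t ht) f)

/-- The operators `(tL)^j e^{-tL}` are uniformly bounded on `L¹` and on `L^∞`. -/
theorem exists_endpointBound_heatPow (hk : HasGaussianKernel L k)
    (hμ : PolynomialGrowth μ n C₀) (hL : IsAnalyticContraction L C) (j : ℕ) :
    ∃ K : ℝ≥0, ∀ t, 0 < t → EndpointBound (heatPow L j t) K := by
  have hone : ∃ K : ℝ≥0, ∀ t, 0 < t → EndpointBound (heatPow L 1 t) K := by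
    obtain ⟨B, hB, hb⟩ := hk.exists_enorm_heatPow_one_le hμ hL (2 * n + 2)
    obtain ⟨K, hK⟩ := exists_dominating hμ hB
    refine ⟨K, fun t ht => ⟨fun f => ?_, fun f => ?_⟩⟩
    · exact eLpNorm_one_le_of_kernel (hK t ht).1 (hK t ht).2.2 (Lp.aestronglyMeasurable f)
        (hb t ht f)
    · exact eLpNorm_top_le_of_kernel (hK t ht).1 (hK t ht).2.1 (hb t ht f)
  induction j with
  | zero =>
    obtain ⟨B, hB, hb⟩ := hk.exists_enorm_heatPow_zero_le hμ (2 * n + 2)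
    obtain ⟨K, hK⟩ := exists_dominating hμ hB
    refine ⟨K, fun t ht => ?_⟩
    have h1 : ∀ f : Lp 𝕜 2 μ, ∀ᵐ x ∂μ, ‖heatPow L 0 t f x‖ₑ ≤
        ∫⁻ y, ENNReal.ofReal (B * decayKernel μ √t (2 * n + 2) x y) * ‖f y‖ₑ ∂μ := by
      intro f
      filter_upwards [enorm_kernelApply_le (hb t ht) f, hk.repr t ht f] with x hx hx'
      rw [heatPow_zero, hx']
      exact hx
    refine ⟨fun f => ?_, fun f => ?_⟩
    · exact eLpNorm_one_le_of_kernel (hK t ht).1 (hK t ht).2.2 (Lp.aestronglyMeasurable f) (h1 f)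
    · exact eLpNorm_top_le_of_kernel (hK t ht).1 (hK t ht).2.1 (h1 f)
  | succ j ih =>
    obtain ⟨K, hK⟩ := ih
    obtain ⟨K₁, hK₁⟩ := hone
    refine ⟨‖((2 ^ (j + 1) : ℝ) : 𝕜)‖₊ * (K * K₁), fun t ht => ?_⟩
    have h1 := ((hK (t / 2) (half_pos ht)).comp (hK₁ (t / 2) (half_pos ht))).const_smul
      ((2 ^ (j + 1) : ℝ) : 𝕜)
    simpa only [← hL.heatPow_succ j ht] using h1

theorem exists_endpointBound_opP (hk : HasGaussianKernel L k)
    (hμ : PolynomialGrowth μ n C₀) (hL : IsAnalyticContraction L C) (N : ℕ) :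
    ∃ K : ℝ≥0, ∀ t, 0 < t → EndpointBound (opP L N t) K := by
  choose K hK using hk.exists_endpointBound_heatPow hμ hL
  exact ⟨_, fun t ht => EndpointBound.sum (Finset.range N) fun j => (hK j t ht).const_smul _⟩

theorem exists_endpointBound_opQ (hk : HasGaussianKernel L k)
    (hμ : PolynomialGrowth μ n C₀) (hL : IsAnalyticContraction L C) (N : ℕ) :
    ∃ K : ℝ≥0, ∀ t, 0 < t → EndpointBound (opQ L N t) K := by
  obtain ⟨K, hK⟩ := hk.exists_endpointBound_heatPow hμ hL N
  exact ⟨_, fun t ht => (hK t ht).const_smul _⟩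

end HasGaussianKernel

end TimeDerivative

/-! ### Interpolation between `L¹` and `L^∞`, and integrals in `L^p` -/

section Interpolation

variable {𝕜 M : Type*} [RCLike 𝕜] [MeasurableSpace M] {μ : Measure M} {p : ℝ≥0∞}

theorem one_lt_toReal_of_one_lt (hp : 1 < p) (hp' : p < ∞) : 1 < p.toReal := by
  rw [← ENNReal.toReal_one]
  exact (ENNReal.toReal_lt_toReal ENNReal.one_ne_top hp'.ne).2 hp

theorem ae_norm_le_of_eLpNorm_top {f : M → 𝕜} {B : ℝ} (hB : 0 ≤ B)
    (h : eLpNorm f ∞ μ ≤ ENNReal.ofReal B) : ∀ᵐ x ∂μ, ‖f x‖ ≤ B := by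
  filter_upwards [ae_le_eLpNormEssSup (f := f) (μ := μ)] with x hx
  rw [← eLpNorm_exponent_top] at hx
  have := hx.trans h
  rwa [← ofReal_norm, ENNReal.ofReal_le_ofReal_iff hB] at this

/-- Pointwise, |f|^p ≤ B^{p-1} |f|. -/
theorem eLpNorm_le_of_one_of_top (hp : 1 < p) (hp' : p < ∞) {f : M → 𝕜} {A B : ℝ}
    (hA0 : 0 ≤ A) (hB0 : 0 ≤ B) (hA : eLpNorm f 1 μ ≤ ENNReal.ofReal A)
    (hB : eLpNorm f ∞ μ ≤ ENNReal.ofReal B) :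
    eLpNorm f p μ ≤ ENNReal.ofReal ((A * B ^ (p.toReal - 1)) ^ (1 / p.toReal)) := by
  have hP := one_lt_toReal_of_one_lt hp hp'
  rw [eLpNorm_eq_lintegral_rpow_enorm_toReal (zero_lt_one.trans hp).ne' hp'.ne,
    ← ENNReal.ofReal_rpow_of_nonneg (by positivity) (by positivity)]
  refine ENNReal.rpow_le_rpow ?_ (by positivity)
  have hpt : ∀ᵐ x ∂μ, ‖f x‖ₑ ^ p.toReal ≤ ‖f x‖ₑ * ENNReal.ofReal (B ^ (p.toReal - 1)) := by
    filter_upwards [ae_norm_le_of_eLpNorm_top hB0 hB] with x hx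
    rw [← ofReal_norm, ENNReal.ofReal_rpow_of_nonneg (norm_nonneg _) (by linarith),
      ← ENNReal.ofReal_mul (norm_nonneg _)]
    refine ENNReal.ofReal_le_ofReal ?_
    have h1 : ‖f x‖ ^ p.toReal = ‖f x‖ * ‖f x‖ ^ (p.toReal - 1) := by
      nth_rewrite 2 [← Real.rpow_one ‖f x‖]
      rw [← Real.rpow_add_of_nonneg (norm_nonneg _) zero_le_one (by linarith)]
      congr 1; ring
    rw [h1]
    exact mul_le_mul_of_nonneg_left (Real.rpow_le_rpow (norm_nonneg _) hx (by linarith))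
      (norm_nonneg _)
  refine (lintegral_mono_ae hpt).trans ?_
  rw [lintegral_mul_const' _ _ (by simp), ← eLpNorm_one_eq_lintegral_enorm,
    ENNReal.ofReal_mul hA0]
  exact mul_le_mul_left hA _

/-- Convergence in `L²` gives convergence in `L^p` for sequences bounded in `L¹` and `L^∞`. -/
theorem tendsto_eLpNorm_of_bounded {ι : Type*} {l : Filter ι} (hp : 1 < p) (hp' : p < ∞)
    {F : ι → Lp 𝕜 2 μ} {A B : ℝ} (hA0 : 0 ≤ A) (hB0 : 0 ≤ B)
    (hA : ∀ᶠ i in l, eLpNorm (F i) 1 μ ≤ ENNReal.ofReal A)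
    (hB : ∀ᶠ i in l, eLpNorm (F i) ∞ μ ≤ ENNReal.ofReal B)
    (hF : Tendsto F l (𝓝 0)) : Tendsto (fun i => eLpNorm (F i) p μ) l (𝓝 0) := by
  have hP := one_lt_toReal_of_one_lt hp hp'
  have hP0 : 0 < p.toReal := by linarith
  set P := p.toReal with hPdef
  -- Where |F| ≤ η, |F|^P ≤ η^{P-1} |F|; elsewhere |F|^P ≤ B^P ≤ (B^P/η²) |F|². The first part is
  -- small through η uniformly in i, the second through the L² norm. No comparison of p with 2 is
  -- needed.
  have key : ∀ η, 0 < η → ∀ᶠ i in l, ∫⁻ x, ‖F i x‖ₑ ^ P ∂μ ≤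
      ENNReal.ofReal (η ^ (P - 1) * A + B ^ P / η ^ 2 * ‖F i‖ ^ 2) := by
    intro η hη
    filter_upwards [hA, hB] with i hAi hBi
    have hpt : ∀ᵐ x ∂μ, ‖F i x‖ₑ ^ P ≤ ENNReal.ofReal (η ^ (P - 1)) * ‖F i x‖ₑ +
        ENNReal.ofReal (B ^ P / η ^ 2) * ‖F i x‖ₑ ^ 2 := by
      filter_upwards [ae_norm_le_of_eLpNorm_top hB0 hBi] with x hx
      have hx0 := norm_nonneg (F i x)
      rw [← ofReal_norm, ENNReal.ofReal_rpow_of_nonneg hx0 hP0.le, ← ENNReal.ofReal_pow hx0,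
        ← ENNReal.ofReal_mul (by positivity), ← ENNReal.ofReal_mul (by positivity),
        ← ENNReal.ofReal_add (by positivity) (by positivity)]
      refine ENNReal.ofReal_le_ofReal ?_
      rcases le_total ‖F i x‖ η with h | h
      · have h1 : ‖F i x‖ ^ P = ‖F i x‖ ^ (P - 1) * ‖F i x‖ := by
          nth_rewrite 3 [← Real.rpow_one ‖F i x‖]
          rw [← Real.rpow_add_of_nonneg hx0 (by linarith) zero_le_one]
          congr 1; ring
        have h2 : ‖F i x‖ ^ (P - 1) * ‖F i x‖ ≤ η ^ (P - 1) * ‖F i x‖ :=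
          mul_le_mul_of_nonneg_right (Real.rpow_le_rpow hx0 h (by linarith)) hx0
        rw [h1]
        exact h2.trans (le_add_of_nonneg_right (by positivity))
      · have h1 : ‖F i x‖ ^ P ≤ B ^ P := Real.rpow_le_rpow hx0 hx hP0.le
        have h2 : B ^ P ≤ B ^ P / η ^ 2 * ‖F i x‖ ^ 2 := by
          rw [div_mul_eq_mul_div, le_div_iff₀ (by positivity)]
          gcongr
        exact (h1.trans h2).trans (le_add_of_nonneg_left (by positivity))
    refine (lintegral_mono_ae hpt).trans ?_
    rw [lintegral_add_left' ((Lp.aestronglyMeasurable (F i)).enorm.const_mul _),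
      lintegral_const_mul' _ _ (by simp), lintegral_const_mul' _ _ (by simp),
      ← enorm_sq_eq_lintegral, ← eLpNorm_one_eq_lintegral_enorm, enorm_sq_eq_ofReal,
      ENNReal.ofReal_add (by positivity) (by positivity), ENNReal.ofReal_mul (by positivity),
      ENNReal.ofReal_mul (by positivity)]
    gcongr
  have h1 : Tendsto (fun i => ∫⁻ x, ‖F i x‖ₑ ^ P ∂μ) l (𝓝 0) := by
    rw [ENNReal.tendsto_nhds_zero]
    intro ε hε
    obtain ⟨δ, hδ0, hδ⟩ := ENNReal.lt_iff_exists_nnreal_btwn.1 hε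
    have hδ0' : (0 : ℝ) < δ := by exact_mod_cast hδ0
    have hη : Tendsto (fun η : ℝ => η ^ (P - 1) * A) (𝓝[>] 0) (𝓝 0) := by
      have h2 : ContinuousAt (fun η : ℝ => η ^ (P - 1) * A) 0 :=
        (continuousAt_id.rpow_const (Or.inr (by linarith))).mul_const A
      have h3 := h2.tendsto.mono_left (nhdsWithin_le_nhds (s := Ioi 0))
      simpa [Real.zero_rpow (by linarith : P - 1 ≠ 0)] using h3
    obtain ⟨η, hη1, hη0⟩ := ((hη.eventually (gt_mem_nhds (half_pos hδ0'))).and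
      self_mem_nhdsWithin).exists
    have hF2 : Tendsto (fun i => B ^ P / η ^ 2 * ‖F i‖ ^ 2) l (𝓝 0) := by
      have := (hF.norm.pow 2).const_mul (B ^ P / η ^ 2)
      simpa using this
    filter_upwards [key η hη0, hF2.eventually (gt_mem_nhds (half_pos hδ0'))] with i hi1 hi2
    refine hi1.trans (le_trans ?_ hδ.le)
    rw [← ENNReal.ofReal_coe_nnreal]
    exact ENNReal.ofReal_le_ofReal (by linarith)
  have h2 := (ENNReal.continuous_rpow_const (y := 1 / P)).tendsto 0 |>.comp h1
  rw [ENNReal.zero_rpow_of_pos (by positivity)] at h2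
  refine h2.congr fun i => ?_
  rw [eLpNorm_eq_lintegral_rpow_enorm_toReal (zero_lt_one.trans hp).ne' hp'.ne]
  rfl

/-! ### Families in L² whose dt/t integral converges in L^p -/

theorem lpClass_of_memLp {f : M → 𝕜} (h : MemLp f p μ) : lpClass μ p f = h.toLp f := dif_pos h

theorem coeFn_lpClass {f : M → 𝕜} (h : MemLp f p μ) : lpClass μ p f =ᵐ[μ] f := by
  rw [lpClass_of_memLp h]; exact h.coeFn_toLp

/-- Families in `L²` whose `dt/t` integral converges absolutely in `L^p` by interpolation. -/
structure AdmissibleFamily (Φ : ℝ → Lp 𝕜 2 μ) : Prop where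
  cont : ∀ t, 0 < t → ContinuousAt Φ t
  small : ∃ K, 0 ≤ K ∧ ∀ t, 0 < t → eLpNorm (Φ t) 1 μ ≤ ENNReal.ofReal (K * t)
  large : ∃ K, 0 ≤ K ∧ ∀ t, 0 < t → eLpNorm (Φ t) 1 μ ≤ ENNReal.ofReal (K * t⁻¹)
  top : ∃ K, 0 ≤ K ∧ ∀ t, 0 < t → eLpNorm (Φ t) ∞ μ ≤ ENNReal.ofReal K

namespace AdmissibleFamily

variable {Φ Ψ : ℝ → Lp 𝕜 2 μ}

theorem memLp (h : AdmissibleFamily Φ) (hp : 1 < p) (hp' : p < ∞) {t : ℝ} (ht : 0 < t) :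
    MemLp (Φ t) p μ := by
  obtain ⟨K, hK, hb⟩ := h.small
  obtain ⟨K', hK', hb'⟩ := h.top
  exact ⟨Lp.aestronglyMeasurable _, (eLpNorm_le_of_one_of_top hp hp' (by positivity) hK'
    (hb t ht) (hb' t ht)).trans_lt ENNReal.ofReal_lt_top⟩

variable [Fact (1 ≤ p)]

/-- This supplies the strong measurability of the L^p-valued integrand: continuity is known in L²
only, and the bounds in L¹ and L^∞ transfer it. -/
theorem continuousAt_lpClass (h : AdmissibleFamily Φ) (hp : 1 < p) (hp' : p < ∞) {t : ℝ}
    (ht : 0 < t) : ContinuousAt (fun t => lpClass μ p (Φ t)) t := by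
  obtain ⟨K, hK, hb⟩ := h.small
  obtain ⟨K', hK', hb'⟩ := h.top
  have h1 : Tendsto (fun s => Φ s - Φ t) (𝓝 t) (𝓝 0) := by
    have := (h.cont t ht).tendsto.sub_const (Φ t)
    rwa [sub_self] at this
  have h2 := tendsto_eLpNorm_of_bounded (p := p) hp hp' (A := K * (t + 1) + K * t) (B := K' + K')
    (by positivity) (by positivity) ?_ ?_ h1
  · refine (Lp.tendsto_Lp_iff_tendsto_eLpNorm' _ _).2 (h2.congr' ?_)
    filter_upwards [Ioi_mem_nhds ht] with s hs
    refine eLpNorm_congr_ae ?_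
    filter_upwards [coeFn_lpClass (h.memLp hp hp' hs), coeFn_lpClass (h.memLp hp hp' ht),
      Lp.coeFn_sub (Φ s) (Φ t)] with x h1 h2 h3
    rw [h3, Pi.sub_apply, Pi.sub_apply, h1, h2]
  · filter_upwards [Ioo_mem_nhds ht (lt_add_one t)] with s hs
    rw [eLpNorm_congr_ae (Lp.coeFn_sub _ _), ENNReal.ofReal_add (by positivity) (by positivity)]
    refine (eLpNorm_sub_le (Lp.aestronglyMeasurable _) (Lp.aestronglyMeasurable _) le_rfl).trans
      (add_le_add ((hb s hs.1).trans (ENNReal.ofReal_le_ofReal ?_)) (hb t ht))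
    exact mul_le_mul_of_nonneg_left hs.2.le hK
  · filter_upwards [Ioi_mem_nhds ht] with s hs
    rw [eLpNorm_congr_ae (Lp.coeFn_sub _ _), ENNReal.ofReal_add hK' hK']
    exact (eLpNorm_sub_le (Lp.aestronglyMeasurable _) (Lp.aestronglyMeasurable _) le_top).trans
      (add_le_add (hb' s hs) (hb' t ht))

/-- Interpolation turns the bound min(t, 1/t) in L¹ into min(t, 1/t)^{1/p} in L^p, which leaves
t^{1/p-1} near 0 and t^{-1/p-1} at infinity. -/
theorem convergesAbsolutely (h : AdmissibleFamily Φ) (hp : 1 < p) (hp' : p < ∞) :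
    ConvergesAbsolutely p Φ := by
  refine ⟨fun t ht => h.memLp hp hp' ht, ?_⟩
  have hP := one_lt_toReal_of_one_lt hp hp'
  set s := 1 / p.toReal with hs
  have hs0 : 0 < s := by positivity
  obtain ⟨K₁, hK₁, hb₁⟩ := h.small
  obtain ⟨K₂, hK₂, hb₂⟩ := h.large
  obtain ⟨K, hK, hb⟩ := h.top
  have key : ∀ A, 0 ≤ A → ∀ u, 0 ≤ u → ∀ t, 0 < t → eLpNorm (Φ t) 1 μ ≤ ENNReal.ofReal (A * u) →
      ‖t⁻¹ • lpClass μ p (Φ t)‖ ≤ (A * K ^ (p.toReal - 1)) ^ s * (t⁻¹ * u ^ s) := by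
    intro A hA u hu t ht h1
    have h2 := eLpNorm_le_of_one_of_top hp hp' (by positivity) hK h1 (hb t ht)
    rw [norm_smul, Real.norm_of_nonneg (by positivity), lpClass_of_memLp (h.memLp hp hp' ht),
      Lp.norm_toLp, mul_left_comm]
    refine mul_le_mul_of_nonneg_left ?_ (by positivity)
    refine (ENNReal.toReal_mono (by simp) h2).trans (le_of_eq ?_)
    rw [ENNReal.toReal_ofReal (by positivity), mul_right_comm,
      Real.mul_rpow (by positivity) hu]
  have hm : AEStronglyMeasurable (fun t : ℝ => t⁻¹ • lpClass μ p (Φ t)) (volume.restrict (Ioi 0)) := by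
    refine ContinuousOn.aestronglyMeasurable (fun t ht => ?_) measurableSet_Ioi
    exact ((continuousAt_inv₀ (mem_Ioi.1 ht).ne').smul
      (h.continuousAt_lpClass hp hp' ht)).continuousWithinAt
  have hI : Ioc (0 : ℝ) 1 ∪ Ioi 1 = Ioi 0 := Ioc_union_Ioi_eq_Ioi zero_le_one
  rw [← hI] at hm ⊢
  refine IntegrableOn.union ?_ ?_
  · have i1 : IntegrableOn (fun t : ℝ => t ^ (s - 1)) (Ioc 0 1) := by
      have := intervalIntegral.intervalIntegrable_rpow' (a := 0) (b := 1) (r := s - 1)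
        (by linarith)
      rwa [intervalIntegrable_iff_integrableOn_Ioc_of_le zero_le_one] at this
    refine Integrable.mono' (i1.const_mul ((K₁ * K ^ (p.toReal - 1)) ^ s))
      (hm.mono_measure (Measure.restrict_mono subset_union_left le_rfl)) ?_
    filter_upwards [ae_restrict_mem measurableSet_Ioc] with t ht
    refine (key K₁ hK₁ t ht.1.le t ht.1 (hb₁ t ht.1)).trans (le_of_eq ?_)
    rw [Real.rpow_sub_one ht.1.ne', div_eq_inv_mul]
  · have i2 : IntegrableOn (fun t : ℝ => t ^ (-s - 1)) (Ioi 1) :=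
      integrableOn_Ioi_rpow_of_lt (by linarith) one_pos
    refine Integrable.mono' (i2.const_mul ((K₂ * K ^ (p.toReal - 1)) ^ s))
      (hm.mono_measure (Measure.restrict_mono subset_union_right le_rfl)) ?_
    filter_upwards [ae_restrict_mem measurableSet_Ioi] with t ht
    have ht0 : 0 < t := lt_trans one_pos ht
    refine (key K₂ hK₂ t⁻¹ (by positivity) t ht0 (hb₂ t ht0)).trans (le_of_eq ?_)
    rw [Real.rpow_sub_one ht0.ne', div_eq_inv_mul, Real.inv_rpow ht0.le, Real.rpow_neg ht0.le]

theorem add (h : AdmissibleFamily Φ) (h' : AdmissibleFamily Ψ) :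
    AdmissibleFamily (fun t => Φ t + Ψ t) := by
  have key : ∀ {q : ℝ≥0∞}, 1 ≤ q → ∀ {t A B}, 0 ≤ A → 0 ≤ B →
      eLpNorm (Φ t) q μ ≤ ENNReal.ofReal A → eLpNorm (Ψ t) q μ ≤ ENNReal.ofReal B →
      eLpNorm (Φ t + Ψ t : Lp 𝕜 2 μ) q μ ≤ ENNReal.ofReal (A + B) := by
    intro q hq t A B hA hB h1 h2
    rw [eLpNorm_congr_ae (Lp.coeFn_add _ _), ENNReal.ofReal_add hA hB]
    exact (eLpNorm_add_le (Lp.aestronglyMeasurable _) (Lp.aestronglyMeasurable _) hq).trans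
      (add_le_add h1 h2)
  refine ⟨fun t ht => (h.cont t ht).add (h'.cont t ht), ?_, ?_, ?_⟩
  · obtain ⟨K, hK, hb⟩ := h.small
    obtain ⟨K', hK', hb'⟩ := h'.small
    refine ⟨K + K', by positivity, fun t ht => ?_⟩
    rw [add_mul]
    exact key le_rfl (by positivity) (by positivity) (hb t ht) (hb' t ht)
  · obtain ⟨K, hK, hb⟩ := h.large
    obtain ⟨K', hK', hb'⟩ := h'.large
    refine ⟨K + K', by positivity, fun t ht => ?_⟩
    rw [add_mul]
    exact key le_rfl (by positivity) (by positivity) (hb t ht) (hb' t ht)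
  · obtain ⟨K, hK, hb⟩ := h.top
    obtain ⟨K', hK', hb'⟩ := h'.top
    exact ⟨K + K', by positivity, fun t ht => key le_top hK hK' (hb t ht) (hb' t ht)⟩

theorem lpIntegral_add (h : AdmissibleFamily Φ) (h' : AdmissibleFamily Ψ) (hp : 1 < p)
    (hp' : p < ∞) : lpIntegral p (fun t => Φ t + Ψ t) = lpIntegral p Φ + lpIntegral p Ψ := by
  rw [lpIntegral, lpIntegral, lpIntegral, ← integral_add (h.convergesAbsolutely hp hp').2
    (h'.convergesAbsolutely hp hp').2]
  refine setIntegral_congr_fun measurableSet_Ioi fun t ht => ?_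
  rw [← smul_add]
  congr 1
  refine Lp.ext ?_
  filter_upwards [coeFn_lpClass ((h.add h').memLp hp hp' ht), coeFn_lpClass (h.memLp hp hp' ht),
    coeFn_lpClass (h'.memLp hp hp' ht), Lp.coeFn_add (Φ t) (Ψ t),
    Lp.coeFn_add (lpClass μ p (Φ t)) (lpClass μ p (Ψ t))] with x h1 h2 h3 h4 h5
  rw [h1, h5, Pi.add_apply, h2, h3, h4, Pi.add_apply]

end AdmissibleFamily

/-! ### The fundamental theorem of calculus between L² and L^p -/

theorem integrableOn_of_memLp {f : M → 𝕜} (hp : 1 ≤ p) (hf : MemLp f p μ) {s : Set M}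
    (hs : μ s < ∞) : IntegrableOn f s μ := by
  have : IsFiniteMeasure (μ.restrict s) := ⟨by rwa [Measure.restrict_apply_univ]⟩
  exact (hf.restrict s).integrable hp

/-- Integration over a set of finite measure is a continuous functional on `L^p`. -/
theorem exists_setIntegral_clm [Fact (1 ≤ p)] {s : Set M} (hs : μ s < ∞) :
    ∃ ℓ : Lp 𝕜 p μ →L[ℝ] 𝕜, ∀ f, ℓ f = ∫ x in s, f x ∂μ := by
  have hp : 1 ≤ p := Fact.out
  have hint : ∀ f : Lp 𝕜 p μ, IntegrableOn f s μ := fun f =>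
    integrableOn_of_memLp hp (Lp.memLp f) hs
  let T : Lp 𝕜 p μ →ₗ[ℝ] 𝕜 := IsLinearMap.mk' (fun f => ∫ x in s, f x ∂μ) ⟨fun f g => by
    rw [← integral_add (hint f) (hint g)]
    exact integral_congr_ae (ae_restrict_of_ae (Lp.coeFn_add f g)), fun c f => by
    rw [← integral_smul]
    exact integral_congr_ae (ae_restrict_of_ae (Lp.coeFn_smul c f))⟩
  have hs1 : μ s ^ (1 / (1 : ℝ≥0∞).toReal - 1 / p.toReal) ≠ ∞ := by
    refine ENNReal.rpow_ne_top_of_nonneg ?_ hs.ne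
    rw [ENNReal.toReal_one, div_one, sub_nonneg]
    rcases eq_or_ne p ∞ with rfl | h
    · simp
    · have h1 : 1 ≤ p.toReal := by
        rw [← ENNReal.toReal_one]; exact ENNReal.toReal_mono h hp
      exact div_le_one_of_le₀ h1 (by linarith)
  refine ⟨T.mkContinuous (μ s ^ (1 / (1 : ℝ≥0∞).toReal - 1 / p.toReal)).toReal fun f => ?_,
    fun f => rfl⟩
  have h1 : ‖T f‖ₑ ≤ ‖f‖ₑ * μ s ^ (1 / (1 : ℝ≥0∞).toReal - 1 / p.toReal) := by
    refine (enorm_integral_le_lintegral_enorm _).trans ?_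
    rw [← eLpNorm_one_eq_lintegral_enorm]
    refine (eLpNorm_le_eLpNorm_mul_rpow_measure_univ hp
      (Lp.aestronglyMeasurable f).restrict).trans ?_
    rw [Measure.restrict_apply_univ, Lp.enorm_def]
    exact mul_le_mul_left (eLpNorm_mono_measure _ Measure.restrict_le_self) _
  have h2 := ENNReal.toReal_mono (ENNReal.mul_ne_top (by finiteness) hs1) h1
  rw [ENNReal.toReal_mul, toReal_enorm, toReal_enorm, mul_comm] at h2
  exact h2

/-- The fundamental theorem of calculus for a curve in `L²` whose derivative is absolutely
integrable in `L^p`. -/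
theorem AdmissibleFamily.lpIntegral_eq [Fact (1 ≤ p)] {Φ W : ℝ → Lp 𝕜 2 μ} {w : Lp 𝕜 2 μ}
    (h : AdmissibleFamily Φ) (hp : 1 < p) (hp' : p < ∞) (hw : MemLp w p μ)
    (hW : ∀ t, 0 < t → HasDerivAt W (-(t⁻¹ • Φ t)) t) (hW0 : Tendsto W (𝓝[>] 0) (𝓝 w))
    (hW1 : Tendsto W atTop (𝓝 0)) : lpIntegral p Φ = lpClass μ p w := by
  refine Lp.ext (Lp.ae_eq_of_forall_setIntegral_eq _ _ (zero_lt_one.trans hp).ne' hp'.ne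
    (fun s _ hs => integrableOn_of_memLp hp.le (Lp.memLp _) hs)
    (fun s _ hs => integrableOn_of_memLp hp.le (Lp.memLp _) hs) fun s hsm hs => ?_)
  -- Integration over a set of finite measure is continuous on L^p and on L², and takes the same
  -- value on a common element. It reduces the claim to scalar functions of t.
  obtain ⟨ℓ, hℓ⟩ := exists_setIntegral_clm (𝕜 := 𝕜) (p := p) hs
  obtain ⟨ℓ₂, hℓ₂⟩ := exists_setIntegral_clm (𝕜 := 𝕜) (p := 2) hs
  have hcl : ∀ g : Lp 𝕜 2 μ, MemLp g p μ → ℓ (lpClass μ p g) = ℓ₂ g := by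
    intro g hg
    rw [hℓ, hℓ₂]
    exact integral_congr_ae (ae_restrict_of_ae (coeFn_lpClass hg))
  rw [← hℓ, ← hℓ, hcl w hw, lpIntegral, ← ContinuousLinearMap.integral_comp_comm ℓ
    (h.convergesAbsolutely hp hp').2]
  -- W is controlled only for t > 0; giving it the value w at 0 makes it continuous from the right
  -- there.
  set V : ℝ → Lp 𝕜 2 μ := Function.update W 0 w with hV
  have hVW : ∀ t, 0 < t → V =ᶠ[𝓝 t] W := by
    intro t ht
    filter_upwards [Ioi_mem_nhds ht] with r hr
    exact Function.update_of_ne (mem_Ioi.1 hr).ne' _ _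
  have hV0 : V 0 = w := Function.update_self _ _ _
  have hcont : ContinuousWithinAt (fun t => ℓ₂ (V t)) (Ici 0) 0 := by
    have h1 : ContinuousWithinAt V (Ici 0) 0 := by
      rw [← continuousWithinAt_Ioi_iff_Ici, ContinuousWithinAt, hV0]
      refine hW0.congr' ?_
      filter_upwards [self_mem_nhdsWithin] with r hr
      exact (Function.update_of_ne (mem_Ioi.1 hr).ne' _ _).symm
    exact ℓ₂.continuous.continuousAt.comp_continuousWithinAt h1
  have hderiv : ∀ t ∈ Ioi (0 : ℝ), HasDerivAt (fun t => ℓ₂ (V t))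
      (-ℓ (t⁻¹ • lpClass μ p (Φ t))) t := by
    intro t ht
    have h1 := ℓ₂.hasFDerivAt.comp_hasDerivAt t ((hW t ht).congr_of_eventuallyEq (hVW t ht))
    refine h1.congr_deriv ?_
    rw [map_neg, map_smul, map_smul, hcl _ (h.memLp hp hp' ht)]
  have h2 := integral_Ioi_of_hasDerivAt_of_tendsto hcont hderiv
    (ℓ.integrable_comp (h.convergesAbsolutely hp hp').2).neg (m := 0) ?_
  · rw [integral_neg, hV0, zero_sub, neg_inj] at h2
    exact h2
  · have h3 := (ℓ₂.continuous.tendsto 0).comp hW1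
    rw [map_zero] at h3
    refine h3.congr' ?_
    filter_upwards [eventually_gt_atTop 0] with r hr
    exact congrArg ℓ₂ (Function.update_of_ne (ne_of_gt hr) _ _).symm

end Interpolation

/-! ### Products in `L²` -/

section Products

variable {𝕜 M : Type*} [RCLike 𝕜] [MeasurableSpace M] {μ : Measure M}

/-- The product of two elements of `L²`, in `L²` if one of them is bounded. -/
noncomputable def prodClass (a b : Lp 𝕜 2 μ) : Lp 𝕜 2 μ := lpClass μ 2 fun x => a x * b x

theorem memLp_mul_left {a b : Lp 𝕜 2 μ} (ha : eLpNorm a ∞ μ < ∞) :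
    MemLp (fun x => a x * b x) 2 μ :=
  (Lp.memLp b).mul (p := ∞) (r := 2) ⟨Lp.aestronglyMeasurable a, ha⟩

theorem coeFn_prodClass {a b : Lp 𝕜 2 μ} (ha : eLpNorm a ∞ μ < ∞) :
    prodClass a b =ᵐ[μ] fun x => a x * b x := coeFn_lpClass (memLp_mul_left ha)

theorem prodClass_comm (a b : Lp 𝕜 2 μ) : prodClass a b = prodClass b a := by
  simp only [prodClass, mul_comm]

theorem norm_prodClass_le {a : Lp 𝕜 2 μ} {A : ℝ} (hA : 0 ≤ A)
    (ha : eLpNorm a ∞ μ ≤ ENNReal.ofReal A) (b : Lp 𝕜 2 μ) : ‖prodClass a b‖ ≤ A * ‖b‖ := by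
  refine Lp.norm_le_mul_norm_of_ae_le_mul ?_
  filter_upwards [coeFn_prodClass (b := b) (ha.trans_lt ENNReal.ofReal_lt_top),
    ae_norm_le_of_eLpNorm_top hA ha] with x hx hx'
  rw [hx, norm_mul]
  exact mul_le_mul_of_nonneg_right hx' (norm_nonneg _)

theorem eLpNorm_one_mul_le_of_two {φ ψ : M → 𝕜} (hφ : AEStronglyMeasurable φ μ)
    (hψ : AEStronglyMeasurable ψ μ) :
    eLpNorm (fun x => φ x * ψ x) 1 μ ≤ eLpNorm φ 2 μ * eLpNorm ψ 2 μ := by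
  have h := eLpNorm_smul_le_mul_eLpNorm (p := 2) (q := 2) (r := 1) hψ hφ
  exact h

theorem eLpNorm_one_mul_le (a b : Lp 𝕜 2 μ) :
    eLpNorm (fun x => a x * b x) 1 μ ≤ ENNReal.ofReal (‖a‖ * ‖b‖) := by
  rw [ENNReal.ofReal_mul (norm_nonneg a), ofReal_norm, ofReal_norm, Lp.enorm_def, Lp.enorm_def]
  exact eLpNorm_one_mul_le_of_two (Lp.aestronglyMeasurable a) (Lp.aestronglyMeasurable b)

theorem eLpNorm_one_prodClass_le {a b : Lp 𝕜 2 μ} (ha : eLpNorm a ∞ μ < ∞) :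
    eLpNorm (prodClass a b) 1 μ ≤ ENNReal.ofReal (‖a‖ * ‖b‖) := by
  rw [eLpNorm_congr_ae (coeFn_prodClass ha)]
  exact eLpNorm_one_mul_le a b

theorem eLpNorm_top_prodClass_le {a b : Lp 𝕜 2 μ} {A B : ℝ} (hA : 0 ≤ A)
    (ha : eLpNorm a ∞ μ ≤ ENNReal.ofReal A) (hb : eLpNorm b ∞ μ ≤ ENNReal.ofReal B) :
    eLpNorm (prodClass a b) ∞ μ ≤ ENNReal.ofReal (A * B) := by
  rw [eLpNorm_congr_ae (coeFn_prodClass (ha.trans_lt ENNReal.ofReal_lt_top)),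
    ENNReal.ofReal_mul hA]
  exact (eLpNorm_smul_le_mul_eLpNorm (p := ∞) (q := ∞) (r := ∞) (Lp.aestronglyMeasurable b)
    (Lp.aestronglyMeasurable a)).trans (mul_le_mul' ha hb)

theorem prodClass_sub {a b c : Lp 𝕜 2 μ} (ha : eLpNorm a ∞ μ < ∞) :
    prodClass a (b - c) = prodClass a b - prodClass a c := by
  refine Lp.ext ?_
  filter_upwards [coeFn_prodClass (b := b - c) ha, coeFn_prodClass (b := b) ha,
    coeFn_prodClass (b := c) ha, Lp.coeFn_sub b c,
    Lp.coeFn_sub (prodClass a b) (prodClass a c)] with x h1 h2 h3 h4 h5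
  rw [h1, h5, Pi.sub_apply, h2, h3, h4, Pi.sub_apply, mul_sub]

theorem prodClass_smul {a b : Lp 𝕜 2 μ} (ha : eLpNorm a ∞ μ < ∞) (c : ℝ) :
    prodClass a (c • b) = c • prodClass a b := by
  refine Lp.ext ?_
  filter_upwards [coeFn_prodClass (b := c • b) ha, coeFn_prodClass (b := b) ha,
    Lp.coeFn_smul c b, Lp.coeFn_smul c (prodClass a b)] with x h1 h2 h3 h4
  rw [h1, h4, Pi.smul_apply, h2, h3, Pi.smul_apply, mul_smul_comm]

/-- Products of convergent nets converge if one of them is bounded and so is the limit of the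
other. -/
theorem tendsto_prodClass {ι : Type*} {l : Filter ι} {a b : ι → Lp 𝕜 2 μ} {a₀ b₀ : Lp 𝕜 2 μ}
    {A B : ℝ} (hA : 0 ≤ A) (hB : 0 ≤ B) (ha : Tendsto a l (𝓝 a₀)) (hb : Tendsto b l (𝓝 b₀))
    (hab : eLpNorm a₀ ∞ μ ≤ ENNReal.ofReal A)
    (hbb : ∀ᶠ i in l, eLpNorm (b i) ∞ μ ≤ ENNReal.ofReal B) :
    Tendsto (fun i => prodClass (a i) (b i)) l (𝓝 (prodClass a₀ b₀)) := by
  have h1 : Tendsto (fun i => B * ‖a i - a₀‖ + A * ‖b i - b₀‖) l (𝓝 0) := by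
    have h2 := (tendsto_iff_norm_sub_tendsto_zero.1 ha).const_mul B
    have h3 := (tendsto_iff_norm_sub_tendsto_zero.1 hb).const_mul A
    simpa using h2.add h3
  rw [tendsto_iff_norm_sub_tendsto_zero]
  refine squeeze_zero' (Eventually.of_forall fun i => norm_nonneg _) ?_ h1
  filter_upwards [hbb] with i hi
  have hi' := hi.trans_lt ENNReal.ofReal_lt_top
  have hab' := hab.trans_lt ENNReal.ofReal_lt_top
  -- The difference is split so that the bounded factors are b_i and a₀; the a_i themselves need no
  -- uniform bound.
  have e : prodClass (a i) (b i) - prodClass a₀ b₀ =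
      prodClass (b i) (a i - a₀) + prodClass a₀ (b i - b₀) := by
    rw [prodClass_sub hi', prodClass_sub hab', prodClass_comm (b i), prodClass_comm (b i)]
    abel
  rw [e]
  exact (norm_add_le _ _).trans (add_le_add (norm_prodClass_le hB hi _)
    (norm_prodClass_le hA hab _))

/-- The product rule for bounded curves in `L²`. -/
theorem hasDerivAt_prodClass {a b : ℝ → Lp 𝕜 2 μ} {a' b' : Lp 𝕜 2 μ} {t A A' B : ℝ}
    (hA : 0 ≤ A) (hA' : 0 ≤ A') (hB : 0 ≤ B) (ha : HasDerivAt a a' t) (hb : HasDerivAt b b' t)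
    (hat : eLpNorm (a t) ∞ μ ≤ ENNReal.ofReal A)
    (ha' : eLpNorm a' ∞ μ ≤ ENNReal.ofReal A')
    (hbt : ∀ᶠ s in 𝓝 t, eLpNorm (b s) ∞ μ ≤ ENNReal.ofReal B) :
    HasDerivAt (fun s => prodClass (a s) (b s)) (prodClass a' (b t) + prodClass (a t) b') t := by
  rw [hasDerivAt_iff_tendsto_slope] at ha hb ⊢
  rename_i hb0
  have hbc : Tendsto b (𝓝[≠] t) (𝓝 (b t)) :=
    (hasDerivAt_iff_tendsto_slope.2 hb).continuousAt.tendsto.mono_left nhdsWithin_le_nhds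
  have hbt' := nhdsWithin_le_nhds (s := {t}ᶜ) hbt
  have h1 := tendsto_prodClass hA' hB ha hbc ha' hbt'
  have h2 : Tendsto (fun s => prodClass (a t) (slope b t s)) (𝓝[≠] t) (𝓝 (prodClass (a t) b')) := by
    rw [tendsto_iff_norm_sub_tendsto_zero] at hb ⊢
    refine squeeze_zero (fun s => norm_nonneg _) (fun s => ?_)
      (by simpa using hb.const_mul A)
    rw [← prodClass_sub (hat.trans_lt ENNReal.ofReal_lt_top)]
    exact norm_prodClass_le hA hat _
  -- Leibniz splitting of the slope: slope of a times b(s), plus a(t) times slope of b. Only the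
  -- limit a' of the first slope has to be bounded, not the slope itself.
  refine (h1.add h2).congr' ?_
  filter_upwards [hbt'] with s hs
  have hs' := hs.trans_lt ENNReal.ofReal_lt_top
  have hat' := hat.trans_lt ENNReal.ofReal_lt_top
  simp only [slope_def_module]
  rw [prodClass_comm _ (b s), prodClass_smul hs', prodClass_sub hs', prodClass_smul hat',
    prodClass_sub hat', ← smul_add, prodClass_comm (b s), prodClass_comm (b s)]
  congr 1
  abel

end Products

/-! ### Families of operators applied to curves -/

section OperatorCurves

variable {E : Type*} [NormedAddCommGroup E] [NormedSpace ℝ E]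

omit [NormedSpace ℝ E] in
/-- Strong continuity along curves for uniformly bounded operators. -/
theorem tendsto_apply_of_bounded {ι : Type*} {l : Filter ι} {T : ι → E → E} {K : ℝ}
    (hT : ∀ᶠ i in l, ∀ x y, ‖T i x - T i y‖ ≤ K * ‖x - y‖) {z : ι → E} {z₀ w : E}
    (hz : Tendsto z l (𝓝 z₀)) (hw : Tendsto (fun i => T i z₀) l (𝓝 w)) :
    Tendsto (fun i => T i (z i)) l (𝓝 w) := by
  have h1 : Tendsto (fun i => T i (z i) - T i z₀) l (𝓝 0) := by
    refine squeeze_zero_norm' (hT.mono fun i hi => hi _ _) ?_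
    simpa using (tendsto_iff_norm_sub_tendsto_zero.1 hz).const_mul K
  simpa using h1.add hw

/-- A product rule that asks for differentiability of the operators only at the one vector z(t). The
increment of z is handled by uniform boundedness and strong continuity at z'. -/
theorem hasDerivAt_apply_of_bounded {T : ℝ → E → E} {K t : ℝ}
    (hT : ∀ᶠ s in 𝓝 t, ∃ A : E →L[ℝ] E, (∀ x, A x = T s x) ∧ ∀ x, ‖A x‖ ≤ K * ‖x‖)
    {z : ℝ → E} {z' w v : E} (hz : HasDerivAt z z' t) (hw : HasDerivAt (fun s => T s (z t)) w t)
    (hv : Tendsto (fun s => T s z') (𝓝 t) (𝓝 v)) : HasDerivAt (fun s => T s (z s)) (w + v) t := by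
  rw [hasDerivAt_iff_tendsto_slope] at hz hw ⊢
  have hT' := hT.filter_mono (nhdsWithin_le_nhds (s := {t}ᶜ))
  have h1 : Tendsto (fun s => T s (slope z t s)) (𝓝[≠] t) (𝓝 v) := by
    refine tendsto_apply_of_bounded (K := K) (hT'.mono ?_) hz (hv.mono_left nhdsWithin_le_nhds)
    rintro s ⟨A, hA, hAb⟩ x y
    rw [← hA, ← hA, ← map_sub]
    exact hAb _
  refine (hw.add h1).congr' ?_
  filter_upwards [hT'] with s ⟨A, hA, _⟩
  simp only [slope_def_module]
  rw [← hA ((s - t)⁻¹ • (z s - z t)), ← hA (z s), ← hA (z t), map_smul, map_sub, ← smul_add]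
  congr 1
  abel

end OperatorCurves

/-! ### Paraproducts of bounded functions -/

section Endpoint

variable {𝕜 M : Type*} [RCLike 𝕜] [MeasurableSpace M] {μ : Measure M}
  {T : Lp 𝕜 2 μ → Lp 𝕜 2 μ} {K : ℝ≥0}

theorem EndpointBound.one_le (h : EndpointBound T K) {f : Lp 𝕜 2 μ} {B : ℝ}
    (hf : eLpNorm f 1 μ ≤ ENNReal.ofReal B) : eLpNorm (T f) 1 μ ≤ ENNReal.ofReal (K * B) := by
  rw [ENNReal.ofReal_mul K.coe_nonneg, ENNReal.ofReal_coe_nnreal]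
  exact (h.one f).trans (mul_le_mul_right hf _)

theorem EndpointBound.top_le (h : EndpointBound T K) {f : Lp 𝕜 2 μ} {B : ℝ}
    (hf : eLpNorm f ∞ μ ≤ ENNReal.ofReal B) : eLpNorm (T f) ∞ μ ≤ ENNReal.ofReal (K * B) := by
  rw [ENNReal.ofReal_mul K.coe_nonneg, ENNReal.ofReal_coe_nnreal]
  exact (h.top f).trans (mul_le_mul_right hf _)

theorem aestronglyMeasurable_kernelApply [SFinite μ] {κ : M → M → 𝕜}
    (hκ : Measurable (Function.uncurry κ)) {f : M → 𝕜} (hf : AEStronglyMeasurable f μ) :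
    AEStronglyMeasurable (kernelApply μ κ f) μ :=
  (hκ.aestronglyMeasurable.mul hf.comp_snd).integral_prod_right'

theorem eLpNorm_one_smul_le (c : ℝ) {w : Lp 𝕜 2 μ} {A : ℝ}
    (hA : eLpNorm w 1 μ ≤ ENNReal.ofReal A) :
    eLpNorm ((c : 𝕜) • w : Lp 𝕜 2 μ) 1 μ ≤ ENNReal.ofReal (|c| * A) := by
  rw [eLpNorm_congr_ae (Lp.coeFn_smul _ _), eLpNorm_const_smul,
    ENNReal.ofReal_mul (abs_nonneg c), ← ofReal_norm, RCLike.norm_ofReal]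
  exact mul_le_mul_right hA _

theorem eLpNorm_top_le_ofReal {f : Lp 𝕜 2 μ} (hf : eLpNorm f ∞ μ < ∞) :
    eLpNorm f ∞ μ ≤ ENNReal.ofReal (eLpNorm f ∞ μ).toReal := by
  rw [ENNReal.ofReal_toReal hf.ne]

end Endpoint

/-! ### Admissibility of the three families and the product formula -/

section Paraproducts

variable {𝕜 M : Type*} [RCLike 𝕜] [MetricSpace M] [SeparableSpace M]
  [MeasurableSpace M] [BorelSpace M] {μ : Measure M} [SigmaFinite μ]
  {L : Lp 𝕜 2 μ →ₗ.[𝕜] Lp 𝕜 2 μ} {F : Submodule ℝ (Lp 𝕜 2 μ)}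
  {Γ : F →ₗ[ℝ] F →ₗ[ℝ] (M →ₘ[μ] 𝕜)} {k : ℝ → M → M → 𝕜} {n : ℕ} {C₀ C : ℝ}

omit [SeparableSpace M] [BorelSpace M] [SigmaFinite μ] in
theorem SobolevSetting.hasGaussianKernel (hL : SobolevSetting L F Γ k) : HasGaussianKernel L k :=
  ⟨hL.kernel_measurable, hL.kernel_repr, hL.kernel_bound⟩

omit [SeparableSpace M] [BorelSpace M] [SigmaFinite μ] in
-- Cauchy-Schwarz for Γ and then in L², followed by ‖Γ(a)‖₂ ≲ ‖L^{1/2}a‖₂ ≲ ‖a‖₂ + ‖La‖₂.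
theorem SobolevSetting.exists_eLpNorm_one_gamma_le (hL : SobolevSetting L F Γ k)
    (hC : IsAnalyticContraction L C) :
    ∃ K, 0 ≤ K ∧ ∀ a b : F, (a : Lp 𝕜 2 μ) ∈ L.domain → (b : Lp 𝕜 2 μ) ∈ L.domain →
      eLpNorm (Γ a b) 1 μ ≤ ENNReal.ofReal (K *
        ((‖(a : Lp 𝕜 2 μ)‖ + ‖opApply L (a : Lp 𝕜 2 μ)‖) *
          (‖(b : Lp 𝕜 2 μ)‖ + ‖opApply L (b : Lp 𝕜 2 μ)‖))) := by
  obtain ⟨R, hR⟩ := hL.riesz_two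
  obtain ⟨S, hS, hSb⟩ := hC.exists_norm_sqrtApply_le
  have h1 : ∀ a : F, (a : Lp 𝕜 2 μ) ∈ L.domain → eLpNorm (gammaLength Γ a) 2 μ ≤
      ENNReal.ofReal (R * S * (‖(a : Lp 𝕜 2 μ)‖ + ‖opApply L (a : Lp 𝕜 2 μ)‖)) := by
    intro a ha
    refine (hR a ha).trans ?_
    rw [mul_assoc, ENNReal.ofReal_mul R.coe_nonneg, ENNReal.ofReal_coe_nnreal, ← ofReal_norm]
    exact mul_le_mul_right (ENNReal.ofReal_le_ofReal (hSb _ ha)) _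
  have hm : ∀ a : F, AEStronglyMeasurable (gammaLength Γ a) μ := fun a =>
    (Real.continuous_sqrt.comp continuous_norm).comp_aestronglyMeasurable
      (AEEqFun.aestronglyMeasurable (Γ a a))
  refine ⟨R * S * (R * S), by positivity, fun a b ha hb => ?_⟩
  have h2 : eLpNorm (Γ a b) 1 μ ≤
      eLpNorm (fun x => gammaLength Γ a x * gammaLength Γ b x) 1 μ := by
    refine eLpNorm_mono_ae ?_
    filter_upwards [hL.gamma_le a b] with x hx
    exact hx.trans (le_abs_self _)
  have h3 : eLpNorm (fun x => gammaLength Γ a x * gammaLength Γ b x) 1 μ ≤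
      eLpNorm (gammaLength Γ a) 2 μ * eLpNorm (gammaLength Γ b) 2 μ :=
    eLpNorm_one_mul_le_of_two (hm a) (hm b)
  refine (h2.trans (h3.trans (mul_le_mul' (h1 a ha) (h1 b hb)))).trans (le_of_eq ?_)
  rw [← ENNReal.ofReal_mul (by positivity)]
  congr 1
  ring

/-- The carré du champ identity bounds `L e^{-tL}` of a product in `L¹`. -/
theorem SobolevSetting.exists_eLpNorm_one_opApply_prodClass_le (hL : SobolevSetting L F Γ k)
    (hμ : PolynomialGrowth μ n C₀) (hC : IsAnalyticContraction L C) :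
    ∃ K, 0 ≤ K ∧ ∀ (t : ℝ) (a b : Lp 𝕜 2 μ), 0 < t → a ∈ L.domain → b ∈ L.domain →
      eLpNorm a ∞ μ < ∞ → eLpNorm b ∞ μ < ∞ →
      eLpNorm (opApply L (heatSemigroup L t (prodClass a b)) : Lp 𝕜 2 μ) 1 μ ≤
        ENNReal.ofReal (K * ((‖a‖ + ‖opApply L a‖) * (‖b‖ + ‖opApply L b‖))) := by
  obtain ⟨G, hG, hGb⟩ := hL.exists_eLpNorm_one_gamma_le hC
  obtain ⟨K, hK⟩ := hL.hasGaussianKernel.exists_eLpNorm_kernelApply_le hμ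
  refine ⟨K + K + 2 * (K * G), by positivity, fun t a b ht ha hb ha' hb' => ?_⟩
  have hcdc := hL.carre_du_champ t ht ⟨a, hL.domain_subset a ha⟩ ⟨b, hL.domain_subset b hb⟩ ha hb
    ⟨Lp.aestronglyMeasurable a, ha'⟩ ⟨Lp.aestronglyMeasurable b, hb'⟩
  set γ := Γ ⟨a, hL.domain_subset a ha⟩ ⟨b, hL.domain_subset b hb⟩
  set X := (‖a‖ + ‖opApply L a‖) * (‖b‖ + ‖opApply L b‖) with hX
  have hX0 : 0 ≤ X := by positivity
  have hmm : ∀ c d : Lp 𝕜 2 μ, AEStronglyMeasurable (fun x => c x * d x) μ := fun c d =>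
    (Lp.aestronglyMeasurable c).mul (Lp.aestronglyMeasurable d)
  have hk : ∀ {w : M → 𝕜}, AEStronglyMeasurable w μ →
      AEStronglyMeasurable (kernelApply μ (k t) w) μ := fun hw =>
    aestronglyMeasurable_kernelApply (hL.kernel_measurable t ht) hw
  -- The kernel operators are bounded on L¹ uniformly in t, so it is enough to bound La · b, a · Lb
  -- and Γ(a,b) in L¹. No negative power of t appears.
  have hb1 : ∀ {w : M → 𝕜} {A : ℝ}, AEStronglyMeasurable w μ →
      eLpNorm w 1 μ ≤ ENNReal.ofReal A →
      eLpNorm (kernelApply μ (k t) w) 1 μ ≤ ENNReal.ofReal (K * A) := fun hw hA => by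
    rw [ENNReal.ofReal_mul K.coe_nonneg, ENNReal.ofReal_coe_nnreal]
    exact (hK t ht _ hw).trans (mul_le_mul_right hA _)
  have e1 := hb1 (A := X) (hmm (opApply L a) b) ((eLpNorm_one_mul_le _ _).trans
    (ENNReal.ofReal_le_ofReal (by
      rw [hX]
      exact mul_le_mul (le_add_of_nonneg_left (norm_nonneg _))
        (le_add_of_nonneg_right (norm_nonneg _)) (norm_nonneg _) (by positivity))))
  have e2 := hb1 (A := X) (hmm a (opApply L b)) ((eLpNorm_one_mul_le _ _).trans
    (ENNReal.ofReal_le_ofReal (by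
      rw [hX]
      exact mul_le_mul (le_add_of_nonneg_right (norm_nonneg _))
        (le_add_of_nonneg_left (norm_nonneg _)) (norm_nonneg _) (by positivity))))
  have hγ : AEStronglyMeasurable (γ : M → 𝕜) μ := AEEqFun.aestronglyMeasurable γ
  have e3 : eLpNorm ((2 : 𝕜) • kernelApply μ (k t) γ) 1 μ ≤
      ENNReal.ofReal (2 * (K * (G * X))) := by
    rw [eLpNorm_const_smul, ENNReal.ofReal_mul zero_le_two]
    refine mul_le_mul' (le_of_eq ?_) (hb1 hγ (hGb _ _ ha hb))
    rw [← ofReal_norm]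
    simp
  have hsum : ((opApply L (heatSemigroup L t (prodClass a b)) : Lp 𝕜 2 μ) : M → 𝕜) =ᵐ[μ]
      kernelApply μ (k t) (fun y => opApply L a y * b y) +
        kernelApply μ (k t) (fun y => a y * opApply L b y) -
        (2 : 𝕜) • kernelApply μ (k t) γ := hcdc
  rw [eLpNorm_congr_ae hsum]
  refine (eLpNorm_sub_le ((hk (hmm _ _)).add (hk (hmm _ _))) ((hk hγ).const_smul _)
    le_rfl).trans ?_
  refine (add_le_add ((eLpNorm_add_le (hk (hmm _ _)) (hk (hmm _ _)) le_rfl).trans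
    (add_le_add e1 e2)) e3).trans (le_of_eq ?_)
  rw [← ENNReal.ofReal_add (by positivity) (by positivity),
    ← ENNReal.ofReal_add (by positivity) (by positivity)]
  congr 1
  ring

omit [MetricSpace M] [SeparableSpace M] [BorelSpace M] [SigmaFinite μ] in
theorem IsAnalyticContraction.continuousAt_opP_apply (hC : IsAnalyticContraction L C) {D : ℕ}
    (hD : 0 < D) {z : ℝ → Lp 𝕜 2 μ} {t : ℝ} (ht : 0 < t) (hz : ContinuousAt z t) :
    ContinuousAt (fun s => opP L D s (z s)) t := by
  obtain ⟨K, hK, hKb⟩ := hC.exists_norm_opP_le D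
  refine tendsto_apply_of_bounded (K := K) ?_ hz (hC.hasDerivAt_opP hD ht (z t)).continuousAt
  filter_upwards [Ioi_mem_nhds ht] with s hs x y
  obtain ⟨T, hT⟩ := hC.exists_clm_opP D hs
  rw [← hT, ← hT, ← map_sub, hT]
  exact hKb s _ hs

omit [MetricSpace M] [SeparableSpace M] [BorelSpace M] [SigmaFinite μ] in
theorem IsAnalyticContraction.continuousAt_opQ_apply (hC : IsAnalyticContraction L C) (D : ℕ)
    {z : ℝ → Lp 𝕜 2 μ} {t : ℝ} (ht : 0 < t) (hz : ContinuousAt z t) :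
    ContinuousAt (fun s => opQ L D s (z s)) t := by
  obtain ⟨K, hK, hKb⟩ := hC.exists_norm_opQ_le D
  refine tendsto_apply_of_bounded (K := K) ?_ hz (hC.continuousAt_opQ D ht (z t))
  filter_upwards [Ioi_mem_nhds ht] with s hs x y
  obtain ⟨T, hT⟩ := hC.exists_clm D hs
  have h1 := hKb s (x - y) hs
  rwa [opQ, ← hT, map_sub, smul_sub, hT, hT] at h1

/-- The paraproduct of bounded functions in the domain and in the range of `L`. -/
theorem admissibleFamily_paraproductTerm (hk : HasGaussianKernel L k)
    (hμ : PolynomialGrowth μ n C₀) (hC : IsAnalyticContraction L C) {D : ℕ} (hD : 0 < D)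
    {f g u : Lp 𝕜 2 μ} (hf : f ∈ L.domain) (hu : u ∈ L.domain) (huf : opApply L u = f)
    (hf' : eLpNorm f ∞ μ < ∞) (hg' : eLpNorm g ∞ μ < ∞) :
    AdmissibleFamily (paraproductTerm L D g f) := by
  obtain ⟨P, hP⟩ := hk.exists_endpointBound_opP hμ hC D
  obtain ⟨Q, hQ⟩ := hk.exists_endpointBound_opQ hμ hC D
  obtain ⟨P₂, hP₂, hP₂b⟩ := hC.exists_norm_opP_le D
  obtain ⟨Q₁, hQ₁, hQ₁b⟩ := hC.exists_norm_opQ_le_mul hD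
  obtain ⟨Q₂, hQ₂, hQ₂b⟩ := hC.exists_norm_opQ_le_div D
  have hQf := fun t ht => (hQ t ht).top_le (eLpNorm_top_le_ofReal hf')
  have hPg := fun t ht => (hP t ht).top_le (eLpNorm_top_le_ofReal hg')
  have hone : ∀ t, 0 < t → eLpNorm (paraproductTerm L D g f t) 1 μ ≤
      ENNReal.ofReal (P * (‖opQ L D t f‖ * ‖opP L D t g‖)) := fun t ht =>
    (hP t ht).one_le (eLpNorm_one_prodClass_le ((hQf t ht).trans_lt ENNReal.ofReal_lt_top))
  refine ⟨fun t ht => ?_, ⟨P * (Q₁ * ‖opApply L f‖ * (P₂ * ‖g‖)), by positivity, fun t ht => ?_⟩,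
    ⟨P * (Q₂ * ‖u‖ * (P₂ * ‖g‖)), by positivity, fun t ht => ?_⟩,
    ⟨P * (Q * (eLpNorm f ∞ μ).toReal * (P * (eLpNorm g ∞ μ).toReal)), by positivity, fun t ht => ?_⟩⟩
  · refine hC.continuousAt_opP_apply hD ht (tendsto_prodClass (B := P * (eLpNorm g ∞ μ).toReal) 
      (by positivity) (by positivity)
      (hC.continuousAt_opQ D ht f) (hC.hasDerivAt_opP hD ht g).continuousAt (hQf t ht) ?_)
    filter_upwards [Ioi_mem_nhds ht] with s hs using hPg s hs
  -- Small times: f lies in the domain of L, so Q_t f = O(t) in L².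
  · refine (hone t ht).trans (ENNReal.ofReal_le_ofReal ?_)
    have := mul_le_mul (hQ₁b t f ht hf) (hP₂b t g ht) (norm_nonneg _) (by positivity)
    calc (P : ℝ) * (‖opQ L D t f‖ * ‖opP L D t g‖)
        ≤ P * (Q₁ * ‖opApply L f‖ * t * (P₂ * ‖g‖)) := mul_le_mul_of_nonneg_left this P.2
      _ = _ := by ring
  -- Large times: f = Lu, so Q_t f = O(1/t) in L².
  · refine (hone t ht).trans (ENNReal.ofReal_le_ofReal ?_)
    have h1 := hQ₂b t u ht hu
    rw [huf] at h1
    have := mul_le_mul h1 (hP₂b t g ht) (norm_nonneg _) (by positivity)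
    calc (P : ℝ) * (‖opQ L D t f‖ * ‖opP L D t g‖)
        ≤ P * (Q₂ * ‖u‖ / t * (P₂ * ‖g‖)) := mul_le_mul_of_nonneg_left this P.2
      _ = _ := by ring
  · exact (hP t ht).top_le (eLpNorm_top_prodClass_le (by positivity) (hQf t ht) (hPg t ht))

/-- The resonant term of bounded functions in the domain and in the range of `L`. -/
theorem admissibleFamily_resonantTerm (hL : SobolevSetting L F Γ k)
    (hμ : PolynomialGrowth μ n C₀) (hC : IsAnalyticContraction L C) {D : ℕ} (hD : 0 < D)
    {f g u : Lp 𝕜 2 μ} (hf : f ∈ L.domain) (hg : g ∈ L.domain) (hu : u ∈ L.domain)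
    (huf : opApply L u = f) (hf' : eLpNorm f ∞ μ < ∞) (hg' : eLpNorm g ∞ μ < ∞) :
    AdmissibleFamily (resonantTerm L D f g) := by
  have hk := hL.hasGaussianKernel
  obtain ⟨P, hP⟩ := hk.exists_endpointBound_opP hμ hC D
  obtain ⟨Q, hQ⟩ := hk.exists_endpointBound_opQ hμ hC D
  obtain ⟨P₂, hP₂, hP₂b⟩ := hC.exists_norm_opP_le D
  obtain ⟨P₃, hP₃, hP₃b⟩ := hC.exists_norm_opP_le_div D
  have hPf := fun t ht => (hP t ht).top_le (eLpNorm_top_le_ofReal hf')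
  have hPg := fun t ht => (hP t ht).top_le (eLpNorm_top_le_ofReal hg')
  refine ⟨fun t ht => ?_, ?_, ⟨Q * (P₃ * ‖u‖ * (P₂ * ‖g‖)), by positivity, fun t ht => ?_⟩,
    ⟨Q * (P * (eLpNorm f ∞ μ).toReal * (P * (eLpNorm g ∞ μ).toReal)), by positivity, fun t ht => ?_⟩⟩
  · refine hC.continuousAt_opQ_apply D ht (tendsto_prodClass (B := P * (eLpNorm g ∞ μ).toReal) 
      (by positivity) (by positivity)
      (hC.hasDerivAt_opP hD ht f).continuousAt (hC.hasDerivAt_opP hD ht g).continuousAt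
      (hPf t ht) ?_)
    filter_upwards [Ioi_mem_nhds ht] with s hs using hPg s hs
  -- Small times: one factor (t/2)Le^{-(t/2)L} is split off from Q_t. The carré du champ identity
  -- bounds it on the product by O(t) in L¹, since P_t is bounded for the graph norm, and the
  -- remaining power of order D - 1 is bounded on L¹.
  · obtain ⟨d, rfl⟩ := Nat.exists_eq_succ_of_ne_zero hD.ne'
    obtain ⟨R, hR⟩ := hk.exists_endpointBound_heatPow hμ hC d
    obtain ⟨K, hK, hKb⟩ := hL.exists_eLpNorm_one_opApply_prodClass_le hμ hC
    have hb : ∀ {t x}, 0 < t → x ∈ L.domain → ‖opP L (d + 1) t x‖ + ‖opApply L (opP L (d + 1) t x)‖ ≤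
        P₂ * (‖x‖ + ‖opApply L x‖) := by
      intro t x ht hx
      rw [hC.opApply_opP _ ht hx, mul_add]
      exact add_le_add (hP₂b t x ht) (hP₂b t _ ht)
    set X := P₂ * (‖f‖ + ‖opApply L f‖) * (P₂ * (‖g‖ + ‖opApply L g‖)) with hX
    have hX0 : 0 ≤ X := by positivity
    refine ⟨|(cN (d + 1))⁻¹| * 2 ^ (d + 1) * (R * (2⁻¹ * (K * X))), by positivity, fun t ht => ?_⟩
    have ht2 := half_pos ht
    set Z := prodClass (opP L (d + 1) t f) (opP L (d + 1) t g) with hZ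
    have h1 : eLpNorm (opApply L (heatSemigroup L (t / 2) Z) : Lp 𝕜 2 μ) 1 μ ≤ ENNReal.ofReal (K * X) := by
      refine (hKb (t / 2) _ _ ht2 (hC.opP_mem _ ht f) (hC.opP_mem _ ht g)
        ((hPf t ht).trans_lt ENNReal.ofReal_lt_top)
        ((hPg t ht).trans_lt ENNReal.ofReal_lt_top)).trans (ENNReal.ofReal_le_ofReal ?_)
      exact mul_le_mul_of_nonneg_left (mul_le_mul (hb ht hf) (hb ht hg) (by positivity)
        (by positivity)) hK
    have h2 : eLpNorm (heatPow L 1 (t / 2) Z : Lp 𝕜 2 μ) 1 μ ≤ ENNReal.ofReal (|(t / 2) ^ 1| * (K * X)) :=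
      eLpNorm_one_smul_le ((t / 2) ^ 1) h1
    have h3 := eLpNorm_one_smul_le (cN (d + 1))⁻¹
      (eLpNorm_one_smul_le (2 ^ (d + 1)) ((hR (t / 2) ht2).one_le h2))
    rw [← hC.heatPow_succ d ht] at h3
    refine h3.trans (ENNReal.ofReal_le_ofReal (le_of_eq ?_))
    rw [pow_one, abs_of_pos ht2, abs_of_pos (by positivity : (0 : ℝ) < 2 ^ (d + 1))]
    ring
  -- Large times: already P_t f = P_t Lu = O(1/t) in L², so the product is O(1/t) in L¹.
  · refine ((hQ t ht).one_le (eLpNorm_one_prodClass_le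
      ((hPf t ht).trans_lt ENNReal.ofReal_lt_top))).trans (ENNReal.ofReal_le_ofReal ?_)
    have h1 := hP₃b t u ht hu
    rw [huf] at h1
    have := mul_le_mul h1 (hP₂b t g ht) (norm_nonneg _) (by positivity)
    calc (Q : ℝ) * (‖opP L D t f‖ * ‖opP L D t g‖)
        ≤ Q * (P₃ * ‖u‖ / t * (P₂ * ‖g‖)) := mul_le_mul_of_nonneg_left this Q.2
      _ = _ := by ring
  · exact (hQ t ht).top_le (eLpNorm_top_prodClass_le (by positivity) (hPf t ht) (hPg t ht))

/-- The derivative of `t ↦ P_t (P_t f · P_t g)`. -/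
theorem hasDerivAt_opP_prodClass (hk : HasGaussianKernel L k)
    (hμ : PolynomialGrowth μ n C₀) (hC : IsAnalyticContraction L C) {D : ℕ} (hD : 0 < D)
    {f g : Lp 𝕜 2 μ} (hf' : eLpNorm f ∞ μ < ∞) (hg' : eLpNorm g ∞ μ < ∞) {t : ℝ} (ht : 0 < t) :
    HasDerivAt (fun s => opP L D s (prodClass (opP L D s f) (opP L D s g)))
      (-(t⁻¹ • (resonantTerm L D f g t + paraproductTerm L D g f t +
        paraproductTerm L D f g t))) t := by
  obtain ⟨P, hP⟩ := hk.exists_endpointBound_opP hμ hC D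
  obtain ⟨Q, hQ⟩ := hk.exists_endpointBound_opQ hμ hC D
  obtain ⟨P₂, hP₂, hP₂b⟩ := hC.exists_norm_opP_le D
  have hPf := fun t ht => (hP t ht).top_le (eLpNorm_top_le_ofReal hf')
  have hPg := fun t ht => (hP t ht).top_le (eLpNorm_top_le_ofReal hg')
  have hQf := (hQ t ht).top_le (eLpNorm_top_le_ofReal hf')
  have hneg : -(t⁻¹ • opQ L D t f) = (-t⁻¹) • opQ L D t f := (neg_smul _ _).symm
  have hQf' : eLpNorm (-(t⁻¹ • opQ L D t f) : Lp 𝕜 2 μ) ∞ μ ≤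
      ENNReal.ofReal (t⁻¹ * (Q * (eLpNorm f ∞ μ).toReal)) := by
    rw [hneg, eLpNorm_congr_ae (Lp.coeFn_smul _ _), eLpNorm_const_smul,
      ENNReal.ofReal_mul (by positivity), ← ofReal_norm, norm_neg,
      Real.norm_of_nonneg (by positivity)]
    exact mul_le_mul_right hQf _
  have hz := hasDerivAt_prodClass (B := P * (eLpNorm g ∞ μ).toReal) 
    (by positivity) (by positivity) (by positivity)
    (hC.hasDerivAt_opP hD ht f) (hC.hasDerivAt_opP hD ht g) (hPf t ht) hQf'
    (by filter_upwards [Ioi_mem_nhds ht] with s hs using hPg s hs)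
  have hz' : prodClass (-(t⁻¹ • opQ L D t f)) (opP L D t g) +
      prodClass (opP L D t f) (-(t⁻¹ • opQ L D t g)) =
      (-t⁻¹) • (prodClass (opQ L D t f) (opP L D t g) + prodClass (opQ L D t g) (opP L D t f)) := by
    rw [hneg, prodClass_comm _ (opP L D t g),
      prodClass_smul ((hPg t ht).trans_lt ENNReal.ofReal_lt_top), ← neg_smul,
      prodClass_smul ((hPf t ht).trans_lt ENNReal.ofReal_lt_top), ← smul_add,
      prodClass_comm (opP L D t g), prodClass_comm (opP L D t f)]
  rw [hz'] at hz
  obtain ⟨T, hT⟩ := hC.exists_clm_opP D ht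
  -- Differentiating the outer P_s at the frozen product yields the resonant term; applying P_t to
  -- the derivative of the product yields the two paraproduct terms.
  refine (hasDerivAt_apply_of_bounded (K := P₂) ?_ hz (hC.hasDerivAt_opP hD ht _)
    (hC.hasDerivAt_opP hD ht _).continuousAt).congr_deriv ?_
  · filter_upwards [Ioi_mem_nhds ht] with s hs
    obtain ⟨A, hA⟩ := hC.exists_clm_opP D hs
    exact ⟨A.restrictScalars ℝ, hA, fun x => (congrArg norm (hA x)).trans_le (hP₂b s x hs)⟩
  · have e : opP L D t ((-t⁻¹) • (prodClass (opQ L D t f) (opP L D t g) +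
        prodClass (opQ L D t g) (opP L D t f))) =
        (-t⁻¹) • (paraproductTerm L D g f t + paraproductTerm L D f g t) := by
      have h1 : ∀ x, T ((-t⁻¹) • x) = (-t⁻¹) • T x := (T.restrictScalars ℝ).map_smul _
      rw [← hT, h1, map_add, hT, hT]
      rfl
    change -(t⁻¹ • resonantTerm L D f g t) + opP L D t ((-t⁻¹) • _) = _
    rw [e]
    module

/-- The product decomposition for bounded functions in the domain and in the range of `L`. -/
theorem lpClass_prodClass_eq (hL : SobolevSetting L F Γ k)
    (hμ : PolynomialGrowth μ n C₀) (hC : IsAnalyticContraction L C) {D : ℕ} (hD : 0 < D)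
    {p : ℝ≥0∞} [Fact (1 ≤ p)] (hp : 1 < p) (hp' : p < ∞)
    {f g u v : Lp 𝕜 2 μ} (hf : f ∈ L.domain) (hg : g ∈ L.domain) (hu : u ∈ L.domain)
    (hv : v ∈ L.domain) (huf : opApply L u = f) (hvg : opApply L v = g)
    (hf' : eLpNorm f ∞ μ < ∞) (hg' : eLpNorm g ∞ μ < ∞) (hw : MemLp (prodClass f g) p μ) :
    lpClass μ p (prodClass f g) =
      resonant L D p f g + paraproduct L D p g f + paraproduct L D p f g := by
  have hk := hL.hasGaussianKernel
  obtain ⟨P, hP⟩ := hk.exists_endpointBound_opP hμ hC D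
  obtain ⟨P₂, hP₂, hP₂b⟩ := hC.exists_norm_opP_le D
  obtain ⟨P₃, hP₃, hP₃b⟩ := hC.exists_norm_opP_le_div D
  have hPf := fun t ht => (hP t ht).top_le (eLpNorm_top_le_ofReal hf')
  have hPg := fun t ht => (hP t ht).top_le (eLpNorm_top_le_ofReal hg')
  have a1 := admissibleFamily_resonantTerm hL hμ hC hD hf hg hu huf hf' hg'
  have a2 := admissibleFamily_paraproductTerm hk hμ hC hD hf hu huf hf' hg'
  have a3 := admissibleFamily_paraproductTerm hk hμ hC hD hg hv hvg hg' hf'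
  rw [resonant, paraproduct, paraproduct, ← a1.lpIntegral_add a2 hp hp',
    ← (a1.add a2).lpIntegral_add a3 hp hp']
  refine (((a1.add a2).add a3).lpIntegral_eq hp hp' hw
    (fun t ht => hasDerivAt_opP_prodClass hk hμ hC hD hf' hg' ht) ?_ ?_).symm
  -- The limit at t = 0: the product tends to fg in L² and P_t tends strongly to the identity with
  -- uniform bounds.
  · refine tendsto_apply_of_bounded (K := P₂) ?_ (tendsto_prodClass (by positivity) (by positivity)
      (hC.tendsto_opP hD f) (hC.tendsto_opP hD g) (eLpNorm_top_le_ofReal hf')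
      (B := P * (eLpNorm g ∞ μ).toReal) ?_) (hC.tendsto_opP hD _)
    · filter_upwards [self_mem_nhdsWithin] with s hs x y
      obtain ⟨T, hT⟩ := hC.exists_clm_opP D hs
      rw [← hT, ← hT, ← map_sub, hT]
      exact hP₂b s _ hs
    · filter_upwards [self_mem_nhdsWithin] with s hs using hPg s hs
  -- The limit at infinity: P_t f stays bounded in L^∞, while P_t g = P_t Lv is O(1/t) in L².
  · have h1 : Tendsto (fun t : ℝ => P₂ * (P * (eLpNorm f ∞ μ).toReal * (P₃ * ‖v‖)) * t⁻¹) atTop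
        (𝓝 0) := by
      simpa using tendsto_inv_atTop_zero.const_mul (P₂ * (P * (eLpNorm f ∞ μ).toReal * (P₃ * ‖v‖)))
    refine squeeze_zero_norm' ?_ h1
    filter_upwards [eventually_gt_atTop 0] with t ht
    have h2 := hP₃b t v ht hv
    rw [hvg] at h2
    refine (hP₂b t _ ht).trans ?_
    rw [mul_assoc]
    refine mul_le_mul_of_nonneg_left ((norm_prodClass_le (by positivity) (hPf t ht) _).trans ?_) hP₂
    rw [mul_assoc _ _ t⁻¹, ← div_eq_mul_inv]
    exact mul_le_mul_of_nonneg_left h2 (by positivity)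

omit [SeparableSpace M] [BorelSpace M] [SigmaFinite μ] in
theorem IsTestFunction.eLpNorm_top_lt {p : ℝ≥0∞} {f : Lp 𝕜 2 μ} (hf : IsTestFunction L F p f) :
    eLpNorm f ∞ μ < ∞ := by
  obtain ⟨φ, hφ⟩ := hf.mem_C₀
  rw [eLpNorm_congr_ae hφ]
  refine lt_of_le_of_lt ?_ (ENNReal.ofReal_lt_top (r := ‖φ.toBCF‖))
  exact eLpNorm_exponent_top.trans_le (eLpNormEssSup_le_of_ae_bound
    (Eventually.of_forall fun x => φ.toBCF.norm_coe_le_norm x))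

end Paraproducts

/-! ### The product decomposition -/

theorem mainTheorem8 {𝕜 M : Type*} [RCLike 𝕜] [MetricSpace M] [LocallyCompactSpace M]
    [SeparableSpace M] [MeasurableSpace M] [BorelSpace M]
    (μ : Measure M) [IsFiniteMeasureOnCompacts μ] [μ.IsOpenPosMeasure]
    (hμ : VolumeDoubling μ) (ν : ℝ) (hν : 0 < ν) (hμν : VolumeDimension μ ν)
    (L : Lp 𝕜 2 μ →ₗ.[𝕜] Lp 𝕜 2 μ) (F : Submodule ℝ (Lp 𝕜 2 μ))
    (Γ : F →ₗ[ℝ] F →ₗ[ℝ] (M →ₘ[μ] 𝕜)) (k : ℝ → M → M → 𝕜)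
    (hL : SobolevSetting L F Γ k)
    (D : ℕ) (hD : 4 * ν < D)
    (p : ℝ≥0∞) [Fact (1 ≤ p)] (hp : 1 < p) (hp' : p < ∞)
    (f g : Lp 𝕜 2 μ) (hf : IsTestFunction L F p f) (hg : IsTestFunction L F p g) :
    -- all the products are in `L²`, so that the operators apply to them
    (∀ t : ℝ, 0 < t →
      MemLp (fun x => opP L D t f x * opP L D t g x) 2 μ ∧
      MemLp (fun x => opQ L D t f x * opP L D t g x) 2 μ ∧
      MemLp (fun x => opQ L D t g x * opP L D t f x) 2 μ) ∧
    -- the integrals that define `Π(f, g)`, `Π_g(f)` and `Π_f(g)` converge in `L^p`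
    ConvergesAbsolutely p (resonantTerm L D f g) ∧
    ConvergesAbsolutely p (paraproductTerm L D g f) ∧
    ConvergesAbsolutely p (paraproductTerm L D f g) ∧
    -- `f g = Π(f, g) + Π_g(f) + Π_f(g)` in `L^p`
    MemLp (fun x => f x * g x) p μ ∧
    lpClass μ p (fun x => f x * g x) =
      resonant L D p f g + paraproduct L D p g f + paraproduct L D p f g := by

  have : IsLocallyFiniteMeasure μ := isLocallyFiniteMeasure_of_isFiniteMeasureOnCompacts
  have : SecondCountableTopology M := UniformSpace.secondCountable_of_separable M
  have : SigmaFinite μ := inferInstance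
  have hD0 : 0 < D := by
    have : (0 : ℝ) < D := lt_trans (by positivity) hD
    exact_mod_cast this
  obtain ⟨n, C₀, hP⟩ := hμν.exists_polynomialGrowth
  obtain ⟨ω, hω, hω', hacc⟩ := hL.accretive
  obtain ⟨C, hC⟩ := hacc.exists_isAnalyticContraction hω hω' hL.dense
  have hk := hL.hasGaussianKernel
  obtain ⟨hfd, -⟩ := hf.image_memLp
  obtain ⟨hgd, -⟩ := hg.image_memLp
  obtain ⟨u, hu, -⟩ := hf.eq_image
  obtain ⟨v, hv, -⟩ := hg.eq_image
  have hu' : opApply L (u : Lp 𝕜 2 μ) = f := (opApply_of_mem u.2).trans hu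
  have hv' : opApply L (v : Lp 𝕜 2 μ) = g := (opApply_of_mem v.2).trans hv
  have hfb := hf.eLpNorm_top_lt
  have hgb := hg.eLpNorm_top_lt
  -- The product lies in L¹, as f and g are in L², and in L^∞, as both are in C₀; hence it lies in
  -- L^p.
  have hw : MemLp (prodClass f g) p μ :=
    ⟨Lp.aestronglyMeasurable _, (eLpNorm_le_of_one_of_top hp hp' (by positivity) (by positivity)
      (eLpNorm_one_prodClass_le hfb) (eLpNorm_top_prodClass_le ENNReal.toReal_nonneg
        (eLpNorm_top_le_ofReal hfb) (eLpNorm_top_le_ofReal hgb))).trans_lt ENNReal.ofReal_lt_top⟩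
  have hfg : prodClass f g =ᵐ[μ] fun x => f x * g x := coeFn_prodClass hfb
  have hw' : MemLp (fun x => f x * g x) p μ := hw.ae_eq hfg
  obtain ⟨A, hA⟩ := hk.exists_endpointBound_opP hP hC D
  obtain ⟨B, hB⟩ := hk.exists_endpointBound_opQ hP hC D
  have hPb : ∀ {t} {x : Lp 𝕜 2 μ}, 0 < t → eLpNorm x ∞ μ < ∞ → eLpNorm (opP L D t x : Lp 𝕜 2 μ) ∞ μ < ∞ :=
    fun ht hx => ((hA _ ht).top_le (eLpNorm_top_le_ofReal hx)).trans_lt ENNReal.ofReal_lt_top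
  have hQb : ∀ {t} {x : Lp 𝕜 2 μ}, 0 < t → eLpNorm x ∞ μ < ∞ → eLpNorm (opQ L D t x : Lp 𝕜 2 μ) ∞ μ < ∞ :=
    fun ht hx => ((hB _ ht).top_le (eLpNorm_top_le_ofReal hx)).trans_lt ENNReal.ofReal_lt_top
  refine ⟨fun t ht => ⟨memLp_mul_left (hPb ht hfb), memLp_mul_left (hQb ht hfb),
    memLp_mul_left (hQb ht hgb)⟩,
    (admissibleFamily_resonantTerm hL hP hC hD0 hfd hgd u.2 hu' hfb hgb).convergesAbsolutely hp hp',
    (admissibleFamily_paraproductTerm hk hP hC hD0 hfd u.2 hu' hfb hgb).convergesAbsolutely hp hp',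
    (admissibleFamily_paraproductTerm hk hP hC hD0 hgd v.2 hv' hgb hfb).convergesAbsolutely hp hp',
    hw', ?_⟩
  rw [← lpClass_prodClass_eq hL hP hC hD0 hp hp' hfd hgd u.2 v.2 hu' hv' hfb hgb hw,
    lpClass_of_memLp hw, lpClass_of_memLp hw']
  exact (MemLp.toLp_eq_toLp_iff _ _).2 hfg.symm
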